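/- Let $K$ be a number field with algebraic closure $\overline K$ and $\Gamma=\mathrm{Gal}(\overline K/K)$. For a finite place $v$ let $K_v$ be the completion, $p_v$ the residue characteristic and $n_v$ the degree of the residue field $k_v$ over $\mathbb F_{p_v}$; if $v$ is unramified over $\mathbb Q$, let $\sigma_v$ be the Frobenius automorphism of $K_v$ (the automorphism that preserves $\mathcal O_{K_v}$ and induces $x\mapsto x^{p_v}$ on $k_v$). **Target category.** An object of the Ogus category $\mathbf{Og}(K)$ is a triple $(V,(V_v,F_v)_{v\in\mathcal P'},(g_v)_{v\in\mathcal P'})$, where $\mathcal P'$ is a cofinite set of places unramified over $\mathbb Q$, $V$ is a finite dimensional $K$-vector space, $V_v$ is a finite dimensional $K_v$-vector space, $F_v\colon V_v\to V_v$ is bijective and $\sigma_v$-semilinear, and $g_v\colon V\otimes_KK_v\to V_v$ is a $K_v$-linear isomorphism. A morphism is a $K$-linear map $f\colon V\to V'$ such that for almost all $v$ the $K_v$-linear map $f_v\colon V_v\to V'_v$ corresponding to $f\otimes K_v$ under $g_v,g'_v$ satisfies $f_vF_v=F'_vf_v$. An object of $\mathbf{FOg}(K)$ is an object of $\mathbf{Og}(K)$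 with a finite increasing exhaustive filtration $0=W_m\subseteq\dots\subseteq W_n=V$ by subobjects in $\mathbf{Og}(K)$ such that, for each $i$ and almost all $v$, the eigenvalues of the $K_v$-linear map $F_v^{n_v}$ on $W_iV_v/W_{i-1}V_v$ are algebraic numbers all of whose complex conjugates have absolute value $p_v^{in_v/2}$; morphisms in $\mathbf{FOg}(K)$ are the morphisms in $\mathbf{Og}(K)$. **Source category.** $\mathcal M_{0,\mathbb Q}$ is the category of Artin motives up to isogeny, i.e. of $1$-motives $[L\to0]$ over $K$: its objects are the lattices over $K$, that is, free abelian groups $L$ of finite rank with a continuous (discrete) action of $\Gamma$, and the morphisms from $[L\to 0]$ to $[L'\to0]$ are the elements of $\mathrm{Hom}_\Gamma(L,L')\otimes_{\mathbb Z}\mathbb Q$. **Functor.** The Ogus realization $T_{\mathrm{Og}}\colon\mathcal M_{0,\mathbb Q}\to\mathbf{FOg}(K)$ sends $[L\to0]$ to the following object. Put $V=T_{\mathrm{dR}}([L\to0])=(L\otimes\overline K)^{\Gamma}$. Let $E\subset\overline K$ be the finite Galois extension of $K$ that is fixed by the kernel of $\Gamma\to\mathrm{Aut}(L)$, and let $\mathcal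 P'$ be the set of places $v$ that are unramified over $\mathbb Q$ and unramified in $E$. For $v\in\mathcal P'$ let $V_v=(L\otimes K_v\otimes_K\overline K)^{\Gamma}=(L\otimes K_v\otimes_KE)^{\mathrm{Gal}(E/K)}$, let $g_v$ be the canonical isomorphism, and let $F_v$ be the restriction of $1\otimes\varphi_v$, where $\varphi_v$ is the unique automorphism of $K_v\otimes_KE$ that preserves $\mathcal O_{K_v}\otimes_{\mathcal O_K}\mathcal O_E$ and induces $x\mapsto x^{p_v}$ on its quotient modulo $p_v$. The filtration is $W_i=0$ for $i<0$ and $W_i=V$ for $i\ge0$. On morphisms, $T_{\mathrm{Og}}(f\otimes q)$ is the restriction to $V$ of $q\cdot(f\otimes\mathrm{id}_{\overline K})$. **Lemma.** The functor $T_{\mathrm{Og}}\colon\mathcal M_{0,\mathbb Q}\to\mathbf{FOg}(K)$ is full. -/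

import Mathlib

noncomputable section

namespace OgusRealization

open IsDedekindDomain NumberField TensorProduct CategoryTheory Filter
open scoped WithZero

set_option linter.unusedSectionVars false

universe u

/-! ## Frobenius lifts on strict `p`-rings -/

section

/-- `σ` preserves the subring `A` of `B` and lifts the `p`-th power map of `A / p A`. -/
def IsFrobeniusLift {B : Type*} [CommRing B] (p : ℕ) (A : Subring B) (σ : B ≃+* B) : Prop :=
  ∀ a ∈ A, σ a ∈ A ∧ ∃ c ∈ A, σ a = a ^ p + p * c

open Classical in
/-- The automorphism of `B` that lifts the Frobenius of `A / p A`, if there is one. In the situation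
of `IsStrict` below, it exists and is unique. -/
def frobeniusLift {B : Type*} [CommRing B] (p : ℕ) (A : Subring B) : B ≃+* B :=
  if h : ∃ σ : B ≃+* B, IsFrobeniusLift p A σ then h.choose else RingEquiv.refl B

/-- `A` is a strict `p`-ring with perfect residue ring `A/p`, and `B = A[1/p]`. -/
structure IsStrict {B : Type*} [CommRing B] (p : ℕ) (A : Subring B) : Prop where
  complete : IsAdicComplete (Ideal.span {(p : A)}) A
  isUnit : IsUnit (p : B)
  not_isUnit : ¬ IsUnit (p : A)
  exists_pow : ∀ b : B, ∃ n : ℕ, (p : B) ^ n * b ∈ A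
  surj : ∀ a : A, ∃ b c : A, a = b ^ p + p * c
  inj : ∀ a c : A, a ^ p = p * c → ∃ d : A, a = p * d

open WittVector in
/-- A strict `p`-ring with perfect residue ring carries a lift of Frobenius. -/
theorem exists_lift {A : Type*} [CommRing A] (p : ℕ) [Fact p.Prime]
    (complete : IsAdicComplete (Ideal.span {(p : A)}) A) (not_isUnit : ¬ IsUnit (p : A))
    (tf : ∀ a : A, p * a = 0 → a = 0)
    (surj : ∀ a : A, ∃ b c : A, a = b ^ p + p * c)
    (inj : ∀ a c : A, a ^ p = p * c → ∃ d : A, a = p * d) :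
    ∃ φ : A ≃+* A, ∀ a, ∃ c, φ a = a ^ p + p * c := by
  have : Fact (¬ IsUnit (p : A)) := ⟨not_isUnit⟩
  have hF : Function.Surjective (frobenius (ModP A p) p) := by
    intro x
    obtain ⟨a, rfl⟩ := Ideal.Quotient.mk_surjective x
    obtain ⟨b, c, h⟩ := surj a
    refine ⟨Ideal.Quotient.mk _ b, ?_⟩
    rw [frobenius_def, ← map_pow]
    apply Ideal.Quotient.eq.mpr
    rw [Ideal.mem_span_singleton]
    exact ⟨-c, by rw [h]; ring⟩
  have hI : ∀ x : ModP A p, x ^ p = 0 → x = 0 := by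
    intro x hx
    obtain ⟨a, rfl⟩ := Ideal.Quotient.mk_surjective x
    rw [← map_pow] at hx
    have hx' := Ideal.Quotient.eq_zero_iff_mem.mp hx
    rw [Ideal.mem_span_singleton] at hx'
    obtain ⟨c, hc⟩ := hx'
    obtain ⟨d, hd⟩ := inj a c hc
    apply Ideal.Quotient.eq_zero_iff_mem.mpr
    rw [Ideal.mem_span_singleton]
    exact ⟨d, hd⟩
  have hs := surjective_fontaineTheta (R := A) (p := p) hF
  have h0 : ∀ x : WittVector p (PreTilt A p), fontaineTheta A p x = 0 →
      ∃ y, x = p * y ∧ fontaineTheta A p y = 0 := by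
    intro x hx
    have h1 := mk_fontaineTheta (R := A) (p := p) x
    rw [hx, map_zero] at h1
    have h2' : ∀ n, PreTilt.coeff n (x.coeff 0) = 0 := by
      intro n
      induction n with
      | zero => exact h1.symm
      | succ n ih =>
        apply hI
        rw [← ih]
        exact Perfection.coeff_pow_p' _ _
    have h2 : x.coeff 0 = 0 := Perfection.ext fun n => (h2' n).trans (map_zero (PreTilt.coeff n)).symm
    have h3 := (mem_span_p_iff_coeff_zero_eq_zero x).mpr h2
    rw [Ideal.mem_span_singleton] at h3
    obtain ⟨y, hy⟩ := h3
    refine ⟨y, hy, tf _ ?_⟩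
    rw [hy, map_mul, map_natCast] at hx
    exact hx
  have hinj : Function.Injective (fontaineTheta A p) := by
    rw [injective_iff_map_eq_zero]
    intro x hx
    have h4 : ∀ n : ℕ, ∀ x, fontaineTheta A p x = 0 → ∃ y, x = (p : WittVector p (PreTilt A p)) ^ n * y := by
      intro n
      induction n with
      | zero => intro x _; exact ⟨x, by simp⟩
      | succ n ih =>
        intro x hx
        obtain ⟨y, rfl, hy⟩ := h0 x hx
        obtain ⟨z, rfl⟩ := ih y hy
        exact ⟨z, by ring⟩
    ext n
    obtain ⟨y, hy⟩ := h4 (n+1) x hx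
    have := (mem_span_p_pow_iff_le_coeff_eq_zero x (n+1)).mp
      (by rw [Ideal.mem_span_singleton]; exact ⟨y, hy⟩) n (by omega)
    simpa using this
  let θ := RingEquiv.ofBijective (fontaineTheta A p) ⟨hinj, hs⟩
  refine ⟨(θ.symm.trans (WittVector.frobeniusEquiv p (PreTilt A p))).trans θ, fun a => ?_⟩
  obtain ⟨x, rfl⟩ := θ.surjective a
  have h5 : (WittVector.frobenius x - x ^ p).coeff 0 = 0 := by
    have : constantCoeff (WittVector.frobenius x - x ^ p) = 0 := by
      rw [map_sub, map_pow]
      change (WittVector.frobenius x).coeff 0 - x.coeff 0 ^ p = 0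
      rw [coeff_frobenius_charP, sub_self]
    exact this
  have h3 := (mem_span_p_iff_coeff_zero_eq_zero _).mpr h5
  rw [Ideal.mem_span_singleton] at h3
  obtain ⟨y, hy⟩ := h3
  refine ⟨θ y, ?_⟩
  simp only [RingEquiv.coe_trans, Function.comp_apply, RingEquiv.symm_apply_apply]
  rw [← map_pow, ← map_natCast θ p, ← map_mul, ← map_add, ← hy]
  congr 1
  change WittVector.frobenius x = _
  ring

theorem IsStrict.exists_isFrobeniusLift {B : Type*} [CommRing B] {p : ℕ} [hp : Fact p.Prime]
    {A : Subring B} (h : IsStrict p A) : ∃ σ : B ≃+* B, IsFrobeniusLift p A σ := by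
  have tf : ∀ a : A, p * a = 0 → a = 0 := by
    intro a ha
    have := congrArg Subtype.val ha
    simp only [Subring.coe_mul, Subring.coe_natCast, ZeroMemClass.coe_zero] at this
    exact Subtype.ext ((h.isUnit.mul_right_eq_zero).mp this)
  obtain ⟨φ, hφ⟩ := exists_lift p h.complete h.not_isUnit tf h.surj h.inj
  let : Algebra A B := A.subtype.toAlgebra
  have hmap : ∀ a : A, algebraMap A B a = a := fun _ => rfl
  have : IsLocalization.Away (p : A) B := by
    refine ⟨?_, ?_, ?_⟩
    · rintro ⟨_, n, rfl⟩
      simpa [hmap] using h.isUnit.pow n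
    · intro b
      obtain ⟨n, hn⟩ := h.exists_pow b
      exact ⟨(⟨_, hn⟩, ⟨_, n, rfl⟩), by simp [hmap, mul_comm]⟩
    · intro x y hxy
      exact ⟨1, by rw [Subtype.ext hxy]⟩
  have hH : (Submonoid.powers (p : A)).map (φ : A ≃+* A).toMonoidHom = Submonoid.powers (p : A) := by
    rw [Submonoid.map_powers]
    simp
  refine ⟨IsLocalization.ringEquivOfRingEquiv B B φ hH, fun a ha => ?_⟩
  have : IsLocalization.ringEquivOfRingEquiv B B φ hH a = φ ⟨a, ha⟩ := by
    exact IsLocalization.ringEquivOfRingEquiv_eq (S := B) (Q := B) hH ⟨a, ha⟩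
  rw [this]
  obtain ⟨c, hc⟩ := hφ ⟨a, ha⟩
  refine ⟨(φ ⟨a, ha⟩).2, c, c.2, ?_⟩
  rw [hc]; simp

theorem IsStrict.isFrobeniusLift {B : Type*} [CommRing B] {p : ℕ} [hp : Fact p.Prime]
    {A : Subring B} (h : IsStrict p A) : IsFrobeniusLift p A (frobeniusLift p A) := by
  have h' := h.exists_isFrobeniusLift
  unfold frobeniusLift
  rw [dif_pos h']
  exact h'.choose_spec

/-- Homomorphisms that agree modulo `p` are equal. -/
theorem IsStrict.hom_ext {B B' : Type*} [CommRing B] [CommRing B'] {p : ℕ} [hp : Fact p.Prime]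
    {A : Subring B} {A' : Subring B'} (h : IsStrict p A) (h' : IsStrict p A')
    (f g : B →+* B') (hf : ∀ a ∈ A, f a ∈ A') (hg : ∀ a ∈ A, g a ∈ A')
    (hfg : ∀ a ∈ A, ∃ c ∈ A', f a = g a + p * c) : f = g := by
  have key : ∀ n : ℕ, ∀ a ∈ A, ∃ c ∈ A', f a = g a + (p : B') ^ (n + 1) * c := by
    intro n
    induction n with
    | zero => simpa using hfg
    | succ n ih =>
      intro a ha
      obtain ⟨b, c, hbc⟩ := h.surj ⟨a, ha⟩
      have hbc' : a = (b : B) ^ p + p * c := by simpa using congrArg Subtype.val hbc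
      obtain ⟨d, hd, hd'⟩ := ih b b.2
      obtain ⟨e, he, he'⟩ := ih c c.2
      have h1 : ∃ u ∈ A', (g b + (p : B') ^ (n + 1) * d) ^ p = g b ^ p + (p : B') ^ (n + 2) * u := by
        obtain ⟨r, hr⟩ := exists_add_pow_prime_eq hp.out (⟨g b, hg _ b.2⟩ : A')
          ((p : A') ^ (n + 1) * ⟨d, hd⟩)
        have hr' := congrArg Subtype.val hr
        simp only [Subring.coe_add, Subring.coe_mul, Subring.coe_pow, Subring.coe_natCast] at hr'
        obtain ⟨k, hk⟩ : ∃ k, (n + 1) * p = n + 2 + k :=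
          Nat.exists_eq_add_of_le (by nlinarith [hp.out.two_le])
        refine ⟨p ^ k * d ^ p + g b * d * r, ?_, ?_⟩
        · exact add_mem (mul_mem (pow_mem (natCast_mem A' p) _) (pow_mem hd _))
            (mul_mem (mul_mem (hg _ b.2) hd) r.2)
        · rw [hr', mul_pow, ← pow_mul, hk]
          ring
      obtain ⟨u, hu, hu'⟩ := h1
      refine ⟨u + e, add_mem hu he, ?_⟩
      rw [hbc', map_add, map_pow, map_mul, map_natCast, map_add, map_pow, map_mul, map_natCast,
        hd', he', hu']
      ring
  have hA : ∀ a ∈ A, f a = g a := by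
    intro a ha
    have := h'.complete.toIsHausdorff.haus (⟨f a, hf a ha⟩ - ⟨g a, hg a ha⟩ : A') (fun n => by
      rw [SModEq.zero, smul_eq_mul, Ideal.mul_top, Ideal.span_singleton_pow, Ideal.mem_span_singleton]
      obtain ⟨c, hc, e⟩ := key n a ha
      refine ⟨p * ⟨c, hc⟩, Subtype.ext ?_⟩
      simp [e]; ring)
    have := congrArg Subtype.val this
    exact sub_eq_zero.mp (by simpa using this)
  ext b
  obtain ⟨n, hn⟩ := h.exists_pow b
  have h1 := hA _ hn
  simp only [map_mul, map_pow, map_natCast] at h1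
  exact (h'.isUnit.pow n).mul_left_cancel h1

end

/-! ## A criterion for strict `p`-rings -/

section

/-- A criterion for `IsStrict`. -/
theorem IsStrict.mk' {R B : Type*} [CommRing R] [CommRing B] {p : ℕ} [hp : Fact p.Prime]
    {A : Subring B} (I : Ideal R) [Finite (R ⧸ I)] [IsReduced (R ⧸ I)] (hpI : (p : R) ∈ I)
    (f : R →+* B) (hfA : ∀ r, f r ∈ A) (hI : ∀ r ∈ I, ∃ c ∈ A, f r = p * c)
    (hd : ∀ a ∈ A, ∃ r, ∃ c ∈ A, a = f r + p * c)
    (complete : IsAdicComplete (Ideal.span {(p : A)}) A) (isUnit : IsUnit (p : B))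
    (not_isUnit : ¬ IsUnit (p : A)) (exists_pow : ∀ b : B, ∃ n : ℕ, (p : B) ^ n * b ∈ A) :
    IsStrict p A ∧
      (∀ m : ℕ, (∀ x : R ⧸ I, x ^ p ^ m = x) → ∀ a ∈ A, ∃ c ∈ A, a ^ p ^ m = a + p * c) ∧
      ∃ m : ℕ, 0 < m ∧ ∀ x : R ⧸ I, x ^ p ^ m = x := by
  have hI1 : I ≠ ⊤ := by
    intro h
    obtain ⟨c, hc, h1⟩ := hI 1 (h ▸ Submodule.mem_top)
    rw [map_one] at h1
    exact not_isUnit (IsUnit.of_mul_eq_one ⟨c, hc⟩ (Subtype.ext (by simpa using h1.symm)))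
  have hpR : ((p : ℕ) : R ⧸ I) = 0 := by
    rw [← map_natCast (Ideal.Quotient.mk I)]
    exact Ideal.Quotient.eq_zero_iff_mem.mpr hpI
  have : Nontrivial (R ⧸ I) := Ideal.Quotient.nontrivial_iff.mpr hI1
  have : CharP (R ⧸ I) p := (CharP.charP_iff_prime_eq_zero hp.out).mpr hpR
  have hinj : Function.Injective (frobenius (R ⧸ I) p) := frobenius_inj _ _
  have hbij : Function.Bijective (frobenius (R ⧸ I) p) := Finite.injective_iff_bijective.mp hinj
  -- Frobenius on A/p
  have hsurj : ∀ a : A, ∃ b c : A, a = b ^ p + p * c := by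
    intro a
    obtain ⟨r, c, hc, h1⟩ := hd a a.2
    obtain ⟨s, hs⟩ := hbij.2 (Ideal.Quotient.mk I r)
    obtain ⟨s, rfl⟩ := Ideal.Quotient.mk_surjective s
    rw [frobenius_def, ← map_pow] at hs
    obtain ⟨d, hd, h2⟩ := hI _ (Ideal.Quotient.eq.mp hs)
    refine ⟨⟨f s, hfA s⟩, ⟨c, hc⟩ - ⟨d, hd⟩, Subtype.ext ?_⟩
    rw [map_sub, map_pow] at h2
    simp only [Subring.coe_add, Subring.coe_pow, Subring.coe_mul, Subring.coe_natCast,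
      AddSubgroupClass.coe_sub]
    linear_combination h1 - h2
  obtain ⟨m, hm, hm'⟩ : ∃ m : ℕ, 0 < m ∧ ∀ x : R ⧸ I, x ^ p ^ m = x := by
    let e : Equiv.Perm (R ⧸ I) := Equiv.ofBijective _ hbij
    obtain ⟨m, hm, h⟩ := (isOfFinOrder_of_finite e).exists_pow_eq_one
    refine ⟨m, hm, fun x => ?_⟩
    have := congrArg (fun g : Equiv.Perm (R ⧸ I) => g x) h
    rw [← iterate_frobenius]
    simpa [Equiv.Perm.coe_pow, e, ← Equiv.Perm.iterate_eq_pow] using this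
  have hpow : ∀ m : ℕ, (∀ x : R ⧸ I, x ^ p ^ m = x) →
      ∀ a ∈ A, ∃ c ∈ A, a ^ p ^ m = a + p * c := by
    intro m hm' a ha
    obtain ⟨r, c, hc, h1⟩ := hd a ha
    have h2 : Ideal.Quotient.mk I (r ^ p ^ m) = Ideal.Quotient.mk I r := by
      rw [map_pow, hm']
    obtain ⟨d, hd, h3⟩ := hI _ (Ideal.Quotient.eq.mp h2)
    rw [map_sub, map_pow] at h3
    have h4 : ∃ u ∈ A, a ^ p ^ m = (f r) ^ p ^ m + p * u := by
      have : (p : A) ∣ (⟨a, ha⟩ : A) ^ p ^ m - (⟨f r, hfA r⟩ : A) ^ p ^ m :=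
        dvd_trans ⟨⟨c, hc⟩, Subtype.ext (by simp [h1])⟩ (sub_dvd_pow_sub_pow _ _ _)
      obtain ⟨u, hu⟩ := this
      have hu' := congrArg Subtype.val hu
      simp only [AddSubgroupClass.coe_sub, Subring.coe_pow, Subring.coe_mul,
        Subring.coe_natCast] at hu'
      exact ⟨u, u.2, by linear_combination hu'⟩
    obtain ⟨u, hu, h5⟩ := h4
    refine ⟨u + d - c, sub_mem (add_mem hu hd) hc, ?_⟩
    rw [h5]
    linear_combination h3 - h1
  refine ⟨⟨complete, isUnit, not_isUnit, exists_pow, hsurj, ?_⟩, hpow, m, hm, hm'⟩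
  intro a c hac
  obtain ⟨d, hd, h1⟩ := hpow m hm' a a.2
  obtain ⟨k, hk⟩ : ∃ k, p ^ m = p + k :=
    Nat.exists_eq_add_of_le (by simpa using Nat.pow_le_pow_right hp.out.pos hm)
  refine ⟨c * a ^ k - ⟨d, hd⟩, Subtype.ext ?_⟩
  have hac' := congrArg Subtype.val hac
  simp only [Subring.coe_pow, Subring.coe_mul, Subring.coe_natCast] at hac'
  rw [hk, pow_add, hac'] at h1
  simp only [AddSubgroupClass.coe_sub, Subring.coe_pow, Subring.coe_mul, Subring.coe_natCast]
  linear_combination -h1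

theorem IsStrict.frobeniusLift_pow {B : Type*} [CommRing B] {p : ℕ} [hp : Fact p.Prime]
    {A : Subring B} (h : IsStrict p A) (m : ℕ)
    (hm : ∀ a ∈ A, ∃ c ∈ A, a ^ p ^ m = a + p * c) (b : B) :
    (frobeniusLift p A)^[m] b = b := by
  have hl := h.isFrobeniusLift
  have key : ∀ n : ℕ, ∀ a ∈ A, (frobeniusLift p A)^[n] a ∈ A ∧
      ∃ c ∈ A, (frobeniusLift p A)^[n] a = a ^ p ^ n + p * c := by
    intro n
    induction n with
    | zero => intro a ha; exact ⟨ha, 0, zero_mem _, by simp⟩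
    | succ n ih =>
      intro a ha
      obtain ⟨h1, c, hc, h2⟩ := ih a ha
      obtain ⟨h3, d, hd, h4⟩ := hl _ h1
      obtain ⟨h5, e, he, h6⟩ := hl _ (pow_mem ha (p ^ n))
      rw [Function.iterate_succ_apply']
      refine ⟨h3, frobeniusLift p A c + e, add_mem (hl c hc).1 he, ?_⟩
      rw [h2, map_add, h6, map_mul, map_natCast, pow_succ p n, pow_mul]
      ring
  have h0 : ((frobeniusLift p A : B →+* B) ^ m : B →+* B) = RingHom.id B := by
    apply h.hom_ext h
    · intro a ha
      rw [RingHom.coe_pow]; exact (key m a ha).1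
    · intro a ha; exact ha
    · intro a ha
      obtain ⟨_, c, hc, h1⟩ := key m a ha
      obtain ⟨d, hd, h2⟩ := hm a ha
      refine ⟨c + d, add_mem hc hd, ?_⟩
      rw [RingHom.coe_pow]
      change (frobeniusLift p A)^[m] a = a + _
      rw [h1, h2]; ring
  have h1 := congrArg (fun g : B →+* B => g b) h0
  rw [RingHom.coe_pow] at h1
  exact h1

end

/-! ## The completions `K_v` and their Frobenius automorphisms -/

section

variable {K : Type*} [Field K] [NumberField K]

/-- The residue characteristic `p_v`. -/
def residueChar (v : HeightOneSpectrum (𝓞 K)) : ℕ := ringChar (𝓞 K ⧸ v.asIdeal)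

/-- The degree `n_v` of the residue field over its prime field. -/
def residueDegree (v : HeightOneSpectrum (𝓞 K)) : ℕ := v.asIdeal.inertiaDeg ℤ

/-- The canonical Frobenius automorphism `σ_v` of `K_v` (for `v` unramified over `ℚ`): it preserves
`𝒪_{K_v}` and lifts the `p_v`-th power map of `𝒪_{K_v} / p_v`. -/
def frob (v : HeightOneSpectrum (𝓞 K)) : v.adicCompletion K ≃+* v.adicCompletion K :=
  frobeniusLift (residueChar v) (v.adicCompletionIntegers K).toSubring

/-- The place `v` is unramified over `ℚ`. -/
def IsUnramified (v : HeightOneSpectrum (𝓞 K)) : Prop := Algebra.IsUnramifiedAt ℤ v.asIdeal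

instance finite_residue (v : HeightOneSpectrum (𝓞 K)) : Finite (𝓞 K ⧸ v.asIdeal) :=
  v.asIdeal.finiteQuotientOfFreeOfNeBot v.ne_bot

instance fact_prime_residueChar (v : HeightOneSpectrum (𝓞 K)) : Fact (residueChar v).Prime := by
  have := v.isPrime
  exact ⟨CharP.char_is_prime (𝓞 K ⧸ v.asIdeal) _⟩

theorem residueChar_mem (v : HeightOneSpectrum (𝓞 K)) : (residueChar v : 𝓞 K) ∈ v.asIdeal := by
  rw [← Ideal.Quotient.eq_zero_iff_mem, map_natCast]
  exact CharP.cast_eq_zero _ _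

theorem liesOver_residueChar (v : HeightOneSpectrum (𝓞 K)) :
    v.asIdeal.LiesOver (Ideal.span {(residueChar v : ℤ)}) :=
  (Ideal.liesOver_span_iff v.isPrime.ne_top (Nat.prime_iff_prime_int.mp (Fact.out))).mpr
    (by simpa using residueChar_mem v)

/-- An unramified prime does not occur with multiplicity. -/
theorem not_le_sq {R S : Type*} [CommRing R] [CommRing S] [Algebra R S] [IsDedekindDomain S]
    [Algebra.EssFiniteType R S] (P : Ideal S) [P.IsPrime] (hP : P ≠ ⊥)
    (p : Ideal R) [p.IsPrime] [P.LiesOver p] (h : Algebra.IsUnramifiedAt R P) :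
    ¬ p.map (algebraMap R S) ≤ P ^ 2 := by
  let := Localization.AtPrime.algebraOfLiesOver p P
  have h1 := ((Algebra.isUnramifiedAt_iff_map_eq R p P).mp h).2
  have hle : p.map (algebraMap R S) ≤ P := by
    rw [Ideal.map_le_iff_le_comap]; exact (Ideal.LiesOver.over (p := p) (P := P)).le
  rw [← Ideal.ramificationIdx'_ne_one_iff hle, not_not]
  exact (Ideal.IsDedekindDomain.ramificationIdx'_eq_one_iff hP hle).mpr h1

theorem valued_residueChar {v : HeightOneSpectrum (𝓞 K)} (hv : IsUnramified v) :
    Valued.v ((residueChar v : ℕ) : v.adicCompletion K) = WithZero.exp (-1 : ℤ) := by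
  have := liesOver_residueChar v
  have := v.isPrime
  have hprime : (Ideal.span {(residueChar v : ℤ)}).IsPrime :=
    (Ideal.span_singleton_prime (by exact_mod_cast (Fact.out : (residueChar v).Prime).ne_zero)).mpr
      (Nat.prime_iff_prime_int.mp Fact.out)
  have h1 := not_le_sq v.asIdeal v.ne_bot (Ideal.span {(residueChar v : ℤ)}) hv
  rw [Ideal.map_span, Set.image_singleton, Ideal.span_singleton_le_iff_mem,
    ← v.intValuation_le_pow_iff_mem] at h1
  have h2 : v.intValuation (residueChar v : 𝓞 K) ≤ WithZero.exp (-(1:ℕ) : ℤ) :=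
    (v.intValuation_le_pow_iff_mem _ 1).mpr (by simpa using residueChar_mem v)
  have h3 : Valued.v ((residueChar v : ℕ) : v.adicCompletion K)
      = v.intValuation (residueChar v : 𝓞 K) := by
    rw [← v.valuation_of_algebraMap (K := K), ← HeightOneSpectrum.valuedAdicCompletion_eq_valuation]
    simp
  rw [h3]
  simp only [eq_intCast, Int.cast_natCast, not_le] at h1
  apply le_antisymm (by simpa using h2)
  have hne : v.intValuation (residueChar v : 𝓞 K) ≠ 0 := by
    intro h; rw [h] at h1; simp at h1
  rw [← WithZero.exp_log hne] at h1 ⊢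
  rw [WithZero.exp_lt_exp] at h1
  rw [WithZero.exp_le_exp]
  push_cast at h1
  omega

theorem ball_mem_nhds {v : HeightOneSpectrum (𝓞 K)} (hv : IsUnramified v)
    (L : v.adicCompletion K) (n : ℕ) :
    {y | Valued.v (y - L) < WithZero.exp (-n : ℤ)} ∈ nhds L := by
  have hp : Valued.v (((residueChar v : ℕ) : v.adicCompletion K) ^ n) = WithZero.exp (-n : ℤ) := by
    rw [map_pow, valued_residueChar hv, ← WithZero.exp_nsmul]; simp
  rw [Valued.mem_nhds]
  have h0 : (Valued.v (R := v.adicCompletion K)).restrict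
      (((residueChar v : ℕ) : v.adicCompletion K) ^ n) ≠ 0 := by
    rw [Ne, Valuation.restrict_eq_zero_iff, hp]; exact WithZero.exp_ne_zero
  refine ⟨Units.mk0 _ h0, fun y hy => ?_⟩
  rw [← hp]
  exact (Valuation.restrict_lt_iff _).mp hy

theorem isAdicComplete_integers {v : HeightOneSpectrum (𝓞 K)} (hv : IsUnramified v) :
    IsAdicComplete (Ideal.span {((residueChar v : ℕ) : v.adicCompletionIntegers K)})
      (v.adicCompletionIntegers K) := by
  have hp := valued_residueChar hv
  have hmem : ∀ (n : ℕ) (x : v.adicCompletionIntegers K),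
      x ∈ Ideal.span {((residueChar v : ℕ) : v.adicCompletionIntegers K)} ^ n ↔
        Valued.v (x : v.adicCompletion K) ≤ WithZero.exp (-n : ℤ) := by
    intro n x
    rw [Ideal.span_singleton_pow, Ideal.mem_span_singleton]
    rw [(HeightOneSpectrum.adicCompletionIntegers.integers (K := K) (v := v)).dvd_iff_le]
    change Valued.v (x : v.adicCompletion K) ≤ Valued.v ((((residueChar v : ℕ) : v.adicCompletionIntegers K) ^ n : v.adicCompletionIntegers K) : v.adicCompletion K) ↔ _
    have : ((((residueChar v : ℕ) : v.adicCompletionIntegers K) ^ n : v.adicCompletionIntegers K) : v.adicCompletion K) = ((residueChar v : ℕ) : v.adicCompletion K) ^ n := by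
      push_cast; rfl
    rw [this, map_pow, hp, ← WithZero.exp_nsmul]
    simp
  have key : ∀ x : v.adicCompletion K, (∀ n : ℕ, Valued.v x ≤ WithZero.exp (-n : ℤ)) → x = 0 := by
    intro x hx
    by_contra h
    have h0 : (Valued.v x : ℤᵐ⁰) ≠ 0 := (Valuation.ne_zero_iff _).mpr h
    have h1 := hx (WithZero.log (Valued.v x : ℤᵐ⁰)).natAbs.succ
    rw [← WithZero.exp_log h0, WithZero.exp_le_exp] at h1
    simp only [WithZero.log_exp] at h1
    omega
  refine { haus' := ?_, prec' := ?_ }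
  · intro x hx
    apply Subtype.ext
    apply key
    intro n
    have := hx n
    rw [SModEq.zero, smul_eq_mul, Ideal.mul_top, hmem] at this
    exact this
  · intro f hf
    simp only [SModEq.sub_mem, smul_eq_mul, Ideal.mul_top, hmem] at hf ⊢
    have hc : CauchySeq (fun n => (f n : v.adicCompletion K)) := by
      rw [CauchySeq, Valued.cauchy_iff]
      refine ⟨inferInstance, fun γ => ?_⟩
      have hg : MonoidWithZeroHom.ValueGroup₀.embedding γ.1 ≠ (0 : ℤᵐ⁰) := by
        rw [Ne, map_eq_zero_iff _ MonoidWithZeroHom.ValueGroup₀.embedding_strictMono.injective]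
        exact γ.ne_zero
      obtain ⟨N, hN⟩ : ∃ N : ℕ, WithZero.exp (-N : ℤ) <
          (MonoidWithZeroHom.ValueGroup₀.embedding γ.1 : ℤᵐ⁰) := by
        refine ⟨(WithZero.log (MonoidWithZeroHom.ValueGroup₀.embedding γ.1 : ℤᵐ⁰)).natAbs.succ, ?_⟩
        rw [← WithZero.exp_log hg, WithZero.exp_lt_exp]
        simp only [WithZero.log_exp]
        omega
      refine ⟨(fun n => (f n : v.adicCompletion K)) '' Set.Ici N,
        Filter.image_mem_map (Filter.mem_atTop N), ?_⟩
      rintro _ ⟨a, ha, rfl⟩ _ ⟨b, hb, rfl⟩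
      rw [Valuation.restrict_lt_iff_lt_embedding]
      refine lt_of_le_of_lt ?_ hN
      rcases le_total a b with hab | hab
      · have h1 := hf hab
        rw [Valuation.map_sub_swap]
        refine h1.trans ?_
        rw [WithZero.exp_le_exp]
        simpa using ha
      · have h1 := hf hab
        refine h1.trans ?_
        rw [WithZero.exp_le_exp]
        simpa using hb
    obtain ⟨L, hL⟩ := cauchySeq_tendsto_of_complete hc
    have hcl : ∀ n, Valued.v ((f n : v.adicCompletion K) - L) ≤ WithZero.exp (-n : ℤ) := by
      intro n
      obtain ⟨k, hk1, hk2⟩ := ((hL.eventually (ball_mem_nhds hv L n)).and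
        (Filter.eventually_ge_atTop n)).exists
      have : (f n : v.adicCompletion K) - L = (f n - f k) + (f k - L) := by ring
      rw [this]
      exact (Valuation.map_add _ _ _).trans (max_le (hf hk2) hk1.le)
    have hLi : L ∈ v.adicCompletionIntegers K := by
      have : L = f 0 - (f 0 - L) := by ring
      rw [this]
      refine sub_mem (f 0).2 ?_
      rw [HeightOneSpectrum.mem_adicCompletionIntegers]
      simpa using hcl 0
    exact ⟨⟨L, hLi⟩, fun n => hcl n⟩

theorem exists_integer_add {v : HeightOneSpectrum (𝓞 K)} (hv : IsUnramified v)
    (x : v.adicCompletionIntegers K) : ∃ (r : 𝓞 K) (c : v.adicCompletionIntegers K),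
      x = algebraMap (𝓞 K) (v.adicCompletionIntegers K) r + (residueChar v : ℕ) * c := by
  obtain ⟨k, hk⟩ := (HeightOneSpectrum.denseRange_algebraMap K v).exists_mem_open
    isOpen_interior ⟨(x : v.adicCompletion K),
      mem_interior_iff_mem_nhds.mpr (ball_mem_nhds hv (x : v.adicCompletion K) 0)⟩
  have hk1 : Valued.v (algebraMap K (v.adicCompletion K) k - x) < 1 := by
    simpa using interior_subset hk
  have hk2 : v.valuation K k ≤ 1 := by
    rw [← HeightOneSpectrum.valuedAdicCompletion_eq_valuation']
    have : algebraMap K (v.adicCompletion K) k = (algebraMap K (v.adicCompletion K) k - x) + x := by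
      ring
    change Valued.v (algebraMap K (v.adicCompletion K) k) ≤ 1
    rw [this]
    exact (Valuation.map_add _ _ _).trans (max_le hk1.le x.2)
  obtain ⟨r, hr⟩ := v.exists_valuation_sub_lt_of_integer hk2 1
  have h1 : Valued.v ((x : v.adicCompletion K) - algebraMap K (v.adicCompletion K) (algebraMap (𝓞 K) K r)) < 1 := by
    have e : (x : v.adicCompletion K) - algebraMap K (v.adicCompletion K) (algebraMap (𝓞 K) K r)
      = -((algebraMap K (v.adicCompletion K) k - x) + (algebraMap K (v.adicCompletion K) (algebraMap (𝓞 K) K r - k))) := by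
      rw [map_sub]; ring
    rw [e, Valuation.map_neg]
    refine (Valuation.map_add _ _ _).trans_lt (max_lt hk1 ?_)
    change Valued.v ((algebraMap (𝓞 K) K r - k : K) : v.adicCompletion K) < 1
    rw [HeightOneSpectrum.valuedAdicCompletion_eq_valuation']
    simpa using hr
  have h2 : ((residueChar v : ℕ) : v.adicCompletionIntegers K) ∣
      x - algebraMap (𝓞 K) (v.adicCompletionIntegers K) r := by
    rw [(HeightOneSpectrum.adicCompletionIntegers.integers (K := K) (v := v)).dvd_iff_le]
    change Valued.v ((x : v.adicCompletion K) - algebraMap K (v.adicCompletion K) (algebraMap (𝓞 K) K r)) ≤ Valued.v ((residueChar v : ℕ) : v.adicCompletion K)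
    rw [valued_residueChar hv]
    by_cases h0 : Valued.v ((x : v.adicCompletion K) - algebraMap K (v.adicCompletion K) (algebraMap (𝓞 K) K r)) = 0
    · rw [h0]; exact zero_le
    · rw [← WithZero.exp_log h0] at h1 ⊢
      rw [← WithZero.exp_zero, WithZero.exp_lt_exp] at h1
      rw [WithZero.exp_le_exp]
      omega
  obtain ⟨c, hc⟩ := h2
  exact ⟨r, c, by rw [← hc]; ring⟩

theorem exists_eq_mul {v : HeightOneSpectrum (𝓞 K)} (hv : IsUnramified v) {r : 𝓞 K}
    (hr : r ∈ v.asIdeal) : ∃ c : v.adicCompletionIntegers K,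
      algebraMap (𝓞 K) (v.adicCompletionIntegers K) r = (residueChar v : ℕ) * c := by
  change ((residueChar v : ℕ) : v.adicCompletionIntegers K) ∣ _
  rw [(HeightOneSpectrum.adicCompletionIntegers.integers (K := K) (v := v)).dvd_iff_le]
  change Valued.v ((algebraMap (𝓞 K) K r : K) : v.adicCompletion K) ≤
    Valued.v ((residueChar v : ℕ) : v.adicCompletion K)
  rw [valued_residueChar hv, HeightOneSpectrum.valuedAdicCompletion_eq_valuation',
    HeightOneSpectrum.valuation_of_algebraMap]
  simpa using (v.intValuation_le_pow_iff_mem r 1).mpr (by simpa using hr)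

theorem residueChar_ne_zero (v : HeightOneSpectrum (𝓞 K)) :
    ((residueChar v : ℕ) : v.adicCompletion K) ≠ 0 := by
  have : CharZero (v.adicCompletion K) := algebraRat.charZero _
  exact_mod_cast (Fact.out : (residueChar v).Prime).ne_zero

theorem not_isUnit_residueChar {v : HeightOneSpectrum (𝓞 K)} (hv : IsUnramified v) :
    ¬ IsUnit ((residueChar v : ℕ) : v.adicCompletionIntegers K) := by
  rw [HeightOneSpectrum.adicCompletionIntegers.isUnit_iff_valued_eq_one]
  change ¬ Valued.v ((residueChar v : ℕ) : v.adicCompletion K) = 1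
  rw [valued_residueChar hv, ← WithZero.exp_zero, WithZero.exp_inj]
  decide

theorem exists_pow_mul_mem {v : HeightOneSpectrum (𝓞 K)} (hv : IsUnramified v)
    (x : v.adicCompletion K) :
    ∃ n : ℕ, ((residueChar v : ℕ) : v.adicCompletion K) ^ n * x ∈ v.adicCompletionIntegers K := by
  by_cases hx : x = 0
  · exact ⟨0, by simp [hx]⟩
  have h0 : (Valued.v x : ℤᵐ⁰) ≠ 0 := (Valuation.ne_zero_iff _).mpr hx
  refine ⟨(WithZero.log (Valued.v x : ℤᵐ⁰)).natAbs, ?_⟩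
  rw [HeightOneSpectrum.mem_adicCompletionIntegers, map_mul, map_pow, valued_residueChar hv,
    ← WithZero.exp_nsmul]
  nth_rewrite 2 [← WithZero.exp_log h0]
  rw [← WithZero.exp_add, ← WithZero.exp_zero, WithZero.exp_le_exp]
  simp only [smul_neg, nsmul_eq_mul, mul_one]
  omega

theorem pow_card_residue (v : HeightOneSpectrum (𝓞 K)) (x : 𝓞 K ⧸ v.asIdeal) :
    x ^ (residueChar v) ^ (residueDegree v) = x := by
  have := v.isPrime
  have := v.isMaximal
  have := liesOver_residueChar v
  let := Ideal.Quotient.field v.asIdeal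
  let := Fintype.ofFinite (𝓞 K ⧸ v.asIdeal)
  have h := Ideal.pow_inertiaDeg (residueChar v) v.asIdeal
  have h2 : Fintype.card (𝓞 K ⧸ v.asIdeal) = residueChar v ^ residueDegree v := by
    rw [← Nat.card_eq_fintype_card]
    exact h.symm
  rw [← h2]
  exact FiniteField.pow_card x

theorem isStrict_integers {v : HeightOneSpectrum (𝓞 K)} (hv : IsUnramified v) :
    IsStrict (residueChar v) (v.adicCompletionIntegers K).toSubring ∧
      ∀ x, (frob v)^[residueDegree v] x = x := by
  have := v.isPrime
  have h := IsStrict.mk' (A := (v.adicCompletionIntegers K).toSubring) (p := residueChar v)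
    v.asIdeal (residueChar_mem v) ((algebraMap K (v.adicCompletion K)).comp (algebraMap (𝓞 K) K))
    (fun r => (algebraMap (𝓞 K) (v.adicCompletionIntegers K) r).2)
    (fun r hr => by
      obtain ⟨c, hc⟩ := exists_eq_mul hv hr
      exact ⟨c, c.2, congrArg Subtype.val hc⟩)
    (fun a ha => by
      obtain ⟨r, c, hc⟩ := exists_integer_add hv ⟨a, ha⟩
      exact ⟨r, c, c.2, congrArg Subtype.val hc⟩)
    (isAdicComplete_integers hv) (residueChar_ne_zero v).isUnit (not_isUnit_residueChar hv)
    (exists_pow_mul_mem hv)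
  exact ⟨h.1, h.1.frobeniusLift_pow _ (h.2.1 _ (pow_card_residue v))⟩

end

/-! ## The rings `K_v ⊗_K E` for a finite extension `E` of `K` -/

section

variable {K : Type*} [Field K] [NumberField K]

/-- The image of `𝒪_{K_v} ⊗ 𝒪_E` in `K_v ⊗_K E`. -/
def integersOver (v : HeightOneSpectrum (𝓞 K)) (E : Type*) [Field E] [Algebra K E] :
    Subalgebra (v.adicCompletionIntegers K) (v.adicCompletion K ⊗[K] E) :=
  Algebra.adjoin _ (Set.range fun a : 𝓞 E => (1 : v.adicCompletion K) ⊗ₜ[K] (a : E))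

/-- The place `v` of `K` is unramified in `E`. -/
def IsUnramifiedIn (v : HeightOneSpectrum (𝓞 K)) (E : Type*) [Field E] [Algebra K E] : Prop :=
  Algebra.IsUnramifiedIn (𝓞 E) v.asIdeal

variable {E : Type*} [Field E] [NumberField E] [Algebra K E]

theorem integersOver_eq_span (v : HeightOneSpectrum (𝓞 K)) :
    Subalgebra.toSubmodule (integersOver v E) = Submodule.span (v.adicCompletionIntegers K)
      (Set.range fun a : 𝓞 E => (1 : v.adicCompletion K) ⊗ₜ[K] (a : E)) := by
  let S : Submonoid (v.adicCompletion K ⊗[K] E) :=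
    MonoidHom.mrange ((Algebra.TensorProduct.includeRight (R := K) (A := v.adicCompletion K) (B := E) :
      E →ₐ[K] v.adicCompletion K ⊗[K] E).toRingHom.comp (algebraMap (𝓞 E) E) : 𝓞 E →* _)
  have hS : (S : Set (v.adicCompletion K ⊗[K] E)) =
    (Set.range fun a : 𝓞 E => (1 : v.adicCompletion K) ⊗ₜ[K] (a : E)) := rfl
  rw [integersOver, Algebra.adjoin_eq_span, ← hS, Submonoid.closure_eq]

theorem smul_one_tmul (v : HeightOneSpectrum (𝓞 K)) (r : 𝓞 K) (a : 𝓞 E) :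
    algebraMap (𝓞 K) (v.adicCompletionIntegers K) r • ((1 : v.adicCompletion K) ⊗ₜ[K] (a : E)) =
      (1 : v.adicCompletion K) ⊗ₜ[K] ((r • a : 𝓞 E) : E) := by
  rw [TensorProduct.smul_tmul']
  have : algebraMap (𝓞 K) (v.adicCompletionIntegers K) r • (1 : v.adicCompletion K) =
      (algebraMap (𝓞 K) K r) • (1 : v.adicCompletion K) := by
    rw [Algebra.smul_def, Algebra.smul_def]; rfl
  rw [this, TensorProduct.smul_tmul]
  congr 1
  rw [Algebra.smul_def, Algebra.smul_def]
  change _ = algebraMap (𝓞 E) E (algebraMap (𝓞 K) (𝓞 E) r * a)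
  rw [map_mul, ← IsScalarTower.algebraMap_apply, ← IsScalarTower.algebraMap_apply]

theorem finite_integersOver (v : HeightOneSpectrum (𝓞 K)) :
    Module.Finite (v.adicCompletionIntegers K) (integersOver v E) := by
  change Module.Finite (v.adicCompletionIntegers K) (Subalgebra.toSubmodule (integersOver v E))
  rw [integersOver_eq_span]
  classical
  obtain ⟨s, hs⟩ := (Module.Finite.fg_top : (⊤ : Submodule (𝓞 K) (𝓞 E)).FG)
  refine Module.Finite.iff_fg.mpr ⟨s.image fun a : 𝓞 E => (1 : v.adicCompletion K) ⊗ₜ[K] (a : E), ?_⟩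
  apply le_antisymm
  · apply Submodule.span_mono
    simp only [Finset.coe_image]
    exact Set.image_subset_range _ _
  · rw [Submodule.span_le]
    rintro _ ⟨a, rfl⟩
    have ha : a ∈ Submodule.span (𝓞 K) (s : Set (𝓞 E)) := hs ▸ Submodule.mem_top
    induction ha using Submodule.span_induction with
    | mem x hx => exact Submodule.subset_span (by simpa using ⟨x, hx, rfl⟩)
    | zero => simp
    | add x y _ _ hx hy =>
      have : ((x + y : 𝓞 E) : E) = (x : E) + (y : E) := rfl
      simp only [this, tmul_add]
      exact add_mem hx hy
    | smul r x _ hx =>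
      simp only [← smul_one_tmul]
      exact Submodule.smul_mem _ _ hx

theorem exists_integersOver_add {v : HeightOneSpectrum (𝓞 K)} (hv : IsUnramified v)
    (x : v.adicCompletion K ⊗[K] E) (hx : x ∈ integersOver v E) :
    ∃ (r : 𝓞 E), ∃ c ∈ integersOver v E,
      x = (1 : v.adicCompletion K) ⊗ₜ[K] (r : E) + (residueChar v : ℕ) * c := by
  rw [← Subalgebra.mem_toSubmodule, integersOver_eq_span] at hx
  induction hx using Submodule.span_induction with
  | mem x hx => obtain ⟨a, rfl⟩ := hx; exact ⟨a, 0, zero_mem _, by simp⟩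
  | zero => exact ⟨0, 0, zero_mem _, by simp⟩
  | add x y _ _ hx hy =>
    obtain ⟨r, c, hc, rfl⟩ := hx
    obtain ⟨s, d, hd, rfl⟩ := hy
    refine ⟨r + s, c + d, add_mem hc hd, ?_⟩
    have : ((r + s : 𝓞 E) : E) = (r : E) + (s : E) := rfl
    rw [this, tmul_add]; ring
  | smul a x hx' hx =>
    obtain ⟨r, c, hc, h1⟩ := hx
    obtain ⟨s, d, rfl⟩ := exists_integer_add hv a
    refine ⟨s • r, algebraMap (𝓞 K) (v.adicCompletionIntegers K) s • c + d • x, add_mem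
      (Subalgebra.smul_mem _ hc _) (Subalgebra.smul_mem _ ?_ _), ?_⟩
    · rw [← Subalgebra.mem_toSubmodule, integersOver_eq_span]; exact hx'
    · rw [add_smul, ← smul_one_tmul, mul_smul]
      nth_rewrite 1 [h1]
      simp only [Algebra.smul_def, map_natCast]
      ring

theorem isReduced_quotient {v : HeightOneSpectrum (𝓞 K)} (hE : IsUnramifiedIn v E) :
    IsReduced (𝓞 E ⧸ v.asIdeal.map (algebraMap (𝓞 K) (𝓞 E))) := by
  have := v.isPrime
  have := v.isMaximal
  have hne : v.asIdeal.map (algebraMap (𝓞 K) (𝓞 E)) ≠ 0 := Ideal.map_ne_bot_of_ne_bot v.ne_bot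
  rw [← Ideal.isRadical_iff_quotient_reduced]
  have hsq : Squarefree (v.asIdeal.map (algebraMap (𝓞 K) (𝓞 E))) := by
    refine (squarefree_iff_no_irreducibles hne).mpr fun P hP hPP => ?_
    have hPp : P.IsPrime := (Ideal.isPrime_of_prime hP.prime)
    have hle : v.asIdeal.map (algebraMap (𝓞 K) (𝓞 E)) ≤ P ^ 2 := by
      rw [pow_two]; exact Ideal.le_of_dvd hPP
    have : P.LiesOver v.asIdeal := by
      refine ⟨?_⟩
      refine v.isMaximal.eq_of_le (Ideal.IsPrime.comap (hK := hPp) _).ne_top ?_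
      rw [← Ideal.map_le_iff_le_comap]
      exact hle.trans (Ideal.pow_le_self two_ne_zero)
    exact not_le_sq P hP.ne_zero v.asIdeal (hE P hPp this) hle
  intro x hx
  obtain ⟨n, hn⟩ := hx
  have h1 := hsq.isRadical n (Ideal.span {x}) (by
    rw [Ideal.span_singleton_pow, Ideal.dvd_span_singleton]; exact hn)
  exact Ideal.dvd_span_singleton.mp h1

theorem finite_quotient (v : HeightOneSpectrum (𝓞 K)) :
    Finite (𝓞 E ⧸ v.asIdeal.map (algebraMap (𝓞 K) (𝓞 E))) := by
  apply Ideal.finiteQuotientOfFreeOfNeBot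
  exact Ideal.map_ne_bot_of_ne_bot v.ne_bot

theorem isAdicComplete_of_basis {R M ι : Type*} [CommRing R] [AddCommGroup M] [Module R M]
    [Finite ι] (b : Module.Basis ι R M) (p : R) [IsAdicComplete (Ideal.span {p}) R] :
    IsAdicComplete (Ideal.span {p}) M := by
  have := Fintype.ofFinite ι
  have h1 : ∀ (n : ℕ) (x : M), x ∈ ((Ideal.span {p} ^ n • ⊤ : Submodule R M)) ↔
      ∀ i, b.repr x i ∈ (Ideal.span {p} ^ n • ⊤ : Submodule R R) := by
    intro n x
    rw [Ideal.span_singleton_pow, Submodule.ideal_span_singleton_smul]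
    simp only [Submodule.mem_smul_pointwise_iff_exists, Submodule.mem_top, true_and, smul_eq_mul,
      Ideal.mul_top, Ideal.mem_span_singleton]
    constructor
    · rintro ⟨y, rfl⟩ i
      exact ⟨b.repr y i, by simp⟩
    · intro h
      choose c hc using h
      refine ⟨∑ i, c i • b i, ?_⟩
      apply b.repr.injective
      ext i
      rw [map_smul, Finsupp.smul_apply, b.repr_sum_self, hc, smul_eq_mul]
  refine { haus' := ?_, prec' := ?_ }
  · intro x hx
    apply b.repr.injective
    ext i
    rw [map_zero]
    refine IsHausdorff.haus (I := Ideal.span {p}) inferInstance _ fun n => ?_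
    have := hx n
    rw [SModEq.zero, h1] at this
    rw [SModEq.zero]
    exact this i
  · intro f hf
    simp only [SModEq.sub_mem, h1, map_sub, Finsupp.sub_apply] at hf
    have : ∀ i, ∃ L : R, ∀ n, b.repr (f n) i - L ∈ (Ideal.span {p} ^ n • ⊤ : Submodule R R) := by
      intro i
      obtain ⟨L, hL⟩ := IsPrecomplete.prec (I := Ideal.span {p}) (M := R) inferInstance
        (f := fun n => b.repr (f n) i) (fun {m n} hmn => by
          rw [SModEq.sub_mem]; exact hf hmn i)
      exact ⟨L, fun n => by rw [← SModEq.sub_mem]; exact hL n⟩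
    choose L hL using this
    refine ⟨∑ i, L i • b i, fun n => ?_⟩
    rw [SModEq.sub_mem, h1]
    intro i
    rw [map_sub, Finsupp.sub_apply, b.repr_sum_self]
    exact hL i n

theorem tmul_mem_integersOver {v : HeightOneSpectrum (𝓞 K)} {c : v.adicCompletion K}
    (hc : c ∈ v.adicCompletionIntegers K) (a : 𝓞 E) : c ⊗ₜ[K] (a : E) ∈ integersOver v E := by
  have h1 : c ⊗ₜ[K] (a : E) = (⟨c, hc⟩ : v.adicCompletionIntegers K) •
      ((1 : v.adicCompletion K) ⊗ₜ[K] (a : E)) := by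
    rw [TensorProduct.smul_tmul']
    congr 1
    rw [Algebra.smul_def, mul_one]; rfl
  rw [h1]
  have h2 : (1 : v.adicCompletion K) ⊗ₜ[K] (a : E) ∈ integersOver v E :=
    Algebra.subset_adjoin ⟨a, rfl⟩
  exact Subalgebra.smul_mem _ h2 _

theorem isStrict_integersOver {v : HeightOneSpectrum (𝓞 K)} (hv : IsUnramified v)
    (hE : IsUnramifiedIn v E) :
    IsStrict (residueChar v) (integersOver v E).toSubring ∧ ∃ m : ℕ, 0 < m ∧
      ∀ x, (frobeniusLift (residueChar v) (integersOver v E).toSubring)^[m] x = x := by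
  have := isReduced_quotient hE
  have := finite_quotient (E := E) v
  have hp0 : IsUnit ((residueChar v : ℕ) : v.adicCompletion K ⊗[K] E) := by
    rw [← map_natCast (algebraMap (v.adicCompletion K) (v.adicCompletion K ⊗[K] E))]
    exact (residueChar_ne_zero v).isUnit.map _
  have := finite_integersOver (E := E) v
  have : Module.IsTorsionFree (v.adicCompletionIntegers K) (v.adicCompletion K ⊗[K] E) :=
    Module.IsTorsionFree.trans_faithfulSMul (v.adicCompletionIntegers K) (v.adicCompletion K) _
  have hfree : Module.Free (v.adicCompletionIntegers K) (integersOver v E) := inferInstance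
  have := isAdicComplete_integers hv
  have hcomp : IsAdicComplete (Ideal.span {((residueChar v : ℕ) : integersOver v E)}) (integersOver v E) := by
    have h1 := isAdicComplete_of_basis
      (Module.Free.chooseBasis (v.adicCompletionIntegers K) (integersOver v E))
      ((residueChar v : ℕ) : v.adicCompletionIntegers K)
    rw [← IsAdicComplete.map_algebraMap_iff (S := integersOver v E), Ideal.map_span,
      Set.image_singleton, map_natCast] at h1
    exact h1
  have hnu : ¬ IsUnit ((residueChar v : ℕ) : integersOver v E) := by
    intro h
    apply not_isUnit_residueChar hv
    have : Algebra.IsIntegral (v.adicCompletionIntegers K) (integersOver v E) := inferInstance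
    have h2 : FaithfulSMul (v.adicCompletionIntegers K) (integersOver v E) := inferInstance
    rw [← map_natCast (algebraMap (v.adicCompletionIntegers K) (integersOver v E))] at h
    exact isUnit_of_map_unit _ _ h
  have h := IsStrict.mk' (A := (integersOver v E).toSubring) (p := residueChar v)
    (v.asIdeal.map (algebraMap (𝓞 K) (𝓞 E)))
    (by simpa using Ideal.mem_map_of_mem (algebraMap (𝓞 K) (𝓞 E)) (residueChar_mem v))
    ((Algebra.TensorProduct.includeRight (R := K) (A := v.adicCompletion K) (B := E) :
      E →ₐ[K] v.adicCompletion K ⊗[K] E).toRingHom.comp (algebraMap (𝓞 E) E))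
    (fun a => Algebra.subset_adjoin ⟨a, rfl⟩)
    (fun r hr => by
      induction hr using Submodule.span_induction with
      | mem x hx =>
        obtain ⟨s, hs, rfl⟩ := hx
        obtain ⟨c, hc⟩ := exists_eq_mul hv hs
        refine ⟨c ⊗ₜ[K] ((1 : 𝓞 E) : E), tmul_mem_integersOver c.2 _, ?_⟩
        have h1 := smul_one_tmul (E := E) v s 1
        rw [Algebra.smul_def (A := 𝓞 E), mul_one] at h1
        change (1 : v.adicCompletion K) ⊗ₜ[K] ((algebraMap (𝓞 K) (𝓞 E) s : 𝓞 E) : E) = _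
        rw [← h1, hc, mul_smul, TensorProduct.smul_tmul', TensorProduct.smul_tmul',
          ← nsmul_eq_mul, Nat.cast_smul_eq_nsmul]
        congr 2
        rw [Algebra.smul_def, mul_one]; rfl
      | zero => exact ⟨0, zero_mem _, by simp⟩
      | add x y _ _ hx hy =>
        obtain ⟨c, hc, h1⟩ := hx
        obtain ⟨d, hd, h2⟩ := hy
        exact ⟨c + d, add_mem hc hd, by rw [map_add, h1, h2, mul_add]⟩
      | smul a x _ hx =>
        obtain ⟨c, hc, h1⟩ := hx
        refine ⟨_, mul_mem (Algebra.subset_adjoin ⟨a, rfl⟩ :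
          (1 : v.adicCompletion K) ⊗ₜ[K] (a : E) ∈ integersOver v E) hc, ?_⟩
        rw [smul_eq_mul, map_mul, h1]
        change (1 : v.adicCompletion K) ⊗ₜ[K] (a : E) * _ = _
        ring)
    (fun a ha => exists_integersOver_add hv a ha)
    hcomp hp0 hnu
    (fun b => by
      induction b using TensorProduct.induction_on with
      | zero => exact ⟨0, by simp⟩
      | tmul c e =>
        obtain ⟨⟨a, d⟩, hd⟩ := IsLocalization.surj (Algebra.algebraMapSubmonoid (𝓞 E) (nonZeroDivisors (𝓞 K))) e
        obtain ⟨_, d, hd0, rfl⟩ := d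
        have hd1 : algebraMap (𝓞 K) K d ≠ 0 := by
          simpa using nonZeroDivisors.ne_zero hd0
        obtain ⟨n, hn⟩ := exists_pow_mul_mem hv ((algebraMap (𝓞 K) K d)⁻¹ • c)
        refine ⟨n, ?_⟩
        have h2 : c ⊗ₜ[K] e = ((algebraMap (𝓞 K) K d)⁻¹ • c) ⊗ₜ[K] (a : E) := by
          rw [TensorProduct.smul_tmul]
          congr 1
          rw [eq_inv_smul_iff₀ hd1, Algebra.smul_def, mul_comm]
          exact hd
        have h3 : ((residueChar v : ℕ) : v.adicCompletion K ⊗[K] E) ^ n * c ⊗ₜ[K] e =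
            (((residueChar v : ℕ) : v.adicCompletion K) ^ n * ((algebraMap (𝓞 K) K d)⁻¹ • c)) ⊗ₜ[K] (a : E) := by
          rw [h2, ← map_natCast (algebraMap (v.adicCompletion K) (v.adicCompletion K ⊗[K] E)),
            ← map_pow, ← Algebra.smul_def, TensorProduct.smul_tmul', smul_eq_mul]
        rw [h3]
        exact tmul_mem_integersOver hn a
      | add x y hx hy =>
        obtain ⟨n, hn⟩ := hx
        obtain ⟨m, hm⟩ := hy
        refine ⟨n + m, ?_⟩
        have : ((residueChar v : ℕ) : v.adicCompletion K ⊗[K] E) ^ (n + m) * (x + y) =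
          ((residueChar v : ℕ) : v.adicCompletion K ⊗[K] E) ^ m * (((residueChar v : ℕ) : v.adicCompletion K ⊗[K] E) ^ n * x) +
          ((residueChar v : ℕ) : v.adicCompletion K ⊗[K] E) ^ n * (((residueChar v : ℕ) : v.adicCompletion K ⊗[K] E) ^ m * y) := by ring
        rw [this]
        exact add_mem (mul_mem (pow_mem (natCast_mem _ _) _) hn) (mul_mem (pow_mem (natCast_mem _ _) _) hm))
  obtain ⟨m, hm, hm'⟩ := h.2.2
  exact ⟨h.1, m, hm, h.1.frobeniusLift_pow _ (h.2.1 _ hm')⟩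

end

/-! ## The Frobenius of `K_v ⊗_K E` -/

section

variable {K : Type*} [Field K] [NumberField K]

/-- The Frobenius lift of `K_v ⊗_K E` (meaningful for `v` unramified over `ℚ` and in `E`). -/
def frobOver (v : HeightOneSpectrum (𝓞 K)) (E : Type*) [Field E] [Algebra K E] :
    v.adicCompletion K ⊗[K] E ≃+* v.adicCompletion K ⊗[K] E :=
  frobeniusLift (residueChar v) (integersOver v E).toSubring

variable {E : Type*} [Field E] [NumberField E] [Algebra K E]
variable {E' : Type*} [Field E'] [NumberField E'] [Algebra K E']

theorem map_mem_integersOver {v : HeightOneSpectrum (𝓞 K)} (τ : E →ₐ[K] E')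
    {x : v.adicCompletion K ⊗[K] E} (hx : x ∈ integersOver v E) :
    Algebra.TensorProduct.map (AlgHom.id (v.adicCompletion K) (v.adicCompletion K)) τ x ∈
      integersOver v E' := by
  rw [← Subalgebra.mem_toSubmodule, integersOver_eq_span] at hx
  induction hx using Submodule.span_induction with
  | mem x hx =>
    obtain ⟨a, rfl⟩ := hx
    simp only [Algebra.TensorProduct.map_tmul, map_one]
    exact tmul_mem_integersOver (one_mem _) (RingOfIntegers.mapRingHom (τ : E →+* E') a)
  | zero => rw [map_zero]; exact zero_mem _
  | add x y _ _ hx hy => rw [map_add]; exact add_mem hx hy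
  | smul c x _ hx =>
    have : c • x = (c : v.adicCompletion K) • x := by
      rw [Algebra.smul_def, Algebra.smul_def]; rfl
    rw [this, map_smul]
    have h2 : (c : v.adicCompletion K) • Algebra.TensorProduct.map (AlgHom.id (v.adicCompletion K) (v.adicCompletion K)) τ x
      = c • Algebra.TensorProduct.map (AlgHom.id (v.adicCompletion K) (v.adicCompletion K)) τ x := by
      rw [Algebra.smul_def, Algebra.smul_def]; rfl
    rw [h2]
    exact Subalgebra.smul_mem _ hx _

theorem frobOver_map {v : HeightOneSpectrum (𝓞 K)} (hv : IsUnramified v)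
    (hE : IsUnramifiedIn v E) (hE' : IsUnramifiedIn v E') (τ : E →ₐ[K] E')
    (x : v.adicCompletion K ⊗[K] E) :
    frobOver v E' (Algebra.TensorProduct.map (AlgHom.id (v.adicCompletion K) (v.adicCompletion K)) τ x) =
      Algebra.TensorProduct.map (AlgHom.id (v.adicCompletion K) (v.adicCompletion K)) τ (frobOver v E x) := by
  have h := (isStrict_integersOver hv hE).1
  have h' := (isStrict_integersOver hv hE').1
  let m : v.adicCompletion K ⊗[K] E →+* v.adicCompletion K ⊗[K] E' :=
    (Algebra.TensorProduct.map (AlgHom.id (v.adicCompletion K) (v.adicCompletion K)) τ).toRingHom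
  have hm : ∀ a ∈ (integersOver v E).toSubring, m a ∈ (integersOver v E').toSubring :=
    fun a ha => map_mem_integersOver τ ha
  have key : (frobOver v E' : _ →+* _).comp m = m.comp (frobOver v E : _ →+* _) := by
    refine h.hom_ext h' _ _ (fun a ha => (h'.isFrobeniusLift _ (hm a ha)).1)
      (fun a ha => hm _ (h.isFrobeniusLift _ ha).1) (fun a ha => ?_)
    obtain ⟨_, c, hc, h1⟩ := h'.isFrobeniusLift _ (hm a ha)
    obtain ⟨_, d, hd, h2⟩ := h.isFrobeniusLift _ ha
    refine ⟨c - m d, sub_mem hc (hm d hd), ?_⟩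
    change frobeniusLift _ _ (m a) = m (frobeniusLift _ _ a) + _
    rw [h1, h2, map_add, map_pow, map_mul, map_natCast]
    ring
  exact congrArg (fun f : _ →+* _ => f x) key

theorem frobOver_algebraMap {v : HeightOneSpectrum (𝓞 K)} (hv : IsUnramified v)
    (hE : IsUnramifiedIn v E) (c : v.adicCompletion K) :
    frobOver v E (algebraMap (v.adicCompletion K) _ c) =
      algebraMap (v.adicCompletion K) (v.adicCompletion K ⊗[K] E) (frob v c) := by
  have h := (isStrict_integers hv).1
  have h' := (isStrict_integersOver hv hE).1
  let m : v.adicCompletion K →+* v.adicCompletion K ⊗[K] E := algebraMap _ _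
  have hm : ∀ a ∈ (v.adicCompletionIntegers K).toSubring, m a ∈ (integersOver v E).toSubring :=
    fun a ha => (integersOver v E).algebraMap_mem ⟨a, ha⟩
  have key : (frobOver v E : _ →+* _).comp m = m.comp (frob v : _ →+* _) := by
    refine h.hom_ext h' _ _ (fun a ha => (h'.isFrobeniusLift _ (hm a ha)).1)
      (fun a ha => hm _ (h.isFrobeniusLift _ ha).1) (fun a ha => ?_)
    obtain ⟨_, c, hc, h1⟩ := h'.isFrobeniusLift _ (hm a ha)
    obtain ⟨_, d, hd, h2⟩ := h.isFrobeniusLift _ ha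
    refine ⟨c - m d, sub_mem hc (hm d hd), ?_⟩
    change frobeniusLift _ _ (m a) = m (frobeniusLift _ _ a) + _
    rw [h1, h2, map_add, map_pow, map_mul, map_natCast]
    ring
  exact congrArg (fun f : _ →+* _ => f c) key

theorem frobOver_smul {v : HeightOneSpectrum (𝓞 K)} (hv : IsUnramified v)
    (hE : IsUnramifiedIn v E) (c : v.adicCompletion K) (x : v.adicCompletion K ⊗[K] E) :
    frobOver v E (c • x) = frob v c • frobOver v E x := by
  rw [Algebra.smul_def, map_mul, frobOver_algebraMap hv hE, ← Algebra.smul_def]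

theorem finite_not_isUnramified : {v : HeightOneSpectrum (𝓞 K) | ¬ IsUnramified v}.Finite := by
  refine (Ideal.finite_factors (I := differentIdeal ℤ (𝓞 K)) differentIdeal_ne_bot).subset ?_
  intro v hv
  have := v.isPrime
  by_contra h
  exact hv ((not_dvd_differentIdeal_iff (A := ℤ) (B := 𝓞 K) (P := v.asIdeal)).mp h)

variable (K E) in
theorem finite_not_isUnramifiedIn :
    {v : HeightOneSpectrum (𝓞 K) | ¬ IsUnramifiedIn v E}.Finite := by
  have h := (Ideal.finite_factors (I := differentIdeal (𝓞 K) (𝓞 E)) differentIdeal_ne_bot)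
  refine (h.image fun P => (P.asIdeal.under (𝓞 K))).preimage
    (f := fun v : HeightOneSpectrum (𝓞 K) => v.asIdeal)
    (fun a _ b _ hab => HeightOneSpectrum.ext hab) |>.subset ?_
  intro v hv
  simp only [Set.mem_ofPred_eq, IsUnramifiedIn, Algebra.IsUnramifiedIn, not_forall] at hv
  obtain ⟨P, hP, hlo, hun⟩ := hv
  have hne : P ≠ ⊥ := Ideal.ne_bot_of_liesOver_of_ne_bot v.ne_bot P
  refine ⟨⟨P, hP, hne⟩, ?_, (Ideal.over_def P v.asIdeal).symm⟩
  by_contra h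
  exact hun ((not_dvd_differentIdeal_iff (A := 𝓞 K) (B := 𝓞 E) (P := P)).mp h)

end

/-! ## Lattices over `K` and their de Rham realization -/

section

section
variable {R M G : Type*} [CommRing R] [AddCommGroup M] [Module R M]

/-- The vectors fixed by a family of endomorphisms. -/
def fixedVectors (a : G → M →ₗ[R] M) : Submodule R M where
  carrier := {x | ∀ g, a g x = x}
  add_mem' hx hy g := by rw [map_add, hx g, hy g]
  zero_mem' g := map_zero _
  smul_mem' c x hx g := by rw [map_smul, hx g]

theorem mem_fixedVectors {a : G → M →ₗ[R] M} {x : M} : x ∈ fixedVectors a ↔ ∀ g, a g x = x :=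
  Iff.rfl

variable (S : Type*) [CommRing S] [Algebra R S]

theorem baseChange_mem_fixedVectors (a : G → M →ₗ[R] M) (x : S ⊗[R] fixedVectors a) :
    (fixedVectors a).subtype.baseChange S x ∈ fixedVectors fun g => (a g).baseChange S := by
  intro g
  rw [← LinearMap.comp_apply, ← LinearMap.baseChange_comp]
  congr 2
  ext y
  exact y.2 g

theorem baseChange_fixedVectors_surj [Module.Free R S] (a : G → M →ₗ[R] M) {x : S ⊗[R] M}
    (hx : x ∈ fixedVectors fun g => (a g).baseChange S) :
    ∃ y, (fixedVectors a).subtype.baseChange S y = x := by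
  let b := Module.Free.chooseBasis R S
  have h1 : ∀ i, TensorProduct.equivFinsuppOfBasisLeft b x i ∈ fixedVectors a := by
    intro i g
    conv_rhs => rw [← hx g]
    generalize x = z
    induction z using TensorProduct.induction_on with
    | zero => simp
    | tmul s m => simp
    | add y z hy hz => simp only [map_add, Finsupp.add_apply, hy, hz]
  have h2 := (TensorProduct.equivFinsuppOfBasisLeft b).symm_apply_apply x
  rw [TensorProduct.equivFinsuppOfBasisLeft_symm_apply, Finsupp.sum] at h2
  refine ⟨∑ i ∈ (TensorProduct.equivFinsuppOfBasisLeft b x).support, b i ⊗ₜ ⟨_, h1 i⟩, ?_⟩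
  rw [map_sum]
  exact h2

/-- Formation of fixed vectors commutes with (flat, free) base change. -/
def baseChangeFixedVectors [Module.Free R S] (a : G → M →ₗ[R] M) :
    S ⊗[R] fixedVectors a ≃ₗ[S] fixedVectors fun g => (a g).baseChange S :=
  LinearEquiv.ofBijective
    (((fixedVectors a).subtype.baseChange S).codRestrict _ (baseChange_mem_fixedVectors S a)) <| by
    constructor
    · intro x y hxy
      exact Module.Flat.lTensor_preserves_injective_linearMap (M := S) (fixedVectors a).subtype
        (Submodule.subtype_injective _) (congrArg Subtype.val hxy)
    · rintro ⟨x, hx⟩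
      obtain ⟨y, hy⟩ := baseChange_fixedVectors_surj S a hx
      exact ⟨y, Subtype.ext hy⟩

@[simp] theorem coe_baseChangeFixedVectors [Module.Free R S] (a : G → M →ₗ[R] M)
    (x : S ⊗[R] fixedVectors a) : (baseChangeFixedVectors S a x : S ⊗[R] M) =
      (fixedVectors a).subtype.baseChange S x := rfl

end

/-- A lattice over `K`: a finitely generated free abelian group with a continuous action of the
absolute Galois group; that is, a group scheme over `K` which is étale locally constant and free
of finite rank. The Artin motive (or `1`-motive of weight zero) `[L → 0]` is given by `L`. -/
structure Lattice (K : Type u) [Field K] where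
  /-- the abelian group `L(K̄)` -/
  carrier : Type u
  [addCommGroup : AddCommGroup carrier]
  [free : Module.Free ℤ carrier]
  [finite : Module.Finite ℤ carrier]
  /-- the Galois action -/
  ρ : Representation ℤ (AlgebraicClosure K ≃ₐ[K] AlgebraicClosure K) carrier
  isOpen_stabilizer : ∀ x, IsOpen {γ | ρ γ x = x}

attribute [instance] Lattice.addCommGroup Lattice.free Lattice.finite

instance (K : Type u) [Field K] : CoeSort (Lattice K) (Type u) := ⟨Lattice.carrier⟩

namespace Lattice
variable {K : Type u} [Field K] (L : Lattice K)

/-- The diagonal action of the Galois group on `K̄ ⊗ L`. -/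
def galAct (γ : AlgebraicClosure K ≃ₐ[K] AlgebraicClosure K) :
    AlgebraicClosure K ⊗[ℤ] L →ₗ[K] AlgebraicClosure K ⊗[ℤ] L :=
  AlgebraTensorModule.map γ.toLinearMap (L.ρ γ)

/-- `T_dR([L → 0]) = (K̄ ⊗ L)^{Gal(K̄/K)}` -/
def deRham : Submodule K (AlgebraicClosure K ⊗[ℤ] L) := fixedVectors L.galAct

/-- The smallest extension of `K` in `K̄` over which `L` becomes constant. -/
def splittingField : IntermediateField K (AlgebraicClosure K) :=
  IntermediateField.fixedField L.ρ.ker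

theorem mem_splittingField {a : AlgebraicClosure K} :
    a ∈ L.splittingField ↔ ∀ γ, L.ρ γ = 1 → γ a = a := by
  rw [splittingField, IntermediateField.mem_fixedField_iff]
  rfl

instance finiteDimensional_splittingField [CharZero K] : FiniteDimensional K L.splittingField := by
  have h1 : {γ | L.ρ γ = 1} ∈ nhds (1 : AlgebraicClosure K ≃ₐ[K] AlgebraicClosure K) := by
    let b := Module.Free.chooseBasis ℤ L
    have h2 : {γ | L.ρ γ = 1} = ⋂ i, {γ | L.ρ γ (b i) = b i} := by
      ext γ
      simp only [Set.mem_ofPred_eq, Set.mem_iInter]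
      exact ⟨fun h i => by rw [h]; rfl, fun h => b.ext h⟩
    rw [h2]
    exact (isOpen_iInter_of_finite fun i => L.isOpen_stabilizer _).mem_nhds (by simp)
  rw [krullTopology_mem_nhds_one_iff] at h1
  obtain ⟨F, hF, h3⟩ := h1
  have h4 : L.splittingField ≤ F := by
    rw [← InfiniteGalois.fixedField_fixingSubgroup F]
    intro a ha
    rw [IntermediateField.mem_fixedField_iff]
    intro γ hγ
    exact L.mem_splittingField.mp ha γ (h3 hγ)
  exact FiniteDimensional.of_injective (IntermediateField.inclusion h4).toLinearMap
    (IntermediateField.inclusion h4).injective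

theorem apply_mem_splittingField (γ : AlgebraicClosure K ≃ₐ[K] AlgebraicClosure K)
    {a : AlgebraicClosure K} (ha : a ∈ L.splittingField) : γ a ∈ L.splittingField := by
  rw [mem_splittingField] at ha ⊢
  intro δ hδ
  have h1 := ha (γ⁻¹ * δ * γ) (by
    rw [map_mul, map_mul, hδ, mul_one, ← map_mul, inv_mul_cancel, map_one])
  have h2 := congrArg γ h1
  have h3 : γ ((γ⁻¹ * δ * γ) a) = δ (γ a) := by
    rw [← AlgEquiv.mul_apply, ← mul_assoc, ← mul_assoc, mul_inv_cancel, one_mul]; rfl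
  rw [← h3, h2]

/-- The action of the Galois group on the splitting field. -/
def restrict (γ : AlgebraicClosure K ≃ₐ[K] AlgebraicClosure K) :
    L.splittingField →ₐ[K] L.splittingField :=
  (γ.toAlgHom.comp L.splittingField.val).codRestrict L.splittingField.toSubalgebra
    fun a => L.apply_mem_splittingField γ a.2

/-- `F ⊗ L → K̄ ⊗ L` -/
def fieldEmb (F : IntermediateField K (AlgebraicClosure K)) :
    F ⊗[ℤ] L →ₗ[K] AlgebraicClosure K ⊗[ℤ] L :=
  AlgebraTensorModule.map F.val.toLinearMap LinearMap.id

theorem fieldEmb_injective (F : IntermediateField K (AlgebraicClosure K)) :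
    Function.Injective (L.fieldEmb F) :=
  Module.Flat.rTensor_preserves_injective_linearMap (M := L)
    (F.val.toLinearMap.restrictScalars ℤ) F.val.injective

theorem exists_fieldEmb {x : AlgebraicClosure K ⊗[ℤ] L} (hx : x ∈ L.deRham) :
    ∃ y, L.fieldEmb L.splittingField y = x := by
  let b := Module.Free.chooseBasis ℤ L
  have h1 : ∀ i, TensorProduct.equivFinsuppOfBasisRight b x i ∈ L.splittingField := by
    intro i
    rw [mem_splittingField]
    intro γ hγ
    conv_rhs => rw [← hx γ]
    generalize x = z
    induction z using TensorProduct.induction_on with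
    | zero => simp
    | tmul s m =>
      simp [galAct, hγ]
    | add y z hy hz => simp only [map_add, Finsupp.add_apply, hy, hz]
  have h2 := (TensorProduct.equivFinsuppOfBasisRight b).symm_apply_apply x
  rw [TensorProduct.equivFinsuppOfBasisRight_symm_apply, Finsupp.sum] at h2
  refine ⟨∑ i ∈ (TensorProduct.equivFinsuppOfBasisRight b x).support, ⟨_, h1 i⟩ ⊗ₜ b i, ?_⟩
  rw [map_sum]
  exact h2

instance finiteDimensional_deRham [CharZero K] : FiniteDimensional K L.deRham := by
  have h1 : L.deRham ≤ LinearMap.range (L.fieldEmb L.splittingField) :=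
    fun x hx => L.exists_fieldEmb hx
  have : FiniteDimensional K (L.splittingField ⊗[ℤ] L) :=
    Module.Finite.equiv (AlgebraTensorModule.cancelBaseChange ℤ K K L.splittingField L)
  have : FiniteDimensional K (LinearMap.range (L.fieldEmb L.splittingField)) :=
    LinearMap.finiteDimensional_range _
  exact Submodule.finiteDimensional_of_le h1

variable [NumberField K] (v : HeightOneSpectrum (𝓞 K))

/-- `(K_v ⊗_K K̄ ⊗ L)^{Gal(K̄/K)}` -/
def crys : Submodule (v.adicCompletion K) (v.adicCompletion K ⊗[K] (AlgebraicClosure K ⊗[ℤ] L)) :=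
  fixedVectors fun γ => (L.galAct γ).baseChange (v.adicCompletion K)

/-- The comparison isomorphism `K_v ⊗_K T_dR ≅ (K_v ⊗_K K̄ ⊗ L)^{Gal(K̄/K)}`. -/
def comparison : v.adicCompletion K ⊗[K] L.deRham ≃ₗ[v.adicCompletion K] L.crys v :=
  baseChangeFixedVectors (v.adicCompletion K) L.galAct

/-- Associativity of the tensor product. -/
def assocEquiv (F : IntermediateField K (AlgebraicClosure K)) :
    (v.adicCompletion K ⊗[K] F) ⊗[ℤ] L ≃ₗ[v.adicCompletion K]
      v.adicCompletion K ⊗[K] (F ⊗[ℤ] L) :=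
  AlgebraTensorModule.assoc ℤ K (v.adicCompletion K) (v.adicCompletion K) F L

/-- `(K_v ⊗_K F) ⊗ L → K_v ⊗_K K̄ ⊗ L` -/
def localEmb (F : IntermediateField K (AlgebraicClosure K)) :
    (v.adicCompletion K ⊗[K] F) ⊗[ℤ] L →ₗ[v.adicCompletion K]
      v.adicCompletion K ⊗[K] (AlgebraicClosure K ⊗[ℤ] L) :=
  (L.fieldEmb F).baseChange (v.adicCompletion K) ∘ₗ
    (L.assocEquiv v F).toLinearMap

@[simp] theorem localEmb_tmul (F : IntermediateField K (AlgebraicClosure K))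
    (c : v.adicCompletion K) (a : F) (l : L) :
    L.localEmb v F ((c ⊗ₜ a) ⊗ₜ l) = c ⊗ₜ ((a : AlgebraicClosure K) ⊗ₜ l) := rfl

theorem localEmb_injective (F : IntermediateField K (AlgebraicClosure K)) :
    Function.Injective (L.localEmb v F) := by
  rw [localEmb, LinearMap.coe_comp]
  refine Function.Injective.comp ?_ (LinearEquiv.injective _)
  exact Module.Flat.lTensor_preserves_injective_linearMap (M := v.adicCompletion K) (L.fieldEmb F)
    (L.fieldEmb_injective F)

theorem exists_localEmb {x : v.adicCompletion K ⊗[K] (AlgebraicClosure K ⊗[ℤ] L)}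
    (hx : x ∈ L.crys v) : ∃ y, L.localEmb v L.splittingField y = x := by
  obtain ⟨z, rfl⟩ := baseChange_fixedVectors_surj (v.adicCompletion K) L.galAct hx
  induction z using TensorProduct.induction_on with
  | zero => exact ⟨0, by simp⟩
  | tmul c y =>
    obtain ⟨w, hw⟩ := L.exists_fieldEmb y.2
    refine ⟨(L.assocEquiv v _).symm (c ⊗ₜ w), ?_⟩
    rw [localEmb, LinearMap.comp_apply, LinearEquiv.coe_coe, LinearEquiv.apply_symm_apply,
      LinearMap.baseChange_tmul, hw]
    rfl
  | add y z hy hz =>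
    obtain ⟨a, ha⟩ := hy (baseChange_mem_fixedVectors _ _ _)
    obtain ⟨b, hb⟩ := hz (baseChange_mem_fixedVectors _ _ _)
    exact ⟨a + b, by rw [map_add, map_add, ha, hb]⟩

/-- The Frobenius `φ ⊗ 1` on `(K_v ⊗_K F) ⊗ L`. -/
def localFrob (F : IntermediateField K (AlgebraicClosure K)) :
    (v.adicCompletion K ⊗[K] F) ⊗[ℤ] L ≃+ (v.adicCompletion K ⊗[K] F) ⊗[ℤ] L :=
  (TensorProduct.congr (frobOver v F).toAddEquiv.toIntLinearEquiv
    (LinearEquiv.refl ℤ L)).toAddEquiv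

@[simp] theorem localFrob_tmul (F : IntermediateField K (AlgebraicClosure K))
    (x : v.adicCompletion K ⊗[K] F) (l : L) :
    L.localFrob v F (x ⊗ₜ l) = frobOver v F x ⊗ₜ l := rfl

end Lattice

end

/-! ## The Frobenius of the realization of a lattice -/

section

instance numberField_intermediateField {K : Type u} [Field K] [NumberField K]
    (F : IntermediateField K (AlgebraicClosure K)) [FiniteDimensional K F] : NumberField F :=
  NumberField.of_module_finite K F

namespace Lattice
variable {K : Type u} [Field K] [NumberField K] (L : Lattice K) {L' : Lattice K}
variable {v : HeightOneSpectrum (𝓞 K)}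

theorem localFrob_smul (hv : IsUnramified v) (F : IntermediateField K (AlgebraicClosure K))
    [FiniteDimensional K F] (hF : IsUnramifiedIn v F) (c : v.adicCompletion K)
    (x : (v.adicCompletion K ⊗[K] F) ⊗[ℤ] L) :
    L.localFrob v F (c • x) = frob v c • L.localFrob v F x := by
  induction x using TensorProduct.induction_on with
  | zero => simp
  | tmul x l =>
    rw [TensorProduct.smul_tmul', localFrob_tmul, localFrob_tmul, frobOver_smul hv hF]
    rfl
  | add x y hx hy => simp only [smul_add, map_add, hx, hy]

/-- The map `(1 ⊗ τ) ⊗ ψ`. -/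
def localMap {L L' : Lattice K} (v : HeightOneSpectrum (𝓞 K)) {F F' : IntermediateField K (AlgebraicClosure K)}
    (τ : F →ₐ[K] F') (ψ : L →ₗ[ℤ] L') :
    (v.adicCompletion K ⊗[K] F) ⊗[ℤ] L →ₗ[ℤ] (v.adicCompletion K ⊗[K] F') ⊗[ℤ] L' :=
  TensorProduct.map (Algebra.TensorProduct.map
    (AlgHom.id (v.adicCompletion K) (v.adicCompletion K)) τ).toRingHom.toAddMonoidHom.toIntLinearMap ψ

theorem localFrob_localMap (hv : IsUnramified v) {F F' : IntermediateField K (AlgebraicClosure K)}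
    [FiniteDimensional K F] [FiniteDimensional K F']
    (hF : IsUnramifiedIn v F) (hF' : IsUnramifiedIn v F') (τ : F →ₐ[K] F') (ψ : L →ₗ[ℤ] L')
    (x : (v.adicCompletion K ⊗[K] F) ⊗[ℤ] L) :
    L'.localFrob v F' (localMap v τ ψ x) = localMap v τ ψ (L.localFrob v F x) := by
  induction x using TensorProduct.induction_on with
  | zero => simp
  | tmul x l =>
    exact congrArg (· ⊗ₜ ψ l) (frobOver_map hv hF hF' τ x)
  | add x y hx hy => simp only [map_add, hx, hy]

theorem baseChange_localEmb {F F' : IntermediateField K (AlgebraicClosure K)}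
    (θ : AlgebraicClosure K →ₗ[K] AlgebraicClosure K) (τ : F →ₐ[K] F') (h : ∀ a : F, θ a = τ a)
    (ψ : L →ₗ[ℤ] L') (x : (v.adicCompletion K ⊗[K] F) ⊗[ℤ] L) :
    (AlgebraTensorModule.map θ ψ).baseChange (v.adicCompletion K) (L.localEmb v F x) =
      L'.localEmb v F' (localMap v τ ψ x) := by
  induction x using TensorProduct.induction_on with
  | zero => simp
  | tmul x l =>
    induction x using TensorProduct.induction_on with
    | zero => simp
    | tmul c a =>
      change c ⊗ₜ (θ a ⊗ₜ ψ l) = c ⊗ₜ ((τ a : AlgebraicClosure K) ⊗ₜ ψ l)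
      rw [h]
    | add x y hx hy => simp only [add_tmul, map_add, hx, hy]
  | add x y hx hy => simp only [map_add, hx, hy]

theorem localEmb_mem_iff (x : (v.adicCompletion K ⊗[K] L.splittingField) ⊗[ℤ] L) :
    L.localEmb v L.splittingField x ∈ L.crys v ↔ ∀ γ, localMap v (L.restrict γ) (L.ρ γ) x = x := by
  refine forall_congr' fun γ => ?_
  have := L.baseChange_localEmb (v := v) (L' := L) γ.toLinearMap (L.restrict γ) (fun a => rfl) (L.ρ γ) x
  change (AlgebraTensorModule.map γ.toLinearMap (L.ρ γ)).baseChange (v.adicCompletion K) _ = _ ↔ _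
  rw [this]
  exact (L.localEmb_injective v _).eq_iff

theorem localFrob_mem_iff (hv : IsUnramified v) (hL : IsUnramifiedIn v L.splittingField)
    (x : (v.adicCompletion K ⊗[K] L.splittingField) ⊗[ℤ] L) :
    L.localEmb v L.splittingField (L.localFrob v L.splittingField x) ∈ L.crys v ↔
      L.localEmb v L.splittingField x ∈ L.crys v := by
  rw [localEmb_mem_iff, localEmb_mem_iff]
  refine forall_congr' fun γ => ?_
  rw [← L.localFrob_localMap hv hL hL]
  exact (L.localFrob v L.splittingField).injective.eq_iff

/-- The Frobenius of `(K_v ⊗_K K̄ ⊗ L)^{Gal(K̄/K)} ⊆ (K_v ⊗_K E) ⊗ L`, for `E` the splitting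
field: the restriction of `φ ⊗ 1`. -/
def crysFrob (v : HeightOneSpectrum (𝓞 K)) (hv : IsUnramified v)
    (hL : IsUnramifiedIn v L.splittingField) :
    L.crys v →ₛₗ[(frob v : v.adicCompletion K →+* v.adicCompletion K)] L.crys v where
  toFun x := ⟨L.localEmb v L.splittingField
    (L.localFrob v L.splittingField (L.exists_localEmb v x.2).choose),
    (L.localFrob_mem_iff hv hL _).mpr (by
      rw [(L.exists_localEmb v x.2).choose_spec]; exact x.2)⟩
  map_add' x y := by
    apply Subtype.ext
    change L.localEmb v _ _ = L.localEmb v _ _ + L.localEmb v _ _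
    rw [← map_add, ← map_add]
    congr 2
    apply L.localEmb_injective v
    rw [map_add, (L.exists_localEmb v x.2).choose_spec, (L.exists_localEmb v y.2).choose_spec,
      (L.exists_localEmb v (x + y).2).choose_spec]
    rfl
  map_smul' c x := by
    apply Subtype.ext
    change L.localEmb v _ _ = frob v c • L.localEmb v _ _
    rw [← map_smul, ← L.localFrob_smul hv _ hL]
    congr 2
    apply L.localEmb_injective v
    rw [map_smul, (L.exists_localEmb v x.2).choose_spec, (L.exists_localEmb v (c • x).2).choose_spec]
    rfl

theorem coe_crysFrob (hv : IsUnramified v) (hL : IsUnramifiedIn v L.splittingField) (x : L.crys v)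
    (F : IntermediateField K (AlgebraicClosure K)) [FiniteDimensional K F]
    (hLF : L.splittingField ≤ F) (hF : IsUnramifiedIn v F)
    (y : (v.adicCompletion K ⊗[K] F) ⊗[ℤ] L) (hy : L.localEmb v F y = x) :
    (L.crysFrob v hv hL x : v.adicCompletion K ⊗[K] (AlgebraicClosure K ⊗[ℤ] L)) =
      L.localEmb v F (L.localFrob v F y) := by
  have hid : (AlgebraTensorModule.map (LinearMap.id : AlgebraicClosure K →ₗ[K] AlgebraicClosure K)
      (LinearMap.id : L →ₗ[ℤ] L)).baseChange (v.adicCompletion K) = LinearMap.id := by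
    rw [AlgebraTensorModule.map_id, LinearMap.baseChange_id]
  have key := fun z => L.baseChange_localEmb (v := v) (L' := L) LinearMap.id
    (IntermediateField.inclusion hLF) (fun a => rfl) LinearMap.id z
  simp only [hid, LinearMap.id_apply] at key
  have h1 : L.localEmb v F y = L.localEmb v F (localMap v (IntermediateField.inclusion hLF)
      LinearMap.id (L.exists_localEmb v x.2).choose) := by
    rw [hy, ← key, (L.exists_localEmb v x.2).choose_spec]
  rw [L.localEmb_injective v F h1, L.localFrob_localMap hv hL hF, ← key]
  rfl

theorem crysFrob_bijective (hv : IsUnramified v) (hL : IsUnramifiedIn v L.splittingField) :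
    Function.Bijective (L.crysFrob v hv hL) := by
  have h := fun x y => L.coe_crysFrob hv hL x L.splittingField le_rfl hL y
  constructor
  · intro x x' hx
    obtain ⟨y, hy⟩ := L.exists_localEmb v x.2
    obtain ⟨y', hy'⟩ := L.exists_localEmb v x'.2
    have h1 := congrArg Subtype.val hx
    rw [h x y hy, h x' y' hy'] at h1
    apply Subtype.ext
    rw [← hy, ← hy', (L.localFrob v _).injective (L.localEmb_injective v _ h1)]
  · intro x
    obtain ⟨y, hy⟩ := L.exists_localEmb v x.2
    obtain ⟨z, rfl⟩ := (L.localFrob v L.splittingField).surjective y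
    refine ⟨⟨L.localEmb v L.splittingField z, (L.localFrob_mem_iff hv hL z).mp (hy ▸ x.2)⟩, ?_⟩
    apply Subtype.ext
    rw [h _ z rfl, hy]

/-- The Frobenius has finite order. -/
theorem exists_iterate_crysFrob (hv : IsUnramified v) (hL : IsUnramifiedIn v L.splittingField) :
    ∃ m : ℕ, 0 < m ∧ ∀ x, (L.crysFrob v hv hL)^[m] x = x := by
  obtain ⟨m, hm, h⟩ := (isStrict_integersOver (E := L.splittingField) hv hL).2
  refine ⟨m, hm, fun x => ?_⟩
  have h1 : ∀ z, (L.localFrob v L.splittingField)^[m] z = z := by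
    intro z
    have h2 : ∀ n : ℕ, ∀ x : v.adicCompletion K ⊗[K] L.splittingField, ∀ l : L,
        (L.localFrob v L.splittingField)^[n] (x ⊗ₜ l) = (frobOver v L.splittingField)^[n] x ⊗ₜ l := by
      intro n
      induction n with
      | zero => intro x l; rfl
      | succ n ih => intro x l; rw [Function.iterate_succ_apply, localFrob_tmul, ih]; rfl
    induction z using TensorProduct.induction_on with
    | zero => exact iterate_map_zero _ _
    | tmul x l => rw [h2]; exact congrArg (· ⊗ₜ l) (h x)
    | add x y hx hy => rw [iterate_map_add, hx, hy]
  obtain ⟨y, hy⟩ := L.exists_localEmb v x.2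
  have h3 : ∀ n : ℕ, ((L.crysFrob v hv hL)^[n] x : v.adicCompletion K ⊗[K] (AlgebraicClosure K ⊗[ℤ] L))
      = L.localEmb v L.splittingField ((L.localFrob v L.splittingField)^[n] y) := by
    intro n
    induction n with
    | zero => exact hy.symm
    | succ n ih =>
      rw [Function.iterate_succ_apply', Function.iterate_succ_apply']
      exact L.coe_crysFrob hv hL _ L.splittingField le_rfl hL _ ih.symm
  apply Subtype.ext
  rw [h3, h1, hy]

end Lattice

end

/-! ## The categories -/

section

/-- An object `(V, (V_v, F_v), (g_v))` of the Ogus category of the number field `K`. The local data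
are given for the places `v` in a cofinite set of places that are unramified over `ℚ`. -/
structure Og (K : Type u) [Field K] [NumberField K] where
  V : Type u
  [addCommGroup : AddCommGroup V]
  [module : Module K V]
  [finite : FiniteDimensional K V]
  places : Set (HeightOneSpectrum (𝓞 K))
  isUnramified : ∀ v ∈ places, IsUnramified v
  cofinite : ∀ᶠ v in cofinite, v ∈ places
  Vloc : ∀ v ∈ places, Type u
  [addCommGroupLoc : ∀ v hv, AddCommGroup (Vloc v hv)]
  [moduleLoc : ∀ v hv, Module (v.adicCompletion K) (Vloc v hv)]
  [finiteLoc : ∀ v hv, FiniteDimensional (v.adicCompletion K) (Vloc v hv)]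
  F : ∀ v hv, Vloc v hv →ₛₗ[(frob v : v.adicCompletion K →+* v.adicCompletion K)] Vloc v hv
  F_bijective : ∀ v hv, Function.Bijective (F v hv)
  g : ∀ v hv, v.adicCompletion K ⊗[K] V ≃ₗ[v.adicCompletion K] Vloc v hv

attribute [instance] Og.addCommGroup Og.module Og.finite Og.addCommGroupLoc Og.moduleLoc
  Og.finiteLoc

variable {K : Type u} [Field K] [NumberField K]

/-- A `K`-linear map `f : V → V'` underlies a morphism of the Ogus category if for almost all `v`
there is a `K_v`-linear map `V_v → V'_v` which corresponds to `f ⊗ K_v` under `g_v` and `g'_v` and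
which commutes with the Frobenius maps. -/
def IsOgHom (X Y : Og K) (f : X.V →ₗ[K] Y.V) : Prop :=
  ∀ᶠ v in cofinite, ∃ (hX : v ∈ X.places) (hY : v ∈ Y.places)
    (φ : X.Vloc v hX →ₗ[v.adicCompletion K] Y.Vloc v hY),
    (∀ x, φ (X.g v hX x) = Y.g v hY (f.baseChange (v.adicCompletion K) x)) ∧
    ∀ x, φ (X.F v hX x) = Y.F v hY (φ x)

/-- Morphisms of the Ogus category. The local components are determined by the `K`-linear map,
so that this is the colimit, over the cofinite sets of places, of the sets of compatible families
`(f, (f_v)_v)`. -/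
@[ext]
structure Og.Hom (X Y : Og K) where
  toLinearMap : X.V →ₗ[K] Y.V
  isOgHom : IsOgHom X Y toLinearMap

theorem isOgHom_id (X : Og K) : IsOgHom X X LinearMap.id := by
  filter_upwards [X.cofinite] with v hv
  exact ⟨hv, hv, LinearMap.id, fun x => by rw [LinearMap.baseChange_id]; rfl, fun x => rfl⟩

theorem IsOgHom.comp {X Y Z : Og K} {f : X.V →ₗ[K] Y.V} {f' : Y.V →ₗ[K] Z.V}
    (hf' : IsOgHom Y Z f') (hf : IsOgHom X Y f) : IsOgHom X Z (f' ∘ₗ f) := by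
  filter_upwards [hf, hf'] with v h h'
  obtain ⟨hX, hY, φ, h1, h2⟩ := h
  obtain ⟨_, hZ, φ', h1', h2'⟩ := h'
  refine ⟨hX, hZ, φ' ∘ₗ φ, fun x => ?_, fun x => ?_⟩
  · rw [LinearMap.comp_apply, h1, h1', LinearMap.baseChange_comp]; rfl
  · rw [LinearMap.comp_apply, h2, h2']; rfl

instance : Category (Og K) where
  Hom := Og.Hom
  id X := ⟨LinearMap.id, isOgHom_id X⟩
  comp f g := ⟨g.toLinearMap ∘ₗ f.toLinearMap, g.isOgHom.comp f.isOgHom⟩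

/-- The `K_v`-subspace of `V_v` that corresponds to a `K`-subspace of `V`. -/
def Og.localize (X : Og K) (W : Submodule K X.V) (v : HeightOneSpectrum (𝓞 K))
    (hv : v ∈ X.places) : Submodule (v.adicCompletion K) (X.Vloc v hv) :=
  (W.baseChange (v.adicCompletion K)).map (X.g v hv).toLinearMap

/-- Weil numbers of weight `i` relative to the residue field of `v`: algebraic numbers all of whose
complex conjugates have absolute value `p_v ^ (i n_v / 2)`. -/
def IsWeilNumber (v : HeightOneSpectrum (𝓞 K)) (i : ℤ)
    (α : AlgebraicClosure (v.adicCompletion K)) : Prop :=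
  IsAlgebraic ℚ α ∧ ∀ z : ℂ, Polynomial.aeval z (minpoly ℚ α) = 0 →
    ‖z‖ = (residueChar v : ℝ) ^ ((i : ℝ) * residueDegree v / 2)

/-- A vector space with an endomorphism is pure of weight `i` if all eigenvalues of the
endomorphism (in an algebraic closure of `K_v`) are Weil numbers of weight `i`. -/
def IsPure (v : HeightOneSpectrum (𝓞 K)) (i : ℤ) {H : Type u} [AddCommGroup H]
    [Module (v.adicCompletion K) H] (ψ : H →ₗ[v.adicCompletion K] H) : Prop :=
  ∀ α : AlgebraicClosure (v.adicCompletion K),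
    Module.End.HasEigenvalue (ψ.baseChange (AlgebraicClosure (v.adicCompletion K))) α →
      IsWeilNumber v i α

variable (K) in
/-- Objects of the enriched Ogus category: objects of the Ogus category with an increasing finite
exhaustive filtration by subobjects such that the `i`-th graded piece is pure of weight `i`, which
means that for almost all `v` the endomorphism `ψ` that the `K_v`-linear map `F_v ^ {n_v}` induces
on `W_i V_v / W_{i-1} V_v` is pure of weight `i`. -/
structure FOg extends Og K where
  W : ℤ → Submodule K V
  monotone : Monotone W
  exists_eq_bot : ∃ m, W m = ⊥
  exists_eq_top : ∃ n, W n = ⊤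
  map_mem : ∀ i, ∀ᶠ v in Filter.cofinite, ∃ hv : v ∈ places,
    ∀ x, F v hv x ∈ toOg.localize (W i) v hv ↔ x ∈ toOg.localize (W i) v hv
  pure : ∀ i, ∀ᶠ v in Filter.cofinite, ∃ (hv : v ∈ places)
    (ψ : (toOg.localize (W i) v hv ⧸
        (toOg.localize (W (i - 1)) v hv).submoduleOf (toOg.localize (W i) v hv))
      →ₗ[v.adicCompletion K]
      (toOg.localize (W i) v hv ⧸
        (toOg.localize (W (i - 1)) v hv).submoduleOf (toOg.localize (W i) v hv))),
    (∀ x y : toOg.localize (W i) v hv,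
      (y : Vloc v hv) = (F v hv)^[residueDegree v] x →
        ψ (Submodule.Quotient.mk x) = Submodule.Quotient.mk y) ∧
    IsPure v i ψ

/-- Morphisms are the morphisms in the Ogus category. -/
@[ext]
structure FOg.Hom (X Y : FOg K) where
  hom : X.toOg ⟶ Y.toOg

instance : Category (FOg K) where
  Hom := FOg.Hom
  id X := ⟨𝟙 X.toOg⟩
  comp f g := ⟨f.hom ≫ g.hom⟩

/-! ### Artin motives up to isogeny -/

/-- Homomorphisms of lattices. -/
def Lattice.Hom (L L' : Lattice K) : Submodule ℤ (L →ₗ[ℤ] L') where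
  carrier := {f | ∀ γ, f ∘ₗ L.ρ γ = L'.ρ γ ∘ₗ f}
  add_mem' hf hg γ := by rw [LinearMap.add_comp, LinearMap.comp_add, hf γ, hg γ]
  zero_mem' γ := by rw [LinearMap.zero_comp, LinearMap.comp_zero]
  smul_mem' c f hf γ := by rw [LinearMap.smul_comp, LinearMap.comp_smul, hf γ]

/-- The identity homomorphism. -/
def Lattice.Hom.id (L : Lattice K) : Lattice.Hom L L := ⟨LinearMap.id, fun _ => rfl⟩

/-- Composition of homomorphisms as a bilinear map. -/
def Lattice.Hom.comp (L L' L'' : Lattice K) :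
    Lattice.Hom L L' →ₗ[ℤ] Lattice.Hom L' L'' →ₗ[ℤ] Lattice.Hom L L'' :=
  LinearMap.mk₂ ℤ (fun f g => ⟨g.1 ∘ₗ f.1, fun γ => by
      rw [LinearMap.comp_assoc, f.2 γ, ← LinearMap.comp_assoc, g.2 γ, LinearMap.comp_assoc]⟩)
    (fun _ _ _ => Subtype.ext (LinearMap.comp_add _ _ _))
    (fun _ _ _ => Subtype.ext (LinearMap.comp_smul _ _ _))
    (fun _ _ _ => Subtype.ext (LinearMap.add_comp _ _ _))
    (fun _ _ _ => Subtype.ext (LinearMap.smul_comp _ _ _))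

variable (K) in
/-- The category of Artin motives `[L → 0]` over `K` up to isogeny: the objects are the lattices
and the group of morphisms from `L` to `L'` is `ℚ ⊗ Hom(L, L')`. -/
structure ArtinMotive where
  lattice : Lattice K

/-- Composition in `ℚ ⊗ Hom`. -/
def ArtinMotive.comp (L L' L'' : Lattice K) :
    ℚ ⊗[ℤ] Lattice.Hom L L' →ₗ[ℤ] ℚ ⊗[ℤ] Lattice.Hom L' L'' →ₗ[ℤ] ℚ ⊗[ℤ] Lattice.Hom L L'' :=
  TensorProduct.map₂ (LinearMap.mul ℤ ℚ) (Lattice.Hom.comp L L' L'')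

theorem ArtinMotive.comp_tmul {L L' L'' : Lattice K} (q r : ℚ) (f : Lattice.Hom L L')
    (g : Lattice.Hom L' L'') : ArtinMotive.comp L L' L'' (q ⊗ₜ f) (r ⊗ₜ g) =
      (q * r) ⊗ₜ Lattice.Hom.comp L L' L'' f g := rfl

theorem ArtinMotive.id_comp {L L' : Lattice K} (x : ℚ ⊗[ℤ] Lattice.Hom L L') :
    ArtinMotive.comp L L L' (1 ⊗ₜ Lattice.Hom.id L) x = x := by
  induction x using TensorProduct.induction_on with
  | zero => simp
  | tmul q f => rw [comp_tmul, one_mul]; rfl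
  | add x y hx hy => rw [map_add, hx, hy]

theorem ArtinMotive.comp_id {L L' : Lattice K} (x : ℚ ⊗[ℤ] Lattice.Hom L L') :
    ArtinMotive.comp L L' L' x (1 ⊗ₜ Lattice.Hom.id L') = x := by
  induction x using TensorProduct.induction_on with
  | zero => simp
  | tmul q f => rw [comp_tmul, mul_one]; rfl
  | add x y hx hy => rw [map_add, LinearMap.add_apply, hx, hy]

theorem ArtinMotive.assoc {L₁ L₂ L₃ L₄ : Lattice K} (x : ℚ ⊗[ℤ] Lattice.Hom L₁ L₂)
    (y : ℚ ⊗[ℤ] Lattice.Hom L₂ L₃) (z : ℚ ⊗[ℤ] Lattice.Hom L₃ L₄) :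
    ArtinMotive.comp L₁ L₃ L₄ (ArtinMotive.comp L₁ L₂ L₃ x y) z =
      ArtinMotive.comp L₁ L₂ L₄ x (ArtinMotive.comp L₂ L₃ L₄ y z) := by
  induction x using TensorProduct.induction_on with
  | zero => simp
  | add x x' hx hx' => simp only [map_add, LinearMap.add_apply, hx, hx']
  | tmul q f =>
    induction y using TensorProduct.induction_on with
    | zero => simp
    | add y y' hy hy' => simp only [map_add, LinearMap.add_apply, hy, hy']
    | tmul r g =>
      induction z using TensorProduct.induction_on with
      | zero => simp
      | add z z' hz hz' => simp only [map_add, hz, hz']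
      | tmul s h =>
        simp only [comp_tmul, mul_assoc]
        rfl

instance : Category (ArtinMotive K) where
  Hom M N := ℚ ⊗[ℤ] Lattice.Hom M.lattice N.lattice
  id M := 1 ⊗ₜ Lattice.Hom.id M.lattice
  comp f g := ArtinMotive.comp _ _ _ f g
  id_comp := ArtinMotive.id_comp
  comp_id := ArtinMotive.comp_id
  assoc := ArtinMotive.assoc

/-! ### The realization of a lattice -/

/-- The map `K̄ ⊗ L → K̄ ⊗ L'`. -/
def Lattice.mapTensor {L L' : Lattice K} (f : L →ₗ[ℤ] L') :
    AlgebraicClosure K ⊗[ℤ] L →ₗ[K] AlgebraicClosure K ⊗[ℤ] L' :=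
  AlgebraTensorModule.map LinearMap.id f

theorem Lattice.mapTensor_add {L L' : Lattice K} (f g : L →ₗ[ℤ] L') :
    mapTensor (f + g) = mapTensor f + mapTensor g :=
  AlgebraTensorModule.map_add_right _ _ _

theorem Lattice.mapTensor_zsmul {L L' : Lattice K} (n : ℤ) (f : L →ₗ[ℤ] L') :
    mapTensor (n • f) = n • mapTensor f := by
  ext x l
  exact TensorProduct.tmul_smul n x (f l)

theorem Lattice.galAct_mapTensor {L L' : Lattice K} (f : Lattice.Hom L L')
    (γ : AlgebraicClosure K ≃ₐ[K] AlgebraicClosure K) :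
    L'.galAct γ ∘ₗ mapTensor f.1 = mapTensor f.1 ∘ₗ L.galAct γ := by
  rw [galAct, galAct, mapTensor, ← AlgebraTensorModule.map_comp, ← AlgebraTensorModule.map_comp,
    f.2 γ]
  rfl

/-- `T_dR(f) : T_dR(L) → T_dR(L')` -/
def Lattice.deRhamMap {L L' : Lattice K} (f : Lattice.Hom L L') : L.deRham →ₗ[K] L'.deRham :=
  (mapTensor f.1).restrict fun x hx γ => by
    rw [← LinearMap.comp_apply, galAct_mapTensor, LinearMap.comp_apply, hx γ]

/-- `ℚ ⊗ Hom(L, L') → Hom_K(T_dR(L), T_dR(L'))` -/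
def Lattice.realize (L L' : Lattice K) :
    ℚ ⊗[ℤ] Lattice.Hom L L' →ₗ[ℤ] (L.deRham →ₗ[K] L'.deRham) :=
  TensorProduct.lift <| LinearMap.mk₂ ℤ (fun (q : ℚ) f => (algebraMap ℚ K q) • deRhamMap f)
    (fun q r f => by rw [map_add, add_smul])
    (fun n q f => by rw [map_zsmul, smul_assoc])
    (fun q f g => by
      rw [← smul_add]; congr 1; ext x
      exact LinearMap.congr_fun (mapTensor_add f.1 g.1) x.1)
    (fun n q f => by
      rw [smul_comm]; congr 1; ext x
      exact LinearMap.congr_fun (mapTensor_zsmul n f.1) x.1)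

theorem Lattice.realize_tmul {L L' : Lattice K} (q : ℚ) (f : Lattice.Hom L L') :
    realize L L' (q ⊗ₜ f) = (algebraMap ℚ K q) • deRhamMap f := rfl

/-- The places at which the Frobenius of the realization is defined. -/
def Lattice.goodPlaces (L : Lattice K) : Set (HeightOneSpectrum (𝓞 K)) :=
  {v | IsUnramified v ∧ IsUnramifiedIn v L.splittingField}

theorem Lattice.eventually_goodPlaces (L : Lattice K) :
    ∀ᶠ v in cofinite, v ∈ L.goodPlaces :=
  (eventually_cofinite.mpr finite_not_isUnramified).and
    (eventually_cofinite.mpr (finite_not_isUnramifiedIn K L.splittingField))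

/-- The object of the Ogus category attached to `[L → 0]`. -/
def Lattice.toOg (L : Lattice K) : Og K where
  V := L.deRham
  places := L.goodPlaces
  isUnramified _ hv := hv.1
  cofinite := L.eventually_goodPlaces
  Vloc v _ := L.crys v
  finiteLoc v _ := Module.Finite.equiv (L.comparison v)
  F v hv := L.crysFrob v hv.1 hv.2
  F_bijective _ hv := L.crysFrob_bijective hv.1 hv.2
  g v _ := L.comparison v

/-- An endomorphism of finite order is pure of weight `0`. -/
theorem isPure_of_pow_eq_one {v : HeightOneSpectrum (𝓞 K)} {H : Type u} [AddCommGroup H]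
    [Module (v.adicCompletion K) H] (ψ : H →ₗ[v.adicCompletion K] H) {m : ℕ} (hm : 0 < m)
    (h : ψ ^ m = 1) : IsPure v 0 ψ := by
  intro α hα
  obtain ⟨x, hx⟩ := hα.exists_hasEigenvector
  have h1 := hx.pow_apply m
  have h2 : (ψ.baseChange (AlgebraicClosure (v.adicCompletion K))) ^ m = 1 := by
    rw [← LinearMap.baseChange_pow, h]
    exact LinearMap.baseChange_one _ _
  rw [h2] at h1
  have h3 : α ^ m = 1 := by
    have h4 : (1 : AlgebraicClosure (v.adicCompletion K)) • x = α ^ m • x := by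
      rw [one_smul, ← h1]; rfl
    exact (smul_left_injective _ hx.2 h4).symm
  have h6 : Polynomial.aeval α (Polynomial.X ^ m - 1 : Polynomial ℚ) = 0 := by simp [h3]
  refine ⟨⟨Polynomial.X ^ m - 1, (Polynomial.monic_X_pow_sub_C 1 hm.ne').ne_zero, h6⟩, fun z hz => ?_⟩
  obtain ⟨r, hr⟩ := minpoly.dvd ℚ α h6
  have h7 : z ^ m = 1 := by
    have := congrArg (Polynomial.aeval z) hr
    rw [map_mul, hz, zero_mul] at this
    simpa [sub_eq_zero] using this
  rw [Complex.norm_eq_one_of_pow_eq_one h7 hm.ne']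
  simp

end

/-! ## The realization functor -/

section

variable {K : Type u} [Field K] [NumberField K]

theorem isPure_of_subsingleton {v : HeightOneSpectrum (𝓞 K)} {i : ℤ} {H : Type u} [AddCommGroup H]
    [Module (v.adicCompletion K) H] [Subsingleton H] (ψ : H →ₗ[v.adicCompletion K] H) :
    IsPure v i ψ := by
  intro α hα
  obtain ⟨x, hx⟩ := hα.exists_hasEigenvector
  have h : ∀ y : AlgebraicClosure (v.adicCompletion K) ⊗[v.adicCompletion K] H, y = 0 := by
    intro y
    induction y using TensorProduct.induction_on with
    | zero => rfl
    | tmul a b => rw [Subsingleton.elim b 0, tmul_zero]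
    | add a b ha hb => rw [ha, hb, add_zero]
  exact absurd (h x) hx.2

theorem Og.localize_top (X : Og K) (v : HeightOneSpectrum (𝓞 K)) (hv : v ∈ X.places) :
    X.localize ⊤ v hv = ⊤ := by
  rw [Og.localize, Submodule.baseChange_top, Submodule.map_top]
  exact LinearEquiv.range _

theorem Og.localize_bot (X : Og K) (v : HeightOneSpectrum (𝓞 K)) (hv : v ∈ X.places) :
    X.localize ⊥ v hv = ⊥ := by
  rw [Og.localize, Submodule.baseChange_bot, Submodule.map_bot]

/-- The `n_v`-th power of the Frobenius is linear. -/
def Og.linearFrob (X : Og K) (v : HeightOneSpectrum (𝓞 K)) (hv : v ∈ X.places) :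
    X.Vloc v hv →ₗ[v.adicCompletion K] X.Vloc v hv where
  toFun := (X.F v hv)^[residueDegree v]
  map_add' x y := iterate_map_add _ _ x y
  map_smul' c x := by
    have h : ∀ (n : ℕ) (c : v.adicCompletion K) (x : X.Vloc v hv),
        (X.F v hv)^[n] (c • x) = (frob v)^[n] c • (X.F v hv)^[n] x := by
      intro n
      induction n with
      | zero => intro c x; rfl
      | succ n ih =>
        intro c x
        rw [Function.iterate_succ_apply, map_smulₛₗ, ih]
        rfl
    rw [h, (isStrict_integers (X.isUnramified v hv)).2]
    rfl

/-- The pure weight zero filtration. -/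
def trivialFiltration (V : Type u) [AddCommGroup V] [Module K V] (i : ℤ) : Submodule K V :=
  if 0 ≤ i then ⊤ else ⊥

theorem trivialFiltration_of_nonneg {V : Type u} [AddCommGroup V] [Module K V] {i : ℤ}
    (hi : 0 ≤ i) : trivialFiltration (K := K) V i = ⊤ := if_pos hi

theorem trivialFiltration_of_neg {V : Type u} [AddCommGroup V] [Module K V] {i : ℤ}
    (hi : i < 0) : trivialFiltration (K := K) V i = ⊥ := if_neg hi.not_ge

theorem Og.mem_localize_trivialFiltration (X : Og K) (v : HeightOneSpectrum (𝓞 K))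
    (hv : v ∈ X.places) (i : ℤ) (x : X.Vloc v hv) :
    X.F v hv x ∈ X.localize (trivialFiltration X.V i) v hv ↔
      x ∈ X.localize (trivialFiltration X.V i) v hv := by
  rcases lt_or_ge i 0 with hi | hi
  · rw [trivialFiltration_of_neg hi, Og.localize_bot, Submodule.mem_bot, Submodule.mem_bot]
    exact map_eq_zero_iff _ (X.F_bijective v hv).1
  · rw [trivialFiltration_of_nonneg hi, Og.localize_top]
    simp

/-- The realization of `[L → 0]`, pure of weight `0`. -/
def Lattice.toFOg (L : Lattice K) : FOg K where
  toOg := L.toOg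
  W := trivialFiltration L.toOg.V
  monotone i j hij := by
    rcases lt_or_ge i 0 with hi | hi
    · rw [trivialFiltration_of_neg hi]; exact bot_le
    · rw [trivialFiltration_of_nonneg (hi.trans hij)]; exact le_top
  exists_eq_bot := ⟨-1, trivialFiltration_of_neg (by decide)⟩
  exists_eq_top := ⟨0, trivialFiltration_of_nonneg le_rfl⟩
  map_mem i := by
    filter_upwards [L.toOg.cofinite] with v hv
    exact ⟨hv, L.toOg.mem_localize_trivialFiltration v hv i⟩
  pure i := by
    filter_upwards [L.toOg.cofinite] with v hv
    have hit : ∀ (j : ℤ) (n : ℕ) (x : L.toOg.Vloc v hv),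
        x ∈ L.toOg.localize (trivialFiltration L.toOg.V j) v hv →
        (L.toOg.F v hv)^[n] x ∈ L.toOg.localize (trivialFiltration L.toOg.V j) v hv := by
      intro j n
      induction n with
      | zero => intro x hx; exact hx
      | succ n ih =>
        intro x hx
        exact ih _ ((L.toOg.mem_localize_trivialFiltration v hv j x).mpr hx)
    let A := L.toOg.localize (trivialFiltration L.toOg.V i) v hv
    let B := L.toOg.localize (trivialFiltration L.toOg.V (i - 1)) v hv
    let Φ : A →ₗ[v.adicCompletion K] A := (L.toOg.linearFrob v hv).restrict fun x hx => hit i _ x hx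
    let ψ : (A ⧸ B.submoduleOf A) →ₗ[v.adicCompletion K] (A ⧸ B.submoduleOf A) :=
      (B.submoduleOf A).mapQ (B.submoduleOf A) Φ fun x hx => hit (i - 1) _ x.1 hx
    refine ⟨hv, ψ, fun x y hxy => congrArg _ (Subtype.ext hxy.symm), ?_⟩
    rcases lt_trichotomy i 0 with hi | rfl | hi
    · have : Subsingleton (A ⧸ B.submoduleOf A) := by
        have hA : A = ⊥ := by
          change L.toOg.localize _ v hv = ⊥
          rw [trivialFiltration_of_neg hi, Og.localize_bot]
        have : Subsingleton A := by rw [hA]; infer_instance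
        exact (Submodule.Quotient.mk_surjective _).subsingleton
      exact isPure_of_subsingleton ψ
    · obtain ⟨m, hm, h⟩ := L.exists_iterate_crysFrob hv.1 hv.2
      refine isPure_of_pow_eq_one ψ hm ?_
      have hΦ : ∀ n : ℕ, ∀ x : A, (((Φ ^ n) x : A) : L.toOg.Vloc v hv) =
          ((L.toOg.F v hv)^[residueDegree v])^[n] x := by
        intro n
        induction n with
        | zero => intro x; rfl
        | succ n ih =>
          intro x
          rw [pow_succ, Module.End.mul_apply, ih]
          rfl
      have hψ : ∀ n : ℕ, ∀ x : A, (ψ ^ n) (Submodule.Quotient.mk x) =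
          Submodule.Quotient.mk ((Φ ^ n) x) := by
        intro n
        induction n with
        | zero => intro x; rfl
        | succ n ih =>
          intro x
          rw [pow_succ, Module.End.mul_apply, pow_succ, Module.End.mul_apply, ← ih]
          rfl
      ext x
      rw [LinearMap.comp_apply, Submodule.mkQ_apply, hψ]
      refine congrArg _ (Subtype.ext ?_)
      rw [hΦ, ← Function.iterate_mul, mul_comm, Function.iterate_mul]
      exact Function.iterate_fixed (h _) _
    · have : Subsingleton (A ⧸ B.submoduleOf A) := by
        have hB : B = ⊤ := by
          change L.toOg.localize _ v hv = ⊤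
          rw [trivialFiltration_of_nonneg (by omega), Og.localize_top]
        refine Submodule.Quotient.subsingleton_iff.mpr (eq_top_iff.mpr fun x _ => ?_)
        change x.1 ∈ B
        rw [hB]; exact Submodule.mem_top
      exact isPure_of_subsingleton ψ

theorem Lattice.baseChange_comparison {L L' : Lattice K} (f : Lattice.Hom L L')
    (v : HeightOneSpectrum (𝓞 K)) (x : v.adicCompletion K ⊗[K] L.deRham) :
    (mapTensor f.1).baseChange (v.adicCompletion K) (L.comparison v x).1 =
      (L'.comparison v ((deRhamMap f).baseChange (v.adicCompletion K) x)).1 := by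
  induction x using TensorProduct.induction_on with
  | zero => simp
  | tmul c y => rfl
  | add x y hx hy =>
    rw [map_add, map_add, map_add]
    exact (map_add _ _ _).trans (congrArg₂ _ hx hy)

theorem Lattice.isOgHom_deRhamMap {L L' : Lattice K} (f : Lattice.Hom L L') :
    IsOgHom L.toOg L'.toOg (deRhamMap f) := by
  let F : IntermediateField K (AlgebraicClosure K) := L.splittingField ⊔ L'.splittingField
  have : FiniteDimensional K F := IntermediateField.finiteDimensional_sup _ _
  filter_upwards [L.toOg.cofinite, L'.toOg.cofinite,
    eventually_cofinite.mpr (finite_not_isUnramifiedIn K F)] with v hv hv' hF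
  have hcomm : ∀ γ, (L'.galAct γ).baseChange (v.adicCompletion K) ∘ₗ
      (mapTensor f.1).baseChange (v.adicCompletion K) =
      (mapTensor f.1).baseChange (v.adicCompletion K) ∘ₗ
        (L.galAct γ).baseChange (v.adicCompletion K) := by
    intro γ
    rw [← LinearMap.baseChange_comp, galAct_mapTensor, LinearMap.baseChange_comp]
  let φ : L.crys v →ₗ[v.adicCompletion K] L'.crys v :=
    ((mapTensor f.1).baseChange (v.adicCompletion K)).restrict fun x hx γ => by
      rw [← LinearMap.comp_apply, hcomm, LinearMap.comp_apply, hx γ]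
  refine ⟨hv, hv', φ, fun x => ?_, fun x => ?_⟩
  · apply Subtype.ext
    exact baseChange_comparison f v x
  · obtain ⟨y, hy⟩ := L.exists_localEmb v x.2
    have hin : ∀ z, L.localEmb v L.splittingField z = L.localEmb v F
        (localMap v (IntermediateField.inclusion le_sup_left) LinearMap.id z) := by
      intro z
      have := L.baseChange_localEmb (v := v) (L' := L) LinearMap.id
        (IntermediateField.inclusion (le_sup_left : L.splittingField ≤ F))
        (fun a => rfl) LinearMap.id z
      rwa [AlgebraTensorModule.map_id, LinearMap.baseChange_id] at this
    rw [hin] at hy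
    set w := localMap v (IntermediateField.inclusion
      (le_sup_left : L.splittingField ≤ F)) LinearMap.id y
    have hmap : ∀ z, (mapTensor f.1).baseChange (v.adicCompletion K) (L.localEmb v F z) =
        L'.localEmb v F (localMap v (AlgHom.id K F) f.1 z) := fun z =>
      L.baseChange_localEmb (v := v) (L' := L') LinearMap.id (AlgHom.id K F) (fun a => rfl) f.1 z
    have h1 := L.coe_crysFrob hv.1 hv.2 x F le_sup_left hF w hy
    have h2 := L'.coe_crysFrob hv'.1 hv'.2 (φ x) F le_sup_right hF
      (localMap v (AlgHom.id K F) f.1 w) (by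
        rw [← hmap, hy]; rfl)
    apply Subtype.ext
    refine Eq.trans ?_ h2.symm
    rw [L.localFrob_localMap hv.1 hF hF, ← hmap, ← h1]
    rfl

theorem isOgHom_zero (X Y : Og K) : IsOgHom X Y 0 := by
  filter_upwards [X.cofinite, Y.cofinite] with v hv hv'
  exact ⟨hv, hv', 0, fun x => by simp, fun x => by simp⟩

theorem IsOgHom.add {X Y : Og K} {f g : X.V →ₗ[K] Y.V} (hf : IsOgHom X Y f) (hg : IsOgHom X Y g) :
    IsOgHom X Y (f + g) := by
  filter_upwards [hf, hg] with v h h'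
  obtain ⟨hX, hY, φ, h1, h2⟩ := h
  obtain ⟨_, _, φ', h1', h2'⟩ := h'
  refine ⟨hX, hY, φ + φ', fun x => ?_, fun x => ?_⟩
  · simp only [LinearMap.add_apply, h1, h1', LinearMap.baseChange_add, map_add]
  · simp only [LinearMap.add_apply, h2, h2', map_add]

theorem IsOgHom.rat_smul {X Y : Og K} {f : X.V →ₗ[K] Y.V} (hf : IsOgHom X Y f) (q : ℚ) :
    IsOgHom X Y (algebraMap ℚ K q • f) := by
  filter_upwards [hf] with v h
  obtain ⟨hX, hY, φ, h1, h2⟩ := h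
  refine ⟨hX, hY, algebraMap ℚ (v.adicCompletion K) q • φ, fun x => ?_, fun x => ?_⟩
  · rw [LinearMap.smul_apply, h1, ← map_smul]
    congr 1
    induction x using TensorProduct.induction_on with
    | zero => simp
    | tmul c y =>
      rw [LinearMap.baseChange_tmul, LinearMap.baseChange_tmul, TensorProduct.smul_tmul',
        LinearMap.smul_apply, TensorProduct.tmul_smul, TensorProduct.smul_tmul',
        algebraMap_smul, algebraMap_smul]
    | add x y hx hy => rw [map_add, map_add, smul_add, hx, hy]
  · rw [LinearMap.smul_apply, LinearMap.smul_apply, h2, map_smulₛₗ]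
    congr 1
    exact (RingHom.map_rat_algebraMap (frob v : v.adicCompletion K →+* v.adicCompletion K) q).symm

theorem Lattice.isOgHom_realize {L L' : Lattice K} (x : ℚ ⊗[ℤ] Lattice.Hom L L') :
    IsOgHom L.toOg L'.toOg (realize L L' x) := by
  induction x using TensorProduct.induction_on with
  | zero => rw [map_zero]; exact isOgHom_zero _ _
  | tmul q f => exact (isOgHom_deRhamMap f).rat_smul q
  | add x y hx hy => rw [map_add]; exact hx.add hy

theorem Lattice.realize_id (L : Lattice K) : realize L L (1 ⊗ₜ Lattice.Hom.id L) = LinearMap.id := by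
  rw [realize_tmul, map_one, one_smul]
  ext x
  exact LinearMap.congr_fun AlgebraTensorModule.map_id x.1

theorem Lattice.deRhamMap_comp {L L' L'' : Lattice K} (f : Lattice.Hom L L')
    (g : Lattice.Hom L' L'') :
    deRhamMap (Lattice.Hom.comp L L' L'' f g) = deRhamMap g ∘ₗ deRhamMap f := by
  ext x
  exact LinearMap.congr_fun (AlgebraTensorModule.map_comp LinearMap.id LinearMap.id g.1 f.1) x.1

theorem Lattice.realize_comp {L L' L'' : Lattice K} (x : ℚ ⊗[ℤ] Lattice.Hom L L')
    (y : ℚ ⊗[ℤ] Lattice.Hom L' L'') :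
    realize L L'' (ArtinMotive.comp L L' L'' x y) = realize L' L'' y ∘ₗ realize L L' x := by
  induction x using TensorProduct.induction_on with
  | zero => simp
  | add x x' hx hx' =>
    rw [map_add, LinearMap.add_apply, map_add, hx, hx', map_add, LinearMap.comp_add]
  | tmul q f =>
    induction y using TensorProduct.induction_on with
    | zero => simp
    | add y y' hy hy' => rw [map_add, map_add, hy, hy', map_add, LinearMap.add_comp]
    | tmul r g =>
      rw [ArtinMotive.comp_tmul, realize_tmul, realize_tmul, realize_tmul, deRhamMap_comp,
        LinearMap.smul_comp, LinearMap.comp_smul, smul_smul, map_mul, mul_comm]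

variable (K) in
/-- The Ogus realization of Artin motives up to isogeny. -/
def ogusRealization : ArtinMotive K ⥤ FOg K where
  obj M := M.lattice.toFOg
  map f := ⟨⟨Lattice.realize _ _ f, Lattice.isOgHom_realize f⟩⟩
  map_id M := FOg.Hom.ext (Og.Hom.ext (Lattice.realize_id M.lattice))
  map_comp f g := FOg.Hom.ext (Og.Hom.ext (Lattice.realize_comp f g))

end

end OgusRealization

end

noncomputable section

namespace OgusRealization

open IsDedekindDomain NumberField TensorProduct CategoryTheory Filter
open scoped WithZero

set_option linter.unusedSectionVars false

universe u

/-! ## Number fields in which almost all primes split -/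

section

variable {F : Type*} [Field F] [NumberField F]

/-! Let `f` be a map of de Rham realizations that commutes with `F_v` for almost all `v`, and let
`E` be a finite Galois extension of `K` over which both lattices become constant. By Galois descent
`E ⊗_K T_dR(L) = E ⊗ L`, so `f` extends to an `E`-linear map `M : E ⊗ L → E ⊗ L'`. The Frobenius
`φ_v ⊗ 1` is semilinear over the whole ring `K_v ⊗_K E`; therefore `M` commutes with it not only on
the invariants but on everything they span (`localFrob_toLocal_eq`). The vectors `1 ⊗ l` are fixed
by `φ_v ⊗ 1`, hence so are their images under `M`, and every matrix entry `m ∈ E` of `M` satisfies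
`φ_v (1 ⊗ m) = 1 ⊗ m` for almost all `v`.

The arithmetic core is that such an `m` is rational (`mem_range_of_frobOver_eq`). After clearing a
denominator, `m ^ p ≡ m` modulo almost all primes of `E`, with `p` the residue characteristic,
because `φ_v` lifts the `p`-th power map. Now `m` generates almost all residue fields of `F = ℚ(m)`,
so almost all primes of `F` have degree one. That this forces `F = ℚ` is a case of Chebotarev's
theorem, but counting ideals suffices (`not_forall_two_primes`). If `[F : ℚ] > 1`, there are two
distinct primes of norm `p` over almost every `p`. Extending both choices multiplicatively to the
integers congruent to `1` modulo a suitable `N`, and multiplying, gives pairwise distinct ideals of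
norm `k * n` indexed by pairs `(k, n)`. The number of pairs with `k * n ≤ s` is not `O(s)`, whereas
the number of ideals of norm at most `s` is.

So some nonzero multiple `d • M` is the base change of a map `h : L → L'`. It respects the
invariants, and these span, which makes `h` Galois equivariant (`mem_hom_of_mapTensor_eq`). Hence
`f` is the realization of `d⁻¹ ⊗ h`. -/

/-- The product of the `P p`, where `p` runs through the prime factors of `m` with multiplicity. -/
def idealOfNat (P : ℕ → Ideal (𝓞 F)) (m : ℕ) : Ideal (𝓞 F) :=
  ((m.primeFactorsList : Multiset ℕ).map P).prod

theorem absNorm_idealOfNat {P : ℕ → Ideal (𝓞 F)} {m : ℕ} (hm : m ≠ 0)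
    (hP : ∀ p ∈ m.primeFactorsList, Ideal.absNorm (P p) = p) :
    Ideal.absNorm (idealOfNat P m) = m := by
  rw [idealOfNat, map_multiset_prod, Multiset.map_map,
    Multiset.map_congr (g := id) rfl (f := Ideal.absNorm ∘ P) (fun p hp => hP p hp), Multiset.map_id, Multiset.prod_coe,
    Nat.prod_primeFactorsList hm]

theorem normalizedFactors_idealOfNat {P : ℕ → Ideal (𝓞 F)} {m : ℕ}
    (hP : ∀ p ∈ m.primeFactorsList, Prime (P p)) :
    UniqueFactorizationMonoid.normalizedFactors (idealOfNat P m) =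
      (m.primeFactorsList : Multiset ℕ).map P := by
  refine UniqueFactorizationMonoid.normalizedFactors_prod_of_prime fun x hx => ?_
  obtain ⟨p, hp, rfl⟩ := Multiset.mem_map.mp hx
  exact hP p hp

/-- By unique factorization it is enough to read off the multiplicity of `P q` for each `q ∈ T`. The
norm of `P p` or `Q p` recovers `p`, so only `p = q` can contribute; there `P q ≠ Q q` excludes the
second factor, and what remains is the multiplicity of `q` in `m`. -/
theorem eq_of_idealOfNat_mul_eq {P Q : ℕ → Ideal (𝓞 F)} {T : Set ℕ}
    (hP : ∀ p ∈ T, Prime (P p) ∧ Ideal.absNorm (P p) = p)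
    (hQ : ∀ p ∈ T, Prime (Q p) ∧ Ideal.absNorm (Q p) = p)
    (hPQ : ∀ p ∈ T, P p ≠ Q p) {m n m' n' : ℕ} (hm : m ≠ 0) (hm' : m' ≠ 0)
    (hmT : ∀ p ∈ m.primeFactorsList, p ∈ T) (hnT : ∀ p ∈ n.primeFactorsList, p ∈ T)
    (hmT' : ∀ p ∈ m'.primeFactorsList, p ∈ T) (hnT' : ∀ p ∈ n'.primeFactorsList, p ∈ T)
    (h : idealOfNat P m * idealOfNat Q n = idealOfNat P m' * idealOfNat Q n') : m = m' := by
  classical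
  have hne : ∀ (R : ℕ → Ideal (𝓞 F)) (k : ℕ), (∀ p ∈ T, Prime (R p) ∧ Ideal.absNorm (R p) = p) →
      (∀ p ∈ k.primeFactorsList, p ∈ T) → idealOfNat R k ≠ 0 := by
    intro R k hR hk h0
    obtain ⟨p, hp, h1⟩ := Multiset.mem_map.mp (Multiset.prod_eq_zero_iff.mp h0)
    exact (hR p (hk p hp)).1.ne_zero h1
  have h1 := congrArg UniqueFactorizationMonoid.normalizedFactors h
  rw [UniqueFactorizationMonoid.normalizedFactors_mul (hne P m hP hmT) (hne Q n hQ hnT),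
    UniqueFactorizationMonoid.normalizedFactors_mul (hne P m' hP hmT') (hne Q n' hQ hnT'),
    normalizedFactors_idealOfNat fun p hp => (hP p (hmT p hp)).1,
    normalizedFactors_idealOfNat fun p hp => (hQ p (hnT p hp)).1,
    normalizedFactors_idealOfNat fun p hp => (hP p (hmT' p hp)).1,
    normalizedFactors_idealOfNat fun p hp => (hQ p (hnT' p hp)).1] at h1
  have hcP : ∀ k : ℕ, (∀ p ∈ k.primeFactorsList, p ∈ T) → ∀ q ∈ T,
      ((k.primeFactorsList : Multiset ℕ).map P).count (P q) = k.primeFactorsList.count q := by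
    intro k hk q hq
    by_cases hqk : q ∈ k.primeFactorsList
    · rw [← Multiset.coe_count]
      refine Multiset.count_map_eq_count P _ ?_ q hqk
      intro a ha b hb hab
      rw [← (hP a (hk a ha)).2, ← (hP b (hk b hb)).2, hab]
    · rw [List.count_eq_zero_of_not_mem hqk, Multiset.count_eq_zero]
      intro hmem
      obtain ⟨p, hp, h2⟩ := Multiset.mem_map.mp hmem
      have : p = q := by rw [← (hP p (hk p hp)).2, h2, (hP q hq).2]
      exact hqk (this ▸ hp)
  have hcQ : ∀ k : ℕ, (∀ p ∈ k.primeFactorsList, p ∈ T) → ∀ q ∈ T,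
      ((k.primeFactorsList : Multiset ℕ).map Q).count (P q) = 0 := by
    intro k hk q hq
    rw [Multiset.count_eq_zero]
    intro hmem
    obtain ⟨p, hp, h2⟩ := Multiset.mem_map.mp hmem
    have : p = q := by rw [← (hQ p (hk p hp)).2, h2, (hP q hq).2]
    subst this
    exact hPQ p hq h2.symm
  have h3 : m.primeFactorsList.Perm m'.primeFactorsList := by
    rw [List.perm_iff_count]
    intro q
    by_cases hq : q ∈ T
    · have h4 := congrArg (Multiset.count (P q)) h1
      rwa [Multiset.count_add, Multiset.count_add, hcP m hmT q hq, hcP m' hmT' q hq,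
        hcQ n hnT q hq, hcQ n' hnT' q hq, add_zero, add_zero] at h4
    · rw [List.count_eq_zero_of_not_mem fun hmem => hq (hmT q hmem),
        List.count_eq_zero_of_not_mem fun hmem => hq (hmT' q hmem)]
  rw [← Nat.prod_primeFactorsList hm, ← Nat.prod_primeFactorsList hm', h3.prod_eq]

/-- It is impossible that there are two different primes of degree one over almost all `p`, as the
number of ideals of norm at most `s` is `O(s)`. -/
theorem not_forall_two_primes (N : ℕ) (hN : 0 < N) (P Q : ℕ → Ideal (𝓞 F))
    (hP : ∀ p, p.Prime → ¬ p ∣ N → Prime (P p) ∧ Ideal.absNorm (P p) = p)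
    (hQ : ∀ p, p.Prime → ¬ p ∣ N → Prime (Q p) ∧ Ideal.absNorm (Q p) = p)
    (hPQ : ∀ p, p.Prime → ¬ p ∣ N → P p ≠ Q p) : False := by
  -- Only the existence of a finite limit is used, not its value.
  obtain ⟨κ, hlim⟩ : ∃ κ : ℝ, Tendsto (fun s : ℝ =>
      (Nat.card {I : Ideal (𝓞 F) // (Ideal.absNorm I : ℝ) ≤ s} : ℝ) / s) atTop (nhds κ) :=
    ⟨_, NumberField.Ideal.tendsto_norm_le_div_atTop F⟩
  let T : Set ℕ := {p | p.Prime ∧ ¬ p ∣ N}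
  -- The integers `1 + a * N` are prime to `N`, so `P` and `Q` are under control at all their prime
  -- factors, and they have positive density.
  let e : ℕ → ℕ := fun a => 1 + a * N
  have he : ∀ a, e a ≠ 0 := fun a => by simp [e]
  have heT : ∀ a, ∀ p ∈ (e a).primeFactorsList, p ∈ T := by
    intro a p hp
    refine ⟨Nat.prime_of_mem_primeFactorsList hp, fun hd => ?_⟩
    have h1 := Nat.dvd_of_mem_primeFactorsList hp
    have h2 : p ∣ 1 := (Nat.dvd_add_left (dvd_mul_of_dvd_right hd a)).mp h1
    exact (Nat.prime_of_mem_primeFactorsList hp).one_lt.ne' (Nat.dvd_one.mp h2)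
  have hPT : ∀ p ∈ T, Prime (P p) ∧ Ideal.absNorm (P p) = p := fun p hp => hP p hp.1 hp.2
  have hQT : ∀ p ∈ T, Prime (Q p) ∧ Ideal.absNorm (Q p) = p := fun p hp => hQ p hp.1 hp.2
  have hPQT : ∀ p ∈ T, P p ≠ Q p := fun p hp => hPQ p hp.1 hp.2
  let J : ℕ × ℕ → Ideal (𝓞 F) := fun x => idealOfNat P (e x.1) * idealOfNat Q (e x.2)
  have hJn : ∀ x, Ideal.absNorm (J x) = e x.1 * e x.2 := by
    intro x
    rw [map_mul, absNorm_idealOfNat (he _) fun p hp => (hPT p (heT _ p hp)).2,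
      absNorm_idealOfNat (he _) fun p hp => (hQT p (heT _ p hp)).2]
  -- Factorization recovers the first index; the norm `e x.1 * e x.2` then recovers the second.
  have hJ : Function.Injective J := by
    intro x y hxy
    have h1 : e x.1 = e y.1 := eq_of_idealOfNat_mul_eq hPT hQT hPQT (he _) (he _)
      (heT _) (heT _) (heT _) (heT _) hxy
    have h2 : e x.2 = e y.2 := by
      have := congrArg Ideal.absNorm hxy
      rw [hJn, hJn, h1] at this
      exact Nat.eq_of_mul_eq_mul_left (Nat.pos_of_ne_zero (he _)) this
    have hinj : Function.Injective e := by
      intro a b hab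
      exact Nat.eq_of_mul_eq_mul_right hN (Nat.add_left_cancel hab)
    exact Prod.ext (hinj h1) (hinj h2)
  -- For fixed `a`, every `b` with `b + 1 ≤ s / (N * e a)` gives an ideal of norm at most `s`,
  -- because `e b ≤ (b + 1) * N`. There are `⌊s / (N * e a)⌋₊` of these, which is where the `- 1`
  -- comes from.
  have hcount : ∀ (A : ℕ) (s : ℝ), 0 ≤ s → ∑ a ∈ Finset.range A, (s / (N * e a) - 1) ≤
      (Nat.card {I : Ideal (𝓞 F) // (Ideal.absNorm I : ℝ) ≤ s} : ℝ) := by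
    intro A s hs
    let B : Finset (ℕ × ℕ) := ((Finset.range A).sigma fun a =>
      Finset.range ⌊s / (N * e a)⌋₊).map (Equiv.sigmaEquivProd ℕ ℕ).toEmbedding
    have hB : ∀ x ∈ B, (Ideal.absNorm (J x) : ℝ) ≤ s := by
      intro x hx
      obtain ⟨⟨a, b⟩, hab, rfl⟩ := Finset.mem_map.mp hx
      rw [Finset.mem_sigma, Finset.mem_range, Finset.mem_range] at hab
      change (Ideal.absNorm (J (a, b)) : ℝ) ≤ s
      rw [hJn]
      have h1 : ((b + 1 : ℕ) : ℝ) ≤ s / (N * e a) := (Nat.le_floor_iff' (by omega)).mp hab.2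
      have hpos : (0 : ℝ) < N * e a := by
        exact_mod_cast Nat.mul_pos hN (Nat.pos_of_ne_zero (he a))
      rw [le_div_iff₀ hpos] at h1
      refine le_trans ?_ h1
      have h2 : e a * e b ≤ (b + 1) * (N * e a) := by
        have : e b ≤ (b + 1) * N := by simp only [e]; nlinarith
        calc e a * e b ≤ e a * ((b + 1) * N) := Nat.mul_le_mul_left _ this
          _ = _ := by ring
      exact_mod_cast h2
    have hfin : Finite {I : Ideal (𝓞 F) // (Ideal.absNorm I : ℝ) ≤ s} := by
      have := Ideal.finite_setOfPred_absNorm_le (S := 𝓞 F) ⌊s⌋₊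
      refine (this.subset fun I hI => ?_).to_subtype
      exact Nat.le_floor hI
    have hle : B.card ≤ Nat.card {I : Ideal (𝓞 F) // (Ideal.absNorm I : ℝ) ≤ s} := by
      rw [← Nat.card_eq_fintype_card.trans (Fintype.card_coe B)]
      exact Nat.card_le_card_of_injective
        (fun x : B => (⟨J x, hB x x.2⟩ : {I : Ideal (𝓞 F) // (Ideal.absNorm I : ℝ) ≤ s}))
        fun x y hxy => Subtype.ext (hJ (congrArg Subtype.val hxy))
    refine le_trans ?_ (Nat.cast_le.mpr hle)
    rw [Finset.card_map, Finset.card_sigma, Nat.cast_sum]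
    refine Finset.sum_le_sum fun a _ => ?_
    rw [Finset.card_range]
    exact (Nat.sub_one_lt_floor _).le
  -- For fixed `A` the total rounding error in `hcount` is `A`; it disappears on dividing by `s` and
  -- letting `s → ∞`.
  have hbound : ∀ A : ℕ, ∑ a ∈ Finset.range A, (1 / ((N : ℝ) * e a)) ≤ κ := by
    intro A
    have h1 : Tendsto (fun s : ℝ => ∑ a ∈ Finset.range A, (1 / ((N : ℝ) * e a)) - A / s) atTop
        (nhds (∑ a ∈ Finset.range A, (1 / ((N : ℝ) * e a)) - 0)) :=
      tendsto_const_nhds.sub (tendsto_const_nhds.div_atTop tendsto_id)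
    rw [sub_zero] at h1
    refine le_of_tendsto_of_tendsto h1 hlim ?_
    filter_upwards [eventually_gt_atTop 0] with s hs
    rw [le_div_iff₀ hs]
    refine le_trans (le_of_eq ?_) (hcount A s hs.le)
    rw [Finset.sum_sub_distrib, sub_mul, div_mul_cancel₀ _ hs.ne', Finset.sum_mul]
    congr 1
    · exact Finset.sum_congr rfl fun a _ => by ring
    · simp
  -- Since `e a ≤ N * (a + 1)`, the sums in `hbound` dominate `N⁻²` times the harmonic sums. Their
  -- divergence would make the constant `N ^ 2 * κ` tend to infinity.
  have hharm := (tendsto_atTop_mono (fun A => ?_) Real.tendsto_sum_range_one_div_nat_succ_atTop :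
    Tendsto (fun A : ℕ => (N : ℝ) ^ 2 * κ) atTop atTop)
  · exact not_tendsto_const_atTop _ _ hharm
  · refine le_trans ?_ (mul_le_mul_of_nonneg_left (hbound A) (by positivity))
    rw [Finset.mul_sum]
    refine Finset.sum_le_sum fun a _ => ?_
    have hN' : (1 : ℝ) ≤ N := by exact_mod_cast hN
    have h2 : (N : ℝ) ^ 2 * (1 / (N * e a)) = N / e a := by
      field_simp
    rw [h2, div_le_div_iff₀ (by positivity) (by exact_mod_cast Nat.pos_of_ne_zero (he a))]
    simp only [e]
    push_cast
    nlinarith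

end

/-! ### Primes of degree one, and integers whose residues lie in the prime fields -/

section

variable {F : Type*} [Field F] [NumberField F]

theorem residueChar_eq_of_mem {v : HeightOneSpectrum (𝓞 F)} {p : ℕ} (hp : p.Prime)
    (h : (p : 𝓞 F) ∈ v.asIdeal) : residueChar v = p := by
  rw [← Ideal.Quotient.eq_zero_iff_mem, map_natCast, CharP.cast_eq_zero_iff _ (residueChar v)] at h
  exact ((Nat.dvd_prime hp).mp h).resolve_left (Fact.out : (residueChar v).Prime).ne_one

theorem finite_setOf_mem {x : 𝓞 F} (hx : x ≠ 0) :
    {v : HeightOneSpectrum (𝓞 F) | x ∈ v.asIdeal}.Finite := by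
  refine (Ideal.finite_factors (I := Ideal.span {x}) ?_).subset fun v hv => ?_
  · simpa using hx
  · exact Ideal.dvd_span_singleton.mpr hv

/-- Every element of `F` is a polynomial in `b` with rational coefficients, so some positive integer
moves it into `ℤ[b]`. As `𝓞 F` is finitely generated, the product of the integers that belong to an
integral basis works for all of it. -/
theorem exists_nat_mul_mem_closure {b : 𝓞 F} (hb : Algebra.adjoin ℚ {(b : F)} = ⊤) :
    ∃ D : ℕ, D ≠ 0 ∧ ∀ x : 𝓞 F, D * x ∈ Subring.closure {b} := by
  have h1 : ∀ x : F, ∃ d : ℕ, d ≠ 0 ∧ ∃ y ∈ Subring.closure {b}, d * x = (y : F) := by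
    intro x
    have hx : x ∈ Algebra.adjoin ℚ {(b : F)} := hb ▸ Algebra.mem_top
    induction hx using Algebra.adjoin_induction with
    | mem x hx =>
      exact ⟨1, one_ne_zero, b, Subring.subset_closure rfl, by rw [hx]; simp⟩
    | algebraMap r =>
      refine ⟨r.den, r.den_nz, (r.num : 𝓞 F), intCast_mem _ _, ?_⟩
      have h := congrArg (algebraMap ℚ F) (Rat.den_mul_eq_num r)
      rw [map_mul, map_natCast, map_intCast] at h
      simpa only [map_intCast] using h
    | add x y _ _ hx hy =>
      obtain ⟨d, hd, z, hz, h1⟩ := hx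
      obtain ⟨d', hd', z', hz', h2⟩ := hy
      refine ⟨d * d', mul_ne_zero hd hd', d' * z + d * z',
        add_mem (mul_mem (natCast_mem _ _) hz) (mul_mem (natCast_mem _ _) hz'), ?_⟩
      simp only [map_add, map_mul, map_natCast, ← h1, ← h2]
      push_cast; ring
    | mul x y _ _ hx hy =>
      obtain ⟨d, hd, z, hz, h1⟩ := hx
      obtain ⟨d', hd', z', hz', h2⟩ := hy
      refine ⟨d * d', mul_ne_zero hd hd', z * z', mul_mem hz hz', ?_⟩
      simp only [map_mul, ← h1, ← h2]
      push_cast; ring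
  have h2 : ∀ x : 𝓞 F, ∃ d : ℕ, d ≠ 0 ∧ d * x ∈ Subring.closure {b} := by
    intro x
    obtain ⟨d, hd, y, hy, h⟩ := h1 x
    refine ⟨d, hd, ?_⟩
    have : (d : 𝓞 F) * x = y := RingOfIntegers.ext (by simpa using h)
    rwa [this]
  let ω := RingOfIntegers.basis F
  choose d hd hdω using fun i => h2 (ω i)
  refine ⟨∏ i, d i, Finset.prod_ne_zero_iff.mpr fun i _ => hd i, fun x => ?_⟩
  rw [← ω.sum_repr x, Finset.mul_sum]
  refine sum_mem fun i _ => ?_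
  obtain ⟨k, hk⟩ := Finset.dvd_prod_of_mem d (Finset.mem_univ i)
  rw [hk, mul_smul_comm]
  refine zsmul_mem ?_ _
  rw [Nat.cast_mul, mul_comm (d i : 𝓞 F), mul_assoc]
  exact mul_mem (natCast_mem _ _) (hdω i)

/-- If `b` modulo `v` lies in the prime field and generates the residue field, then `v` has
degree one. -/
theorem absNorm_eq_residueChar {v : HeightOneSpectrum (𝓞 F)} {b : 𝓞 F} {D : ℕ}
    (hD : ∀ x : 𝓞 F, D * x ∈ Subring.closure {b}) (hDv : (D : 𝓞 F) ∉ v.asIdeal)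
    (hb : b ^ residueChar v - b ∈ v.asIdeal) : Ideal.absNorm v.asIdeal = residueChar v := by
  have := v.isPrime
  have := v.isMaximal
  let p := residueChar v
  have hp : p.Prime := Fact.out
  let := Ideal.Quotient.field v.asIdeal
  let := Fintype.ofFinite (𝓞 F ⧸ v.asIdeal)
  have hchar : CharP (𝓞 F ⧸ v.asIdeal) p := ringChar.charP _
  have : Fact p.Prime := ⟨hp⟩
  -- The elements with Frobenius-fixed residue form a subring. It contains `b`, hence `ℤ[b]`.
  let A : Subring (𝓞 F) := ((frobenius (𝓞 F ⧸ v.asIdeal) p).eqLocus (RingHom.id _)).comap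
    (Ideal.Quotient.mk v.asIdeal)
  have hmem : ∀ x, x ∈ A ↔ Ideal.Quotient.mk v.asIdeal x ^ p = Ideal.Quotient.mk v.asIdeal x :=
    fun x => Iff.rfl
  have hbA : b ∈ A := by
    rw [hmem, ← map_pow]
    exact Ideal.Quotient.eq.mpr hb
  have hA : Subring.closure {b} ≤ A := Subring.closure_le.mpr (by simpa using hbA)
  -- Both `D * x` and `D` have fixed residues, and `D` is invertible modulo `v`, so the residue of
  -- `x` is fixed too.
  have hall : ∀ y : 𝓞 F ⧸ v.asIdeal, y ^ p = y := by
    intro y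
    obtain ⟨x, rfl⟩ := Ideal.Quotient.mk_surjective y
    have h1 := (hmem _).mp (hA (hD x))
    have h2 := (hmem D).mp (natCast_mem A D)
    rw [map_mul, mul_pow, h2] at h1
    exact mul_left_cancel₀ (fun h => hDv (Ideal.Quotient.eq_zero_iff_mem.mp h)) h1
  -- All elements of the residue field are roots of `X ^ p - X`.
  have hcard : Fintype.card (𝓞 F ⧸ v.asIdeal) ≤ p := by
    classical
    have hne : (Polynomial.X ^ p - Polynomial.X : Polynomial (𝓞 F ⧸ v.asIdeal)) ≠ 0 :=
      FiniteField.X_pow_card_sub_X_ne_zero _ hp.one_lt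
    rw [← FiniteField.X_pow_card_sub_X_natDegree_eq (𝓞 F ⧸ v.asIdeal) hp.one_lt]
    refine le_trans (Finset.card_le_card (t := (Polynomial.X ^ p - Polynomial.X :
      Polynomial (𝓞 F ⧸ v.asIdeal)).roots.toFinset) fun y _ => ?_)
      ((Multiset.toFinset_card_le _).trans (Polynomial.card_roots' _))
    rw [Multiset.mem_toFinset, Polynomial.mem_roots hne]
    simp [hall y]
  have hnorm : Ideal.absNorm v.asIdeal = Fintype.card (𝓞 F ⧸ v.asIdeal) := by
    rw [Ideal.absNorm_apply, ← Nat.card_eq_fintype_card]; rfl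
  rw [hnorm]
  refine le_antisymm hcard ?_
  obtain ⟨n, _, hn⟩ := FiniteField.card (𝓞 F ⧸ v.asIdeal) p
  rw [hn]
  exact Nat.le_self_pow n.ne_zero p

/-- If `v` were the only prime over `p`, then `(p) = v ^ k`. Being unramified gives `k ≤ 1`, while
comparing norms gives `p ^ k = p ^ [F : ℚ]`, which contradicts `[F : ℚ] > 1`. -/
theorem exists_ne_of_isUnramified (hn : 1 < Module.finrank ℚ F) {p : ℕ} (hp : p.Prime)
    (hu : ∀ v : HeightOneSpectrum (𝓞 F), (p : 𝓞 F) ∈ v.asIdeal →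
      IsUnramified v ∧ Ideal.absNorm v.asIdeal = p) :
    ∃ v w : HeightOneSpectrum (𝓞 F), (p : 𝓞 F) ∈ v.asIdeal ∧ (p : 𝓞 F) ∈ w.asIdeal ∧
      v.asIdeal ≠ w.asIdeal := by
  have hp0 : Ideal.span {(p : 𝓞 F)} ≠ ⊥ := by
    simpa using hp.ne_zero
  have hnorm : Ideal.absNorm (Ideal.span {(p : 𝓞 F)}) = p ^ Module.finrank ℚ F := by
    rw [Ideal.absNorm_span_natCast, RingOfIntegers.rank]
  have hprod := Ideal.prod_normalizedFactors_eq_self hp0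
  set s := UniqueFactorizationMonoid.normalizedFactors (Ideal.span {(p : 𝓞 F)}) with hs
  have hplace : ∀ P ∈ s, ∃ v : HeightOneSpectrum (𝓞 F), v.asIdeal = P ∧ (p : 𝓞 F) ∈ v.asIdeal := by
    intro P hP
    have h1 := UniqueFactorizationMonoid.prime_of_normalized_factor P hP
    exact ⟨⟨P, Ideal.isPrime_of_prime h1, h1.ne_zero⟩, rfl,
      Ideal.dvd_span_singleton.mp (UniqueFactorizationMonoid.dvd_of_mem_normalizedFactors hP)⟩
  by_contra! hcon
  -- There is at least one prime over `p`, since the norm of `(p)` is not `1`.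
  have hs0 : s ≠ 0 := by
    intro h0
    rw [h0, Multiset.prod_zero] at hprod
    rw [← hprod, map_one] at hnorm
    exact (Nat.one_lt_pow (by omega) hp.one_lt).ne hnorm
  obtain ⟨P, hP⟩ := Multiset.exists_mem_of_ne_zero hs0
  obtain ⟨v, rfl, hv⟩ := hplace P hP
  have hrep : s = Multiset.replicate s.card v.asIdeal := by
    refine Multiset.eq_replicate.mpr ⟨rfl, fun Q hQ => ?_⟩
    obtain ⟨w, rfl, hw⟩ := hplace Q hQ
    exact hcon w v hw hv
  rw [hrep, Multiset.prod_replicate] at hprod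
  have hcard : s.card < 2 := by
    by_contra! h2
    have := v.isPrime
    have hpr : (Ideal.span {(p : ℤ)}).IsPrime :=
      (Ideal.span_singleton_prime (by exact_mod_cast hp.ne_zero)).mpr (Nat.prime_iff_prime_int.mp hp)
    have : v.asIdeal.LiesOver (Ideal.span {(p : ℤ)}) :=
      residueChar_eq_of_mem hp hv ▸ liesOver_residueChar v
    refine not_le_sq v.asIdeal v.ne_bot (Ideal.span {(p : ℤ)}) (hu v hv).1 ?_
    rw [Ideal.map_span, Set.image_singleton]
    simp only [eq_intCast, Int.cast_natCast]
    rw [← hprod]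
    exact Ideal.pow_le_pow_right h2
  rw [← hprod, map_pow, (hu v hv).2] at hnorm
  have := Nat.pow_right_injective hp.two_le hnorm
  omega

/-- Away from the divisors of the index `D`, the residue of `b` generates the residue field, so the
congruence makes almost all primes unramified of degree one. In degree greater than one this would
provide the two families of primes excluded by `not_forall_two_primes`. -/
theorem finrank_le_one_of_pow_sub_mem {b : 𝓞 F} (hb : Algebra.adjoin ℚ {(b : F)} = ⊤)
    (h : ∀ᶠ v : HeightOneSpectrum (𝓞 F) in cofinite, b ^ residueChar v - b ∈ v.asIdeal) :
    Module.finrank ℚ F ≤ 1 := by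
  by_contra! hn
  obtain ⟨D, hD0, hD⟩ := exists_nat_mul_mem_closure hb
  have hgood : ∀ᶠ v : HeightOneSpectrum (𝓞 F) in cofinite, IsUnramified v ∧
      Ideal.absNorm v.asIdeal = residueChar v := by
    filter_upwards [h, eventually_cofinite.mpr finite_not_isUnramified,
      (finite_setOf_mem (F := F) (x := D) (by exact_mod_cast hD0)).eventually_cofinite_notMem]
      with v h1 h2 h3
    exact ⟨h2, absNorm_eq_residueChar hD h3 h1⟩
  rw [eventually_cofinite] at hgood
  -- With the residue characteristics of all exceptional places in `N`, every place over a prime `p`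
  -- not dividing `N` is good.
  let N : ℕ := ∏ v ∈ hgood.toFinset, residueChar v
  have hN : 0 < N := Finset.prod_pos fun v _ => (Fact.out : (residueChar v).Prime).pos
  have hgood' : ∀ p : ℕ, p.Prime → ¬ p ∣ N → ∀ v : HeightOneSpectrum (𝓞 F),
      (p : 𝓞 F) ∈ v.asIdeal → IsUnramified v ∧ Ideal.absNorm v.asIdeal = p := by
    intro p hp hpN v hv
    by_contra hbad
    rw [← residueChar_eq_of_mem hp hv] at hbad hpN
    exact hpN (Finset.dvd_prod_of_mem _ (hgood.mem_toFinset.mpr hbad))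
  have hex : ∀ p : ℕ, ∃ P Q : Ideal (𝓞 F), p.Prime → ¬ p ∣ N →
      (Prime P ∧ Ideal.absNorm P = p) ∧ (Prime Q ∧ Ideal.absNorm Q = p) ∧ P ≠ Q := by
    intro p
    by_cases hp : p.Prime ∧ ¬ p ∣ N
    · obtain ⟨v, w, hv, hw, hvw⟩ := exists_ne_of_isUnramified hn hp.1 (hgood' p hp.1 hp.2)
      exact ⟨v.asIdeal, w.asIdeal, fun _ _ => ⟨⟨v.prime, (hgood' p hp.1 hp.2 v hv).2⟩,
        ⟨w.prime, (hgood' p hp.1 hp.2 w hw).2⟩, hvw⟩⟩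
    -- At the divisors of `N` and at composite numbers the values are irrelevant.
    · exact ⟨⊥, ⊥, fun h1 h2 => absurd ⟨h1, h2⟩ hp⟩
  choose P Q hPQ using hex
  exact not_forall_two_primes N hN P Q (fun p h1 h2 => (hPQ p h1 h2).1)
    (fun p h1 h2 => (hPQ p h1 h2).2.1) (fun p h1 h2 => (hPQ p h1 h2).2.2)

/-- An algebraic integer which is congruent to an element of the prime field modulo almost all
primes is rational. -/
theorem mem_range_of_pow_sub_mem {E : Type*} [Field E] [NumberField E] {a : 𝓞 E}
    (h : ∀ᶠ v : HeightOneSpectrum (𝓞 E) in cofinite, a ^ residueChar v - a ∈ v.asIdeal) :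
    (a : E) ∈ Set.range (algebraMap ℚ E) := by
  -- The subfield generated by `a` replaces `E`, because `finrank_le_one_of_pow_sub_mem` needs a
  -- generator.
  let F := IntermediateField.adjoin ℚ {(a : E)}
  let g : F := IntermediateField.AdjoinSimple.gen ℚ (a : E)
  have hg : IsIntegral ℤ g := by
    rw [← isIntegral_algebraMap_iff (algebraMap F E).injective]
    exact a.isIntegral_coe
  let b : 𝓞 F := ⟨g, hg⟩
  have hba : algebraMap (𝓞 F) (𝓞 E) b = a := RingOfIntegers.ext rfl
  -- One place of `E` is chosen above each place of `F`. This choice is injective, so a condition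
  -- that holds at almost all places of `E` holds at the chosen ones for almost all `w`.
  have hover : ∀ w : HeightOneSpectrum (𝓞 F), ∃ v : HeightOneSpectrum (𝓞 E),
      v.asIdeal.under (𝓞 F) = w.asIdeal := by
    intro w
    have := w.isPrime
    have := w.isMaximal
    obtain ⟨V, hV, hVw⟩ := Ideal.exists_maximal_ideal_liesOver_of_isIntegral (S := 𝓞 E) w.asIdeal
    exact ⟨⟨V, hV.isPrime, Ideal.ne_bot_of_liesOver_of_ne_bot w.ne_bot V⟩, hVw.over.symm⟩
  choose up hup using hover
  have hinj : Function.Injective up := fun w w' hw =>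
    HeightOneSpectrum.ext (by rw [← hup w, ← hup w', hw])
  have hF : Module.finrank ℚ F ≤ 1 := by
    refine finrank_le_one_of_pow_sub_mem (b := b) ?_ ?_
    · change Algebra.adjoin ℚ {g} = ⊤
      have hint : IsIntegral ℚ (a : E) := Algebra.IsIntegral.isIntegral _
      have h1 := (IntermediateField.adjoin.powerBasis hint).adjoin_gen_eq_top
      rwa [IntermediateField.adjoin.powerBasis_gen] at h1
    · filter_upwards [hinj.tendsto_cofinite.eventually h] with w hw
      have hmem : ∀ x : 𝓞 F, x ∈ w.asIdeal ↔ algebraMap (𝓞 F) (𝓞 E) x ∈ (up w).asIdeal := by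
        intro x
        rw [← hup w]; rfl
      have hp : residueChar (up w) = residueChar w := by
        refine residueChar_eq_of_mem Fact.out ?_
        simpa using (hmem _).mp (residueChar_mem w)
      rw [hmem, map_sub, map_pow, hba, ← hp]
      exact hw
  have h1 : Module.finrank ℚ F = 1 := le_antisymm hF Module.finrank_pos
  have h2 : F = ⊥ := IntermediateField.finrank_eq_one_iff.mp h1
  have h3 : (a : E) ∈ F := IntermediateField.mem_adjoin_simple_self ℚ _
  rw [h2] at h3
  exact IntermediateField.mem_bot.mp h3

end

/-! ## Elements fixed by the Frobenius lifts -/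

section

variable {K : Type*} [Field K] [NumberField K]
variable {E : Type*} [Field E] [NumberField E] [Algebra K E]

variable (K E) in
/-- Outside the divisors of some `D`, the ring `K_v ⊗_K E` does not make integers of `E` divisible
by `p_v` unless they already lie in `v 𝒪_E`. -/
theorem exists_mul_mem_map : ∃ D : 𝓞 K, D ≠ 0 ∧ ∀ v : HeightOneSpectrum (𝓞 K), ∀ x : 𝓞 E,
    ∀ c ∈ integersOver v E, (1 : v.adicCompletion K) ⊗ₜ[K] (x : E) = (residueChar v : ℕ) * c →
      algebraMap (𝓞 K) (𝓞 E) D * x ∈ v.asIdeal.map (algebraMap (𝓞 K) (𝓞 E)) := by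
  -- A `K`-basis of `E` consisting of integral elements. It need not generate `𝓞 E` over `𝓞 K`; the
  -- integer `D` below bounds the denominators.
  obtain ⟨ι, b, hb⟩ := FiniteDimensional.exists_is_basis_integral (𝓞 K) K E
  have hb' : ∀ j, ∃ β : 𝓞 E, (β : E) = b j := fun j =>
    ⟨⟨b j, isIntegral_trans (R := ℤ) (A := 𝓞 K) _ (hb j)⟩, rfl⟩
  choose β hβ using hb'
  obtain ⟨s, hs⟩ := (Module.Finite.fg_top : (⊤ : Submodule (𝓞 K) (𝓞 E)).FG)
  -- A common denominator for the coordinates of finitely many generators of `𝓞 E`. It is fixed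
  -- before any place `v` is considered.
  obtain ⟨D, hD⟩ := IsLocalization.exist_integer_multiples_of_finite (nonZeroDivisors (𝓞 K))
    (S := K) (fun y : s × ι => b.repr ((y.1 : 𝓞 E) : E) y.2)
  have hD' : ∀ (x : 𝓞 E) (j : ι), ∃ r : 𝓞 K, (r : K) = (D.1 : K) * b.repr (x : E) j := by
    intro x j
    have hx : x ∈ Submodule.span (𝓞 K) (s : Set (𝓞 E)) := hs ▸ Submodule.mem_top
    induction hx using Submodule.span_induction with
    | mem x hx =>
      obtain ⟨r, hr⟩ := hD (⟨x, hx⟩, j)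
      exact ⟨r, by rw [RingOfIntegers.coe_eq_algebraMap, hr, Algebra.smul_def]⟩
    | zero => exact ⟨0, by simp⟩
    | add x y _ _ hx hy =>
      obtain ⟨r, hr⟩ := hx
      obtain ⟨r', hr'⟩ := hy
      exact ⟨r + r', by simp only [map_add, Finsupp.add_apply, hr, hr']; ring⟩
    | smul a x _ hx =>
      obtain ⟨r, hr⟩ := hx
      refine ⟨a * r, ?_⟩
      have : ((a • x : 𝓞 E) : E) = (a : K) • (x : E) := by
        rw [Algebra.smul_def, Algebra.smul_def, RingOfIntegers.coe_eq_algebraMap, map_mul]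
        rfl
      rw [this, map_smul, Finsupp.smul_apply, RingOfIntegers.coe_eq_algebraMap, map_mul,
        ← RingOfIntegers.coe_eq_algebraMap, ← RingOfIntegers.coe_eq_algebraMap, hr, smul_eq_mul]
      ring
  refine ⟨D, nonZeroDivisors.coe_ne_zero D, fun v x c hc hx => ?_⟩
  let bv := Algebra.TensorProduct.basis (v.adicCompletion K) b
  have hbv : ∀ (y : E) (j : ι), bv.repr ((1 : v.adicCompletion K) ⊗ₜ[K] y) j =
      algebraMap K (v.adicCompletion K) (b.repr y j) := by
    intro y j
    simp [bv, Algebra.TensorProduct.basis_repr_tmul]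
  let δ : v.adicCompletion K := algebraMap K (v.adicCompletion K) (D.1 : K)
  have hint : ∀ r : 𝓞 K, algebraMap K (v.adicCompletion K) (r : K) ∈ v.adicCompletionIntegers K :=
    fun r => (algebraMap (𝓞 K) (v.adicCompletionIntegers K) r).2
  -- The same denominator works after completion, since `integersOver v E` is spanned over the
  -- integers of `K_v` by the image of `𝓞 E`.
  have hc' : ∀ j, δ * bv.repr c j ∈ v.adicCompletionIntegers K := by
    intro j
    rw [← Subalgebra.mem_toSubmodule, integersOver_eq_span] at hc
    clear hx
    induction hc using Submodule.span_induction with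
    | mem y hy =>
      obtain ⟨a, rfl⟩ := hy
      obtain ⟨r, hr⟩ := hD' a j
      rw [hbv, ← map_mul, ← hr]
      exact hint r
    | zero => simp
    | add y z _ _ hy hz =>
      rw [map_add, Finsupp.add_apply, mul_add]
      exact add_mem hy hz
    | smul a y _ hy =>
      have : a • y = (a : v.adicCompletion K) • y := by
        rw [Algebra.smul_def, Algebra.smul_def]; rfl
      rw [this, map_smul, Finsupp.smul_apply, smul_eq_mul, mul_left_comm]
      exact mul_mem a.2 hy
  choose r hr using hD' x
  -- In `K_v`, the element `r j` is `p_v` times the integral element `δ * bv.repr c j`, so its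
  -- valuation is less than `1`.
  have hrv : ∀ j, r j ∈ v.asIdeal := by
    intro j
    have h1 : algebraMap K (v.adicCompletion K) (r j : K) =
        (residueChar v : ℕ) * (δ * bv.repr c j) := by
      rw [hr, map_mul, ← hbv, hx, ← nsmul_eq_mul, map_nsmul, Finsupp.smul_apply, nsmul_eq_mul]
      ring
    have hval : ∀ t : 𝓞 K, Valued.v (algebraMap K (v.adicCompletion K) (t : K)) < 1 ↔
        t ∈ v.asIdeal := by
      intro t
      rw [← v.intValuation_lt_one_iff_mem, ← v.valuation_of_algebraMap (K := K),
        ← HeightOneSpectrum.valuedAdicCompletion_eq_valuation']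
      rfl
    rw [← hval, h1, map_mul]
    have h2 := (hval (residueChar v)).mpr (residueChar_mem v)
    rw [RingOfIntegers.coe_eq_algebraMap, map_natCast, map_natCast] at h2
    exact mul_lt_one_of_lt_of_le h2 (hc' j)
  -- The expansion of `D * x` in the integral basis has its coefficients in `v`.
  have hsum : algebraMap (𝓞 K) (𝓞 E) D * x = ∑ j, algebraMap (𝓞 K) (𝓞 E) (r j) * β j := by
    apply RingOfIntegers.ext
    simp only [map_mul, map_sum, hβ]
    have h1 : ∀ t : 𝓞 K, ((algebraMap (𝓞 K) (𝓞 E) t : 𝓞 E) : E) = algebraMap K E (t : K) :=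
      fun t => rfl
    simp only [h1, hr]
    rw [← RingOfIntegers.coe_eq_algebraMap]
    conv_lhs => rw [← b.sum_repr (x : E), Finset.mul_sum]
    exact Finset.sum_congr rfl fun j _ => by rw [map_mul, Algebra.smul_def, mul_assoc]
  rw [hsum]
  exact sum_mem fun j _ => Ideal.mul_mem_right _ _ (Ideal.mem_map_of_mem _ (hrv j))

/-- The fibres are finite: all primes of `E` over `v` contain the residue characteristic of `v`. -/
theorem tendsto_under_cofinite :
    Tendsto (fun w : HeightOneSpectrum (𝓞 E) => w.under (𝓞 K)) cofinite cofinite := by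
  refine Tendsto.cofinite_of_finite_preimage_singleton fun v => ?_
  have hne : ((residueChar v : ℕ) : 𝓞 E) ≠ 0 := by
    exact_mod_cast (Fact.out : (residueChar v).Prime).ne_zero
  refine ((finite_setOf_mem hne).subset fun w hw => ?_).to_subtype
  have h1 := residueChar_mem v
  rw [← (show w.under (𝓞 K) = v from hw)] at h1
  have h2 : algebraMap (𝓞 K) (𝓞 E) (residueChar (w.under (𝓞 K)) : ℕ) ∈ w.asIdeal := h1
  rw [map_natCast, show w.under (𝓞 K) = v from hw] at h2
  exact h2

/-- The Frobenius lift is the `p`-th power modulo `p`, so a fixed element `1 ⊗ a` has `a ^ p - a`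
divisible by `p` in `integersOver v E`. By `exists_mul_mem_map` this gives a divisibility in `𝓞 E`
up to the factor `D`, which is harmless at the primes `w` whose restriction does not contain `D`. -/
theorem eventually_pow_sub_mem {a : 𝓞 E} (h : ∀ᶠ v : HeightOneSpectrum (𝓞 K) in cofinite,
      frobOver v E ((1 : v.adicCompletion K) ⊗ₜ[K] (a : E)) = 1 ⊗ₜ (a : E)) :
    ∀ᶠ w : HeightOneSpectrum (𝓞 E) in cofinite, a ^ residueChar w - a ∈ w.asIdeal := by
  obtain ⟨D, hD0, hD⟩ := exists_mul_mem_map K E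
  have h1 := (((h.and (eventually_cofinite.mpr finite_not_isUnramified)).and
    (eventually_cofinite.mpr (finite_not_isUnramifiedIn K E))).and
    (finite_setOf_mem hD0).eventually_cofinite_notMem)
  filter_upwards [tendsto_under_cofinite.eventually h1] with w hw
  obtain ⟨⟨⟨hfix, hv⟩, hE⟩, hDw⟩ := hw
  set v := w.under (𝓞 K)
  have hmem : ∀ t : 𝓞 K, t ∈ v.asIdeal ↔ algebraMap (𝓞 K) (𝓞 E) t ∈ w.asIdeal := fun t => Iff.rfl
  have hp : residueChar w = residueChar v := by
    refine residueChar_eq_of_mem Fact.out ?_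
    simpa using (hmem _).mp (residueChar_mem v)
  have hstrict := (isStrict_integersOver hv hE).1
  obtain ⟨_, c, hc, h2⟩ := hstrict.isFrobeniusLift ((1 : v.adicCompletion K) ⊗ₜ[K] (a : E))
    (Algebra.subset_adjoin ⟨a, rfl⟩)
  change frobOver v E _ = _ at h2
  rw [hfix, Algebra.TensorProduct.tmul_pow, one_pow] at h2
  have h3 : (1 : v.adicCompletion K) ⊗ₜ[K] ((a ^ residueChar v - a : 𝓞 E) : E) =
      (residueChar v : ℕ) * (-c) := by
    rw [RingOfIntegers.coe_eq_algebraMap, map_sub, map_pow, tmul_sub]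
    linear_combination -h2
  have h4 := hD v _ (-c) (neg_mem hc) h3
  have h5 : v.asIdeal.map (algebraMap (𝓞 K) (𝓞 E)) ≤ w.asIdeal := Ideal.map_comap_le
  rw [hp]
  exact (w.isPrime.mem_or_mem (h5 h4)).resolve_left hDw

/-- An element of `E` which is fixed by the Frobenius lift of `K_v ⊗_K E` for almost all `v` is
rational. -/
theorem mem_range_of_frobOver_eq {m : E} (h : ∀ᶠ v : HeightOneSpectrum (𝓞 K) in cofinite,
      frobOver v E ((1 : v.adicCompletion K) ⊗ₜ[K] m) = 1 ⊗ₜ m) :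
    m ∈ Set.range (algebraMap ℚ E) := by
  have halg : IsAlgebraic ℤ m :=
    (IsFractionRing.isAlgebraic_iff ℤ ℚ E).mpr (Algebra.IsAlgebraic.isAlgebraic m)
  -- A multiple `d • m` is integral, and it is again fixed because Frobenius lifts are additive.
  obtain ⟨d, hd, hint⟩ := halg.exists_integral_multiple
  let a : 𝓞 E := ⟨d • m, hint⟩
  obtain ⟨q, hq⟩ := mem_range_of_pow_sub_mem (eventually_pow_sub_mem (K := K) (a := a) (by
    filter_upwards [h] with v hv
    change frobOver v E ((1 : v.adicCompletion K) ⊗ₜ[K] (d • m)) = 1 ⊗ₜ (d • m)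
    rw [tmul_smul, map_zsmul, hv]))
  refine ⟨q / d, ?_⟩
  have hd' : (d : E) ≠ 0 := by exact_mod_cast hd
  rw [map_div₀, hq, map_intCast, div_eq_iff hd']
  change d • m = _
  rw [zsmul_eq_mul, mul_comm]

end

/-! ## Galois descent -/

section

variable {K E : Type*} [Field K] [Field E] [Algebra K E] [FiniteDimensional K E] [IsGalois K E]

open Classical in
variable (K E) in
-- Take a basis `a` and its dual basis `c` for the trace form. Duality says that the square matrices
-- `(g (a i))` and `(g (c i))` are inverse to each other; multiplying them in the other order gives
-- the orthogonality relation. Multiplication by `e` is self-adjoint for the trace form, so its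
-- matrices in the two bases are transposes of each other.
theorem exists_dual_bases : ∃ (n : ℕ) (a c : Fin n → E),
    (∀ g : E ≃ₐ[K] E, ∑ i, c i * g (a i) = if g = 1 then 1 else 0) ∧
    ∀ e : E, ∃ t : Fin n → Fin n → K, (∀ i, a i * e = ∑ j, t i j • a j) ∧
      ∀ j, c j * e = ∑ i, t i j • c i := by
  let a := Module.finBasis K E
  let c := a.traceDual
  refine ⟨_, a, c, fun g => ?_, fun e => ⟨fun i j => Algebra.trace K E (a i * e * c j), fun i => ?_,
    fun j => ?_⟩⟩
  · let A : Matrix (Fin (Module.finrank K E)) (E ≃ₐ[K] E) E := Matrix.of fun i g => g (a i)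
    let C : Matrix (E ≃ₐ[K] E) (Fin (Module.finrank K E)) E := Matrix.of fun g i => g (c i)
    have h1 : A * C = 1 := by
      ext i j
      rw [Matrix.mul_apply]
      have h2 := trace_eq_sum_automorphisms (K := K) (a i * c j)
      rw [a.trace_mul_traceDual] at h2
      simp only [map_mul] at h2
      simp only [A, C, Matrix.of_apply, ← h2, Matrix.one_apply]
      by_cases hij : i = j <;> simp [hij]
    have h2 : C * A = 1 := by
      refine (Matrix.mul_eq_one_comm_of_card_eq _ _ _ ?_).mp h1
      rw [Fintype.card_fin, ← Nat.card_eq_fintype_card, IsGalois.card_aut_eq_finrank]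
    have h3 := congrFun (congrFun h2 1) g
    rw [Matrix.mul_apply, Matrix.one_apply] at h3
    simpa [A, C, eq_comm] using h3
  · have h1 := a.sum_repr (a i * e)
    conv_lhs => rw [← h1]
    refine Finset.sum_congr rfl fun j _ => ?_
    have h2 := c.traceDual_repr_apply (a i * e) j
    rw [a.traceDual_traceDual] at h2
    rw [h2]; rfl
  · conv_lhs => rw [← c.sum_repr (c j * e)]
    refine Finset.sum_congr rfl fun i _ => ?_
    rw [a.traceDual_repr_apply, Algebra.traceForm_apply]
    congr 2
    ring

variable {N N' : Type*} [AddCommGroup N] [Module K N] [Module E N] [IsScalarTower K E N]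
  [AddCommGroup N'] [Module K N'] [Module E N'] [IsScalarTower K E N']

/-- The trace of a semilinear action. -/
def galTrace (s : (E ≃ₐ[K] E) → N →ₗ[K] N) (hmul : ∀ g h x, s (g * h) x = s g (s h x)) :
    N →ₗ[K] fixedVectors s :=
  (∑ g, s g).codRestrict _ fun x h => by
    simp only [LinearMap.sum_apply, map_sum, ← hmul]
    exact Fintype.sum_equiv (Equiv.mulLeft h) _ _ fun g => rfl

theorem coe_galTrace (s : (E ≃ₐ[K] E) → N →ₗ[K] N) (hmul : ∀ g h x, s (g * h) x = s g (s h x))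
    (x : N) : (galTrace s hmul x : N) = ∑ g, s g x := by
  change (∑ g, s g) x = _
  rw [LinearMap.sum_apply]

/-- The relation for dual bases gives `x = ∑ i, c i • Tr (a i • x)`: the terms with `g ≠ 1` cancel.
-/
theorem span_fixedVectors (s : (E ≃ₐ[K] E) → N →ₗ[K] N) (hone : ∀ x, s 1 x = x)
    (hmul : ∀ g h x, s (g * h) x = s g (s h x)) (hsmul : ∀ g (e : E) x, s g (e • x) = g e • s g x) :
    Submodule.span E (fixedVectors s : Set N) = ⊤ := by
  classical
  obtain ⟨n, a, c, hac, -⟩ := exists_dual_bases K E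
  refine eq_top_iff.mpr fun x _ => ?_
  have h : x = ∑ i, c i • (galTrace s hmul (a i • x) : N) := by
    simp only [coe_galTrace, hsmul, Finset.smul_sum, smul_smul]
    rw [Finset.sum_comm]
    simp only [← Finset.sum_smul, hac]
    simp [hone]
  rw [h]
  exact sum_mem fun i _ => Submodule.smul_mem _ _ (Submodule.subset_span (Subtype.mem _))

/-- The formula `x = ∑ i, c i • Tr (a i • x)` dictates the extension `M x = ∑ i, c i • f (Tr (a i •
x))`. -/
theorem exists_extend_fixedVectors (s : (E ≃ₐ[K] E) → N →ₗ[K] N)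
    (hmul : ∀ g h x, s (g * h) x = s g (s h x)) (hsmul : ∀ g (e : E) x, s g (e • x) = g e • s g x)
    (f : fixedVectors s →ₗ[K] N') : ∃ M : N →ₗ[E] N', ∀ x : fixedVectors s, M x = f x := by
  classical
  obtain ⟨n, a, c, hac, ht⟩ := exists_dual_bases K E
  refine ⟨{ toFun := fun x => ∑ i, c i • f (galTrace s hmul (a i • x))
            map_add' := fun x y => by simp only [smul_add, map_add, Finset.sum_add_distrib]
            map_smul' := fun e x => ?_ }, fun x => ?_⟩
  -- `E`-linearity: the matrix of `e` on the `a i` passes through the `K`-linear `f` and reappears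
  -- as its transpose on the `c i`.
  · obtain ⟨t, h1, h2⟩ := ht e
    simp only [smul_smul, h1, Finset.sum_smul, map_sum, smul_assoc, map_smul, Finset.smul_sum,
      RingHom.id_apply]
    rw [Finset.sum_comm]
    refine Finset.sum_congr rfl fun j _ => ?_
    rw [mul_comm e, h2, Finset.sum_smul]
    refine Finset.sum_congr rfl fun i _ => ?_
    rw [smul_assoc, smul_comm]
  -- On a fixed vector the trace of `e • x` is `Tr e • x`, so the extension property reduces to `∑
  -- i, c i * Tr (a i) = 1`, which is the orthogonality relation summed over `g`.
  · have h1 : ∀ e : E, galTrace s hmul (e • (x : N)) = Algebra.trace K E e • x := by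
      intro e
      apply Subtype.ext
      rw [coe_galTrace]
      simp only [hsmul]
      rw [Finset.sum_congr rfl fun g _ => by rw [x.2 g], ← Finset.sum_smul,
        ← trace_eq_sum_automorphisms, algebraMap_smul]
      rfl
    change ∑ i, c i • f (galTrace s hmul (a i • (x : N))) = f x
    simp only [h1, map_smul]
    have h2 : ∑ i, c i * algebraMap K E (Algebra.trace K E (a i)) = 1 := by
      simp only [trace_eq_sum_automorphisms, Finset.mul_sum]
      rw [Finset.sum_comm]
      simp [hac]
    conv_rhs => rw [← one_smul E (f x), ← h2, Finset.sum_smul]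
    refine Finset.sum_congr rfl fun i _ => ?_
    rw [mul_smul, algebraMap_smul]

end

/-! ## Descent for lattices -/

section

namespace Lattice
variable {K : Type u} [Field K]

/-- The lattice `L` becomes constant over the extension `E`. -/
def SplitBy (L : Lattice K) (E : IntermediateField K (AlgebraicClosure K)) : Prop :=
  ∀ γ ∈ E.fixingSubgroup, L.ρ γ = 1

theorem SplitBy.mono {L : Lattice K} {E E' : IntermediateField K (AlgebraicClosure K)}
    (h : L.SplitBy E) (hE : E ≤ E') : L.SplitBy E' :=
  fun γ hγ => h γ (IntermediateField.fixingSubgroup_antitone hE hγ)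

/-- The kernel of `L.ρ` is a finite intersection of open stabilizers, namely of the members of a
basis. It is therefore open and contains the fixing subgroup of a finite extension. -/
theorem exists_splitBy (L : Lattice K) :
    ∃ E : IntermediateField K (AlgebraicClosure K), FiniteDimensional K E ∧ L.SplitBy E := by
  have h1 : {γ | L.ρ γ = 1} ∈ nhds (1 : AlgebraicClosure K ≃ₐ[K] AlgebraicClosure K) := by
    let b := Module.Free.chooseBasis ℤ L
    have h2 : {γ | L.ρ γ = 1} = ⋂ i, {γ | L.ρ γ (b i) = b i} := by
      ext γ
      simp only [Set.mem_ofPred_eq, Set.mem_iInter]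
      exact ⟨fun h i => by rw [h]; rfl, fun h => b.ext h⟩
    rw [h2]
    exact (isOpen_iInter_of_finite fun i => L.isOpen_stabilizer _).mem_nhds (by simp)
  rw [krullTopology_mem_nhds_one_iff] at h1
  obtain ⟨E, hE, h⟩ := h1
  exact ⟨E, hE, fun γ hγ => h hγ⟩

theorem SplitBy.splittingField_le [CharZero K] {L : Lattice K}
    {E : IntermediateField K (AlgebraicClosure K)} (h : L.SplitBy E) : L.splittingField ≤ E := by
  rw [← InfiniteGalois.fixedField_fixingSubgroup E]
  intro a ha
  rw [IntermediateField.mem_fixedField_iff]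
  intro γ hγ
  exact L.mem_splittingField.mp ha γ (h γ hγ)

/-- Normality of `E` lets the absolute Galois group act on `E ⊗ L` through `Gal(E/K)`, so that
finite Galois descent applies. -/
theorem exists_normal_splitBy (L L' : Lattice K) :
    ∃ E : IntermediateField K (AlgebraicClosure K), FiniteDimensional K E ∧ Normal K E ∧
      L.SplitBy E ∧ L'.SplitBy E := by
  obtain ⟨F, hF, h⟩ := L.exists_splitBy
  obtain ⟨F', hF', h'⟩ := L'.exists_splitBy
  let F₀ : IntermediateField K (AlgebraicClosure K) := F ⊔ F'
  have : FiniteDimensional K F₀ := IntermediateField.finiteDimensional_sup _ _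
  have hle := IntermediateField.le_normalClosure F₀
  exact ⟨IntermediateField.normalClosure K F₀ (AlgebraicClosure K), inferInstance, inferInstance,
    h.mono (le_sup_left.trans hle), h'.mono (le_sup_right.trans hle)⟩

variable (L : Lattice K) {L' : Lattice K} (E : IntermediateField K (AlgebraicClosure K))

theorem exists_fieldEmb_of_splitBy [CharZero K] {E} (hL : L.SplitBy E)
    {x : AlgebraicClosure K ⊗[ℤ] L} (hx : x ∈ L.deRham) : ∃ y, L.fieldEmb E y = x := by
  obtain ⟨y, rfl⟩ := L.exists_fieldEmb hx
  refine ⟨AlgebraTensorModule.map (IntermediateField.inclusion hL.splittingField_le).toLinearMap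
    LinearMap.id y, ?_⟩
  rw [fieldEmb, fieldEmb, ← LinearMap.comp_apply, ← AlgebraTensorModule.map_comp]
  rfl

variable [Normal K E]

/-- The action of `Gal(E/K)` on `E ⊗ L`, for a lattice `L` that becomes constant over `E`. -/
def finAct (g : E ≃ₐ[K] E) : E ⊗[ℤ] L →ₗ[K] E ⊗[ℤ] L :=
  AlgebraTensorModule.map g.toLinearMap (L.ρ
    (AlgEquiv.restrictNormalHom_surjective (AlgebraicClosure K) g).choose)

variable {E} {L}

/-- Two automorphisms with the same restriction differ by an element that fixes `E`. Hence the lift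
chosen in `finAct` does not matter. -/
theorem SplitBy.ρ_eq (hL : L.SplitBy E) {γ δ : AlgebraicClosure K ≃ₐ[K] AlgebraicClosure K}
    (h : AlgEquiv.restrictNormalHom E γ = AlgEquiv.restrictNormalHom E δ) : L.ρ γ = L.ρ δ := by
  have h1 : γ⁻¹ * δ ∈ E.fixingSubgroup := by
    rw [← IntermediateField.restrictNormalHom_ker, MonoidHom.mem_ker, map_mul, map_inv, h,
      inv_mul_cancel]
  have h2 := hL _ h1
  calc L.ρ γ = L.ρ γ * L.ρ (γ⁻¹ * δ) := by rw [h2, mul_one]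
    _ = L.ρ δ := by rw [← map_mul, mul_inv_cancel_left]

theorem SplitBy.finAct_restrict (hL : L.SplitBy E)
    (γ : AlgebraicClosure K ≃ₐ[K] AlgebraicClosure K) :
    L.finAct E (AlgEquiv.restrictNormalHom E γ) =
      AlgebraTensorModule.map (AlgEquiv.restrictNormalHom E γ).toLinearMap (L.ρ γ) := by
  rw [finAct, hL.ρ_eq (AlgEquiv.restrictNormalHom_surjective (AlgebraicClosure K)
    (AlgEquiv.restrictNormalHom E γ)).choose_spec]

theorem SplitBy.fieldEmb_finAct (hL : L.SplitBy E)
    (γ : AlgebraicClosure K ≃ₐ[K] AlgebraicClosure K) (x : E ⊗[ℤ] L) :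
    L.fieldEmb E (L.finAct E (AlgEquiv.restrictNormalHom E γ) x) = L.galAct γ (L.fieldEmb E x) := by
  rw [hL.finAct_restrict]
  induction x using TensorProduct.induction_on with
  | zero => simp
  | tmul a l =>
    have h1 := AlgEquiv.restrictNormal_commutes γ E a
    exact congrArg (· ⊗ₜ[ℤ] L.ρ γ l) h1
  | add x y hx hy => simp only [map_add, hx, hy]

theorem SplitBy.finAct_one (hL : L.SplitBy E) (x : E ⊗[ℤ] L) : L.finAct E 1 x = x := by
  have h := hL.finAct_restrict 1
  rw [map_one, map_one] at h
  rw [h]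
  exact LinearMap.congr_fun AlgebraTensorModule.map_id x

theorem SplitBy.finAct_mul (hL : L.SplitBy E) (g h : E ≃ₐ[K] E) (x : E ⊗[ℤ] L) :
    L.finAct E (g * h) x = L.finAct E g (L.finAct E h x) := by
  obtain ⟨γ, rfl⟩ := AlgEquiv.restrictNormalHom_surjective (AlgebraicClosure K) g
  obtain ⟨δ, rfl⟩ := AlgEquiv.restrictNormalHom_surjective (AlgebraicClosure K) h
  rw [← map_mul, hL.finAct_restrict, hL.finAct_restrict, hL.finAct_restrict, map_mul, map_mul,
    ← LinearMap.comp_apply, ← AlgebraTensorModule.map_comp]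
  rfl

theorem finAct_smul (g : E ≃ₐ[K] E) (e : E) (x : E ⊗[ℤ] L) :
    L.finAct E g (e • x) = g e • L.finAct E g x := by
  induction x using TensorProduct.induction_on with
  | zero => simp
  | tmul a l =>
    rw [TensorProduct.smul_tmul', finAct, AlgebraTensorModule.map_tmul,
      AlgebraTensorModule.map_tmul, TensorProduct.smul_tmul']
    congr 1
    exact map_mul g e a
  | add x y hx hy => simp only [smul_add, map_add, hx, hy]

/-- The two actions correspond under `fieldEmb`, and every element of `Gal(E/K)` lifts to `K̄`, so
the invariants are the same. -/
theorem SplitBy.mem_fixedVectors_iff (hL : L.SplitBy E) (x : E ⊗[ℤ] L) :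
    x ∈ fixedVectors (L.finAct E) ↔ L.fieldEmb E x ∈ L.deRham := by
  constructor
  · intro h γ
    rw [← hL.fieldEmb_finAct, h]
  · intro h g
    obtain ⟨γ, rfl⟩ := AlgEquiv.restrictNormalHom_surjective (AlgebraicClosure K) g
    apply L.fieldEmb_injective E
    rw [hL.fieldEmb_finAct, h γ]

variable [CharZero K] [FiniteDimensional K E]

theorem SplitBy.span_eq_top (hL : L.SplitBy E) :
    Submodule.span E {x | L.fieldEmb E x ∈ L.deRham} = ⊤ := by
  have : IsGalois K E := {}
  rw [← span_fixedVectors (L.finAct E) hL.finAct_one hL.finAct_mul finAct_smul]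
  congr 1
  ext x
  exact (hL.mem_fixedVectors_iff x).symm

theorem SplitBy.exists_extend (hL : L.SplitBy E) (hL' : L'.SplitBy E)
    (f : L.deRham →ₗ[K] L'.deRham) : ∃ M : E ⊗[ℤ] L →ₗ[E] E ⊗[ℤ] L',
      ∀ x (hx : L.fieldEmb E x ∈ L.deRham), L'.fieldEmb E (M x) = f ⟨_, hx⟩ := by
  have : IsGalois K E := {}
  let e : fixedVectors (L.finAct E) →ₗ[K] L.deRham :=
    (L.fieldEmb E).restrict fun x hx => (hL.mem_fixedVectors_iff x).mp hx
  -- Since `L'` becomes constant over `E`, all of `L'.deRham` lies in the image of `E ⊗ L'`; so `f`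
  -- can be read with values in `E ⊗ L'`.
  let e' : LinearMap.range (L'.fieldEmb E) →ₗ[K] E ⊗[ℤ] L' :=
    (LinearEquiv.ofInjective (L'.fieldEmb E) (L'.fieldEmb_injective E)).symm.toLinearMap
  let i : L'.deRham →ₗ[K] LinearMap.range (L'.fieldEmb E) :=
    Submodule.inclusion fun x hx => L'.exists_fieldEmb_of_splitBy hL' hx
  obtain ⟨M, hM⟩ := exists_extend_fixedVectors (L.finAct E) hL.finAct_mul finAct_smul
    (e' ∘ₗ i ∘ₗ f ∘ₗ e)
  refine ⟨M, fun x hx => ?_⟩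
  rw [hM ⟨x, (hL.mem_fixedVectors_iff x).mpr hx⟩]
  exact congrArg Subtype.val
    ((LinearEquiv.ofInjective (L'.fieldEmb E) (L'.fieldEmb_injective E)).apply_symm_apply _)

end Lattice

end

/-! ## Compatibility with the Frobenius maps -/

section

namespace Lattice
variable {K : Type u} [Field K] [NumberField K] {L L' : Lattice K}
variable {v : HeightOneSpectrum (𝓞 K)} {E : IntermediateField K (AlgebraicClosure K)}

/-- Multiplication by an element of `K_v ⊗_K E` on `(K_v ⊗_K E) ⊗ L`. -/
def localMul (b : v.adicCompletion K ⊗[K] E) :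
    (v.adicCompletion K ⊗[K] E) ⊗[ℤ] L →ₗ[ℤ] (v.adicCompletion K ⊗[K] E) ⊗[ℤ] L :=
  TensorProduct.map (AddMonoidHom.mulLeft b).toIntLinearMap LinearMap.id

@[simp] theorem localMul_tmul (b c : v.adicCompletion K ⊗[K] E) (l : L) :
    localMul b (c ⊗ₜ[ℤ] l) = (b * c) ⊗ₜ l := rfl

theorem localMul_add (b c : v.adicCompletion K ⊗[K] E) (x : (v.adicCompletion K ⊗[K] E) ⊗[ℤ] L) :
    localMul (b + c) x = localMul b x + localMul c x := by
  induction x using TensorProduct.induction_on with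
  | zero => simp only [map_zero, add_zero]
  | tmul a l => rw [localMul_tmul, localMul_tmul, localMul_tmul, add_mul, add_tmul]
  | add x y hx hy => simp only [map_add, hx, hy]; abel

theorem localMul_mul (b c : v.adicCompletion K ⊗[K] E) (x : (v.adicCompletion K ⊗[K] E) ⊗[ℤ] L) :
    localMul (b * c) x = localMul b (localMul c x) := by
  induction x using TensorProduct.induction_on with
  | zero => simp only [map_zero]
  | tmul a l => rw [localMul_tmul, localMul_tmul, localMul_tmul, mul_assoc]
  | add x y hx hy => simp only [map_add, hx, hy]

theorem localMul_one (x : (v.adicCompletion K ⊗[K] E) ⊗[ℤ] L) : localMul 1 x = x := by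
  induction x using TensorProduct.induction_on with
  | zero => simp only [map_zero]
  | tmul a l => rw [localMul_tmul, one_mul]
  | add x y hx hy => simp only [map_add, hx, hy]

theorem localMul_tmul_one (c : v.adicCompletion K) (x : (v.adicCompletion K ⊗[K] E) ⊗[ℤ] L) :
    localMul (c ⊗ₜ[K] 1) x = c • x := by
  induction x using TensorProduct.induction_on with
  | zero => simp only [map_zero, smul_zero]
  | tmul a l =>
    rw [localMul_tmul, TensorProduct.smul_tmul']
    exact congrArg (· ⊗ₜ[ℤ] l) (Algebra.smul_def (A := v.adicCompletion K ⊗[K] E) c a).symm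
  | add x y hx hy => simp only [map_add, smul_add, hx, hy]

variable (L v E) in
/-- The map `E ⊗ L → (K_v ⊗_K E) ⊗ L`. -/
def toLocal : E ⊗[ℤ] L →ₗ[K] (v.adicCompletion K ⊗[K] E) ⊗[ℤ] L :=
  (L.assocEquiv v E).symm.toLinearMap.restrictScalars K ∘ₗ
    TensorProduct.mk K (v.adicCompletion K) (E ⊗[ℤ] L) 1

@[simp] theorem toLocal_tmul (a : E) (l : L) :
    L.toLocal v E (a ⊗ₜ l) = ((1 : v.adicCompletion K) ⊗ₜ[K] a) ⊗ₜ l := rfl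

theorem toLocal_smul (e : E) (x : E ⊗[ℤ] L) :
    L.toLocal v E (e • x) = localMul (1 ⊗ₜ[K] e) (L.toLocal v E x) := by
  induction x using TensorProduct.induction_on with
  | zero => simp only [smul_zero, map_zero]
  | tmul a l =>
    rw [TensorProduct.smul_tmul', toLocal_tmul, toLocal_tmul, localMul_tmul, smul_eq_mul,
      Algebra.TensorProduct.tmul_mul_tmul, one_mul]
  | add x y hx hy => simp only [smul_add, map_add, hx, hy]

theorem localEmb_smul_toLocal (c : v.adicCompletion K) (x : E ⊗[ℤ] L) :
    L.localEmb v E (c • L.toLocal v E x) = c ⊗ₜ L.fieldEmb E x := by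
  have h : L.localEmb v E (L.toLocal v E x) = 1 ⊗ₜ L.fieldEmb E x := by
    rw [localEmb, LinearMap.comp_apply]
    change (L.fieldEmb E).baseChange (v.adicCompletion K)
      (L.assocEquiv v E ((L.assocEquiv v E).symm (1 ⊗ₜ x))) = _
    rw [LinearEquiv.apply_symm_apply, LinearMap.baseChange_tmul]
  rw [map_smul, h, TensorProduct.smul_tmul', smul_eq_mul, mul_one]

/-- `frobOver` is a ring automorphism, so the Frobenius is semilinear over all of `K_v ⊗_K E`. This
is what carries commutation from the invariants to their `E`-span. -/
theorem localFrob_localMul (b : v.adicCompletion K ⊗[K] E)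
    (x : (v.adicCompletion K ⊗[K] E) ⊗[ℤ] L) :
    L.localFrob v E (localMul b x) = localMul (frobOver v E b) (L.localFrob v E x) := by
  induction x using TensorProduct.induction_on with
  | zero => simp only [map_zero]
  | tmul y l => rw [localMul_tmul, localFrob_tmul, localFrob_tmul, localMul_tmul, map_mul]
  | add x y hx hy => simp only [map_add, hx, hy]

variable (v) in
/-- The `K_v ⊗_K E`-linear extension of an `E`-linear map. -/
def localExtend (M : E ⊗[ℤ] L →ₗ[E] E ⊗[ℤ] L') :
    (v.adicCompletion K ⊗[K] E) ⊗[ℤ] L →+ (v.adicCompletion K ⊗[K] E) ⊗[ℤ] L' :=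
  TensorProduct.liftAddHom
    (AddMonoidHom.mk' (fun b => AddMonoidHom.mk' (fun l => localMul b (L'.toLocal v E (M (1 ⊗ₜ l))))
        fun l l' => by rw [tmul_add, map_add, map_add, map_add])
      fun b b' => AddMonoidHom.ext fun l => localMul_add b b' _)
    fun n b l => by
      change localMul (n • b) _ = localMul b (L'.toLocal v E (M (1 ⊗ₜ (n • l))))
      rw [tmul_smul, map_zsmul, map_zsmul, map_zsmul]
      exact map_zsmul (AddMonoidHom.mk' (fun b => localMul b (L'.toLocal v E (M (1 ⊗ₜ l))))
        fun b b' => localMul_add b b' _) n b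

theorem localExtend_tmul (M : E ⊗[ℤ] L →ₗ[E] E ⊗[ℤ] L') (b : v.adicCompletion K ⊗[K] E) (l : L) :
    localExtend v M (b ⊗ₜ l) = localMul b (L'.toLocal v E (M (1 ⊗ₜ l))) := rfl

theorem localExtend_localMul (M : E ⊗[ℤ] L →ₗ[E] E ⊗[ℤ] L') (b : v.adicCompletion K ⊗[K] E)
    (x : (v.adicCompletion K ⊗[K] E) ⊗[ℤ] L) :
    localExtend v M (localMul b x) = localMul b (localExtend v M x) := by
  induction x using TensorProduct.induction_on with
  | zero => simp only [map_zero]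
  | tmul a l => rw [localMul_tmul, localExtend_tmul, localExtend_tmul, localMul_mul]
  | add x y hx hy => simp only [map_add, hx, hy]

theorem localExtend_toLocal (M : E ⊗[ℤ] L →ₗ[E] E ⊗[ℤ] L') (x : E ⊗[ℤ] L) :
    localExtend v M (L.toLocal v E x) = L'.toLocal v E (M x) := by
  induction x using TensorProduct.induction_on with
  | zero => simp only [map_zero]
  | tmul a l =>
    rw [toLocal_tmul, localExtend_tmul, ← toLocal_smul, ← map_smul, TensorProduct.smul_tmul',
      smul_eq_mul, mul_one]
  | add x y hx hy => simp only [map_add, hx, hy]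

theorem localExtend_smul (M : E ⊗[ℤ] L →ₗ[E] E ⊗[ℤ] L') (c : v.adicCompletion K)
    (x : (v.adicCompletion K ⊗[K] E) ⊗[ℤ] L) :
    localExtend v M (c • x) = c • localExtend v M x := by
  rw [← localMul_tmul_one, localExtend_localMul, localMul_tmul_one]

/-! ### Commutation of the extended map with Frobenius -/

section

variable {f : L.deRham →ₗ[K] L'.deRham} {M : E ⊗[ℤ] L →ₗ[E] E ⊗[ℤ] L'}

theorem localEmb_localExtend (hL : L.SplitBy E)
    (hM : ∀ x (hx : L.fieldEmb E x ∈ L.deRham), L'.fieldEmb E (M x) = f ⟨_, hx⟩)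
    (t : v.adicCompletion K ⊗[K] L.deRham) (y : (v.adicCompletion K ⊗[K] E) ⊗[ℤ] L)
    (hy : L.localEmb v E y = L.comparison v t) :
    L'.localEmb v E (localExtend v M y) =
      L'.comparison v (f.baseChange (v.adicCompletion K) t) := by
  -- As `localEmb` is injective, `t` determines `y`. It is therefore enough to find one suitable
  -- preimage for each `t`, which can be done on pure tensors.
  have key : ∃ y, L.localEmb v E y = L.comparison v t ∧ L'.localEmb v E (localExtend v M y) =
      L'.comparison v (f.baseChange (v.adicCompletion K) t) := by
    clear hy
    induction t using TensorProduct.induction_on with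
    | zero => exact ⟨0, by simp, by simp⟩
    | tmul c d =>
      obtain ⟨d, hd⟩ := d
      obtain ⟨x, rfl⟩ := L.exists_fieldEmb_of_splitBy hL hd
      refine ⟨c • L.toLocal v E x, localEmb_smul_toLocal c x, ?_⟩
      rw [localExtend_smul, localExtend_toLocal, localEmb_smul_toLocal, hM x hd]
      rfl
    | add t t' ht ht' =>
      obtain ⟨y, h1, h2⟩ := ht
      obtain ⟨y', h1', h2'⟩ := ht'
      refine ⟨y + y', ?_, ?_⟩
      · rw [map_add, map_add, h1, h1']; rfl
      · rw [map_add, map_add, map_add, map_add, h2, h2']; rfl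
  obtain ⟨y', h1, h2⟩ := key
  rw [L.localEmb_injective v E (hy.trans h1.symm), h2]

/-- The extension of `M` commutes with Frobenius on the invariants, where it is `φ`. It is linear,
Frobenius is semilinear, and the invariants span `E ⊗ L`, so they commute on all of `E ⊗ L`. The
vector `1 ⊗ l` is fixed by Frobenius, hence so is its image. -/
theorem localFrob_toLocal_eq [FiniteDimensional K E] [Normal K E]
    (hL : L.SplitBy E) (hL' : L'.SplitBy E)
    (hM : ∀ x (hx : L.fieldEmb E x ∈ L.deRham), L'.fieldEmb E (M x) = f ⟨_, hx⟩)
    (hX : v ∈ L.goodPlaces) (hY : v ∈ L'.goodPlaces) (hE : IsUnramifiedIn v E)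
    (φ : L.crys v →ₗ[v.adicCompletion K] L'.crys v)
    (hφ : ∀ x, φ (L.comparison v x) = L'.comparison v (f.baseChange (v.adicCompletion K) x))
    (hφF : ∀ x, φ (L.crysFrob v hX.1 hX.2 x) = L'.crysFrob v hY.1 hY.2 (φ x)) (l : L) :
    L'.localFrob v E (L'.toLocal v E (M (1 ⊗ₜ l))) = L'.toLocal v E (M (1 ⊗ₜ l)) := by
  have hφ' : ∀ (z : L.crys v) (y : (v.adicCompletion K ⊗[K] E) ⊗[ℤ] L), L.localEmb v E y = z →
      L'.localEmb v E (localExtend v M y) = φ z := by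
    intro z y hy
    obtain ⟨t, rfl⟩ := (L.comparison v).surjective z
    rw [hφ]
    exact localEmb_localExtend hL hM t y hy
  -- Both sides have the same image under `localEmb`, namely the Frobenius of `φ z`. The Frobenius
  -- of `crys` can be computed over `E` because `E` contains the splitting fields.
  have hD : ∀ x, L.fieldEmb E x ∈ L.deRham →
      localExtend v M (L.localFrob v E (L.toLocal v E x)) =
        L'.localFrob v E (L'.toLocal v E (M x)) := by
    intro x hx
    let z : L.crys v := L.comparison v (1 ⊗ₜ ⟨_, hx⟩)
    have hz : L.localEmb v E (L.toLocal v E x) = z := by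
      have := localEmb_smul_toLocal (v := v) 1 x
      rw [one_smul] at this
      exact this
    have h1 := L.coe_crysFrob hX.1 hX.2 z E hL.splittingField_le hE _ hz
    have h2 := hφ' _ _ h1.symm
    have h3 := L'.coe_crysFrob hY.1 hY.2 (φ z) E hL'.splittingField_le hE _ (hφ' z _ hz)
    rw [hφF, h3] at h2
    rw [L'.localEmb_injective v E h2, localExtend_toLocal]
  have hall : ∀ x, localExtend v M (L.localFrob v E (L.toLocal v E x)) =
        L'.localFrob v E (L'.toLocal v E (M x)) := by
    intro x
    have hx : x ∈ Submodule.span E {x | L.fieldEmb E x ∈ L.deRham} := by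
      rw [hL.span_eq_top]; exact Submodule.mem_top
    induction hx using Submodule.span_induction with
    | mem x hx => exact hD x hx
    | zero => simp
    | add x y _ _ hx hy => simp only [map_add, hx, hy]
    | smul e x _ hx =>
      rw [toLocal_smul, localFrob_localMul, localExtend_localMul, hx, map_smul, toLocal_smul,
        localFrob_localMul]
  have h := hall (1 ⊗ₜ l)
  rw [← h, toLocal_tmul, localFrob_tmul, localExtend_tmul]
  have : frobOver v E ((1 : v.adicCompletion K) ⊗ₜ[K] (1 : E)) = 1 := map_one _
  rw [this, localMul_one]

/-- Frobenius acts on the first tensor factor only, so it acts coordinatewise with respect to a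
basis of the lattice. -/
theorem frobOver_coord {ι : Type*} [DecidableEq ι] (β : Module.Basis ι ℤ L') (y : E ⊗[ℤ] L')
    (hy : L'.localFrob v E (L'.toLocal v E y) = L'.toLocal v E y) (j : ι) :
    frobOver v E ((1 : v.adicCompletion K) ⊗ₜ[K] TensorProduct.equivFinsuppOfBasisRight β y j) =
      1 ⊗ₜ TensorProduct.equivFinsuppOfBasisRight β y j := by
  have h1 : ∀ z : (v.adicCompletion K ⊗[K] E) ⊗[ℤ] L',
      TensorProduct.equivFinsuppOfBasisRight β (L'.localFrob v E z) j =
        frobOver v E (TensorProduct.equivFinsuppOfBasisRight β z j) := by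
    intro z
    induction z using TensorProduct.induction_on with
    | zero => simp
    | tmul b l => simp
    | add x y hx hy => simp only [map_add, Finsupp.add_apply, hx, hy]
  have h2 : ∀ z : E ⊗[ℤ] L', TensorProduct.equivFinsuppOfBasisRight β (L'.toLocal v E z) j =
      (1 : v.adicCompletion K) ⊗ₜ[K] TensorProduct.equivFinsuppOfBasisRight β z j := by
    intro z
    induction z using TensorProduct.induction_on with
    | zero => simp
    | tmul b l =>
      rw [toLocal_tmul, TensorProduct.equivFinsuppOfBasisRight_apply_tmul_apply,
        TensorProduct.equivFinsuppOfBasisRight_apply_tmul_apply]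
      exact (map_zsmul (TensorProduct.mk K (v.adicCompletion K) E 1) _ b).symm
    | add x y hx hy => simp only [map_add, Finsupp.add_apply, hx, hy, tmul_add]
  rw [← h2, ← h1, hy]

end

/-! ## Fullness -/

/-- A map to `E ⊗ L'` with rational coordinates comes from a map to `L'`, up to a denominator. -/
theorem exists_zsmul_eq_tmul (M : L →ₗ[ℤ] E ⊗[ℤ] L')
    {ι : Type*} [Finite ι] [DecidableEq ι] (β : Module.Basis ι ℤ L')
    (hM : ∀ l j, TensorProduct.equivFinsuppOfBasisRight β (M l) j ∈ Set.range (algebraMap ℚ E)) :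
    ∃ (d : ℤ) (h : L →ₗ[ℤ] L'), d ≠ 0 ∧ ∀ l, d • M l = 1 ⊗ₜ h l := by
  have := Fintype.ofFinite ι
  let b := Module.Free.chooseBasis ℤ L
  choose q hq using fun x : Module.Free.ChooseBasisIndex ℤ L × ι => hM (b x.1) x.2
  -- A common denominator of the finitely many matrix entries; the integers `n` are the entries of
  -- `h`.
  obtain ⟨d, hd⟩ := IsLocalization.exist_integer_multiples_of_finite (nonZeroDivisors ℤ) q
  choose n hn using hd
  let h : L →ₗ[ℤ] L' := b.constr ℤ fun i => ∑ j, n (i, j) • β j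
  refine ⟨d, h, nonZeroDivisors.coe_ne_zero d, fun l => ?_⟩
  have h1 : ∀ i, (d : ℤ) • M (b i) = 1 ⊗ₜ h (b i) := by
    intro i
    apply (TensorProduct.equivFinsuppOfBasisRight (M := E) β).injective
    ext1 j
    have h1 : h (b i) = ∑ j, n (i, j) • β j := b.constr_basis _ _ _
    have h2 := congrArg (algebraMap ℚ E) (hn (i, j))
    rw [map_zsmul, Finsupp.smul_apply, ← hq (i, j), ← map_zsmul, ← h2,
      TensorProduct.equivFinsuppOfBasisRight_apply_tmul_apply, h1, β.repr_sum_self, zsmul_eq_mul,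
      mul_one]
    simp only [eq_intCast, map_intCast]
  have h2 : (zsmulAddGroupHom (d : ℤ)).comp M.toAddMonoidHom =
      (TensorProduct.mk ℤ E L' 1).toAddMonoidHom.comp h.toAddMonoidHom := by
    have h3 := b.ext (f₁ := ((zsmulAddGroupHom (d : ℤ)).comp M.toAddMonoidHom).toIntLinearMap)
      (f₂ := ((TensorProduct.mk ℤ E L' 1).toAddMonoidHom.comp h.toAddMonoidHom).toIntLinearMap) h1
    exact congrArg LinearMap.toAddMonoidHom h3
  exact DFunLike.congr_fun h2 l

theorem mapTensor_fieldEmb (h : L →ₗ[ℤ] L') (x : E ⊗[ℤ] L) :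
    mapTensor h (L.fieldEmb E x) = L'.fieldEmb E (h.baseChange E x) := by
  induction x using TensorProduct.induction_on with
  | zero => simp
  | tmul a l => rfl
  | add x y hx hy => simp only [map_add, hx, hy]

/-- The coordinates of `1 ⊗ l` are those of `l` seen in `E`, which has characteristic zero. -/
theorem one_tmul_injective : Function.Injective fun l : L => (1 : E) ⊗ₜ[ℤ] l := by
  intro l l' h
  let b := Module.Free.chooseBasis ℤ L
  apply b.repr.injective
  ext i
  have h1 := congrArg (fun x => TensorProduct.equivFinsuppOfBasisRight (M := E) b x i) h
  simpa using h1

/-- On an invariant `x`, both `h ∘ ρ γ` and `ρ' γ ∘ h` become `h x` after `γ` is applied to the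
field factor: in one case because `x` is invariant, in the other because `h x` is. As `γ` is
injective and the invariants span `E ⊗ L`, the two maps agree. -/
theorem mem_hom_of_mapTensor_eq [FiniteDimensional K E] [Normal K E] (hL : L.SplitBy E)
    {h : L →ₗ[ℤ] L'} (hh : ∀ x ∈ L.deRham, mapTensor h x ∈ L'.deRham) :
    h ∈ Lattice.Hom L L' := by
  intro γ
  -- The action of `γ` on the field factor alone, to be cancelled at the end.
  let Γ : AlgebraicClosure K ⊗[ℤ] L' →ₗ[K] AlgebraicClosure K ⊗[ℤ] L' :=
    AlgebraTensorModule.map γ.toLinearMap LinearMap.id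
  have hΓ : Function.Injective Γ := by
    refine Function.LeftInverse.injective (g := AlgebraTensorModule.map (R := ℤ) (A := K)
      γ.symm.toLinearMap (LinearMap.id : L' →ₗ[ℤ] L')) fun x => ?_
    rw [← LinearMap.comp_apply, ← AlgebraTensorModule.map_comp]
    have : γ.symm.toLinearMap ∘ₗ γ.toLinearMap = LinearMap.id := by
      ext a; simp
    rw [this, LinearMap.id_comp, AlgebraTensorModule.map_id]
    rfl
  have h1 : Γ ∘ₗ mapTensor (h ∘ₗ L.ρ γ) = mapTensor h ∘ₗ L.galAct γ := by
    simp only [Γ, mapTensor, galAct, ← AlgebraTensorModule.map_comp]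
    rfl
  have h2 : Γ ∘ₗ mapTensor (L'.ρ γ ∘ₗ h) = L'.galAct γ ∘ₗ mapTensor h := by
    simp only [Γ, mapTensor, galAct, ← AlgebraTensorModule.map_comp]
    rfl
  have h3 : (h ∘ₗ L.ρ γ).baseChange E = (L'.ρ γ ∘ₗ h).baseChange E := by
    refine LinearMap.ext_on hL.span_eq_top fun x hx => ?_
    apply L'.fieldEmb_injective E
    rw [← mapTensor_fieldEmb, ← mapTensor_fieldEmb]
    apply hΓ
    rw [← LinearMap.comp_apply, h1, ← LinearMap.comp_apply (f := Γ), h2, LinearMap.comp_apply,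
      LinearMap.comp_apply, hx γ, hh _ hx γ]
  ext l
  exact one_tmul_injective (E := E) (LinearMap.congr_fun h3 (1 ⊗ₜ l))

/-- Every morphism between the realizations of lattices comes from a morphism of lattices up to
isogeny. -/
theorem realize_surjective {f : L.deRham →ₗ[K] L'.deRham} (hf : IsOgHom L.toOg L'.toOg f) :
    ∃ x, realize L L' x = f := by
  obtain ⟨E, _, _, hL, hL'⟩ := exists_normal_splitBy L L'
  obtain ⟨M, hM⟩ := hL.exists_extend hL' f
  classical
  let β := Module.Free.chooseBasis ℤ L'
  have hrat : ∀ l j, TensorProduct.equivFinsuppOfBasisRight β (M (1 ⊗ₜ l)) j ∈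
      Set.range (algebraMap ℚ E) := by
    intro l j
    refine mem_range_of_frobOver_eq (K := K) ?_
    filter_upwards [hf, eventually_cofinite.mpr (finite_not_isUnramifiedIn K E)] with v hv hE
    obtain ⟨hX, hY, φ, h1, h2⟩ := hv
    exact frobOver_coord β _ (localFrob_toLocal_eq hL hL' hM hX hY hE φ h1 h2 l) j
  obtain ⟨d, h, hd, hh⟩ := exists_zsmul_eq_tmul
    (M.restrictScalars ℤ ∘ₗ TensorProduct.mk ℤ E L 1) β hrat
  -- Both sides are `E`-linear and agree on the vectors `1 ⊗ l`.
  have hbase : d • M = h.baseChange E := by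
    refine AlgebraTensorModule.ext fun e l => ?_
    have h1 := congrArg (e • ·) (hh l)
    have h2 : (e ⊗ₜ l : E ⊗[ℤ] L) = e • (1 ⊗ₜ l) := by
      rw [TensorProduct.smul_tmul', smul_eq_mul, mul_one]
    rw [LinearMap.smul_apply, h2, map_smul, map_smul, smul_comm]
    exact h1
  have hfh : ∀ x : L.deRham, mapTensor h x = d • (f x : AlgebraicClosure K ⊗[ℤ] L') := by
    rintro ⟨x, hx⟩
    obtain ⟨y, rfl⟩ := L.exists_fieldEmb_of_splitBy hL hx
    rw [mapTensor_fieldEmb, ← hbase, LinearMap.smul_apply, map_zsmul, hM y hx]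
  -- On invariants `h` is `d • f`, so it takes them to invariants.
  have hhom : h ∈ Lattice.Hom L L' := by
    refine mem_hom_of_mapTensor_eq hL fun x hx => ?_
    rw [hfh ⟨x, hx⟩]
    exact zsmul_mem (f ⟨x, hx⟩).2 d
  refine ⟨(d : ℚ)⁻¹ ⊗ₜ ⟨h, hhom⟩, ?_⟩
  rw [realize_tmul]
  ext x
  have h1 : deRhamMap ⟨h, hhom⟩ x = (d : K) • f x := by
    apply Subtype.ext
    refine (hfh x).trans ?_
    rw [Submodule.coe_smul, Int.cast_smul_eq_zsmul]
  have hd' : (d : K) ≠ 0 := by exact_mod_cast hd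
  rw [LinearMap.smul_apply, h1, map_inv₀, map_intCast, inv_smul_smul₀ hd']

end Lattice

end

end OgusRealization

end

theorem lemma3p8 (K : Type*) [Field K] [NumberField K] :
    (OgusRealization.ogusRealization K).Full := by
  refine ⟨fun {M N} f => ?_⟩
  obtain ⟨x, hx⟩ := OgusRealization.Lattice.realize_surjective f.hom.isOgHom
  -- Morphisms in `FOg` carry no condition on the filtration and are determined by the underlying
  -- `K`-linear map.
  exact ⟨x, OgusRealization.FOg.Hom.ext (OgusRealization.Og.Hom.ext hx)⟩
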